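/- Let $\Bbbk$ be a field of characteristic $0$ and $G$ a finitely generated group. Let $I$ be the augmentation ideal of the Hopf algebra $\Bbbk G$, let $\widehat{\Bbbk G}=\varprojlim_n \Bbbk G/I^n$, with filtration $\widehat{I^n}=\ker(\widehat{\Bbbk G}\to \Bbbk G/I^n)$ and the comultiplication $\widehat\Delta$ induced by $\Delta(g)=g\otimes g$, and let $\widehat{\mathrm{gr}}(\Bbbk G)=\prod_{n\ge 0} I^n/I^{n+1}$, with filtration $\prod_{j\ge n}I^j/I^{j+1}$ and comultiplication $\bar\Delta=\widehat{\mathrm{gr}}(\Delta)$. Let $\mathfrak m(G;\Bbbk)$ be the Malcev Lie algebra, i.e. the Lie algebra of primitive elements of $\widehat{\Bbbk G}$, filtered by its intersections with the $\widehat{I^n}$. Let $\mathrm{gr}(G;\Bbbk)=\bigoplus_{n\ge1}(\Gamma_nG/\Gamma_{n+1}G)\otimes\Bbbk$ be the associated graded Lie algebra of the lower central series, with bracket induced by the group commutator, and $\widehat{\mathrm{gr}}(G;\Bbbk)$ its degree completion, with filtration by degree. A Taylor expansion of $G$ is a multiplicative map $E\colon G\to\widehat{\mathrm{gr}}(\Bbbk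 G)$ with $\bar\Delta(E(g))=E(g)\hat\otimes E(g)$ for all $g\in G$, whose linear extension $\bar E\colon \Bbbk G\to\widehat{\mathrm{gr}}(\Bbbk G)$ preserves filtrations and satisfies $\mathrm{gr}(\bar E)=\mathrm{id}$. Let $\widehat E\colon\widehat{\Bbbk G}\to\widehat{\mathrm{gr}}(\Bbbk G)$ be the map induced by $\bar E$ on the completion. For a Lie algebra $L$, let $\widehat U(L)$ be the completion of its universal enveloping algebra with respect to the powers of the augmentation ideal. **Theorem.** The canonical map $q\colon\widehat{\mathrm{gr}}(G;\Bbbk)\to\widehat{\mathrm{gr}}(\Bbbk G)$, $[g]\otimes c\mapsto c\,[g-1]$, is an isomorphism of Lie algebras onto the primitive elements of $\widehat{\mathrm{gr}}(\Bbbk G)$, and the maps $\theta_1\colon \widehat U(\mathfrak m(G;\Bbbk))\to\widehat{\Bbbk G}$ and $\theta_2\colon\widehat U(\widehat{\mathrm{gr}}(G;\Bbbk))\to\widehat{\mathrm{gr}}(\Bbbk G)$ induced by the inclusion of $\mathfrak m(G;\Bbbk)$ and by $q$ are bijective. With these identifications, there is a one-to-one correspondence between Taylor expansions $E\colon G\to\widehat{\mathrm{gr}}(\Bbbk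 G)$ and filtration-preserving Lie algebra isomorphisms $\alpha\colon\mathfrak m(G;\Bbbk)\to\widehat{\mathrm{gr}}(G;\Bbbk)$ which induce the identity on $\mathrm{gr}(G;\Bbbk)$ (that is, whenever $x\in\mathfrak m(G;\Bbbk)$ is congruent to $a\in I^n$ modulo $\widehat{I^{n+1}}$, the degree-$n$ component of $q(\alpha(x))$ is the class of $a$ in $I^n/I^{n+1}$). It is obtained as follows. For every Taylor expansion $E$, the map $\widehat E$ is a filtration-preserving isomorphism of complete Hopf algebras with $\mathrm{gr}(\widehat E)=\mathrm{id}$, and the corresponding $\alpha$ is the restriction of $\widehat E$ to primitive elements, i.e. $q(\alpha(x))=\widehat E(x)$ for all $x\in\mathfrak m(G;\Bbbk)$. Conversely, the Taylor expansion $E$ corresponding to $\alpha$ satisfies $\widehat E\circ\theta_1=\theta_2\circ\widehat U(\alpha)$. -/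

import Mathlib

open scoped TensorProduct

attribute [local instance 100] LieRing.ofAssociativeRing

set_option linter.unusedSectionVars false

noncomputable section

namespace TaylorExp

section Adic

variable (k : Type*) {A : Type*} [Field k] [Ring A] [Algebra k A] (I : Ideal A) [I.IsTwoSided]

/-- The power `I ^ n` of a two-sided ideal, as a `k`-subspace of `A`. -/
def pow (n : ℕ) : Submodule k A := (I ^ n).restrictScalars k

theorem mem_pow {n : ℕ} {a : A} : a ∈ pow k I n ↔ a ∈ I ^ n := Iff.rfl

theorem one_mem_pow_zero : (1 : A) ∈ pow k I 0 := by
  rw [mem_pow, Submodule.pow_zero, Ideal.one_eq_top]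
  trivial

theorem mul_mem_pow {m n : ℕ} {a b : A} (ha : a ∈ pow k I m) (hb : b ∈ pow k I n) :
    a * b ∈ pow k I (m + n) := by
  rw [mem_pow, Ideal.IsTwoSided.pow_add]
  exact Ideal.mul_mem_mul ha hb

/-- The projection `A ⧸ I ^ n → A ⧸ I ^ m` for `m ≤ n`. -/
def transition {m n : ℕ} (h : m ≤ n) : (A ⧸ I ^ n) →ₐ[k] (A ⧸ I ^ m) :=
  Ideal.Quotient.factorₐ k (Ideal.pow_le_pow_right h)

/-- The algebra of compatible families in `∏ A ⧸ I ^ n`. -/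
def completionSubalgebra : Subalgebra k (∀ n, A ⧸ I ^ n) where
  carrier := {x | ∀ m n (h : m ≤ n), transition k I h (x n) = x m}
  mul_mem' hx hy m n h := by simp [hx m n h, hy m n h]
  add_mem' hx hy m n h := by simp [hx m n h, hy m n h]
  algebraMap_mem' r m n h := by simp

/-- The `I`-adic completion `lim A ⧸ I ^ n`. -/
def Completion : Type _ := completionSubalgebra k I

instance Completion.instRing : Ring (Completion k I) :=
  inferInstanceAs (Ring (completionSubalgebra k I))
instance Completion.instAlgebra : Algebra k (Completion k I) :=
  inferInstanceAs (Algebra k (completionSubalgebra k I))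

/-- The canonical map from `A` to its `I`-adic completion. -/
def toCompletion : A →ₐ[k] Completion k I :=
  AlgHom.codRestrict (AlgHom.pi fun n => Ideal.Quotient.mkₐ k (I ^ n)) (completionSubalgebra k I)
    fun _ _ _ _ => rfl

/-- The projection of the completion to `A ⧸ I ^ n`. -/
def Completion.proj (n : ℕ) : Completion k I →ₐ[k] (A ⧸ I ^ n) :=
  (Pi.evalAlgHom k (fun n => A ⧸ I ^ n) n).comp (completionSubalgebra k I).val

/-- The algebra of compatible families in `∏ (A ⧸ I ^ n) ⊗ (A ⧸ I ^ n)`. -/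
def completedTensorSubalgebra : Subalgebra k (∀ n, (A ⧸ I ^ n) ⊗[k] (A ⧸ I ^ n)) where
  carrier := {x | ∀ m n (h : m ≤ n),
    Algebra.TensorProduct.map (transition k I h) (transition k I h) (x n) = x m}
  mul_mem' hx hy m n h := by simp [hx m n h, hy m n h]
  add_mem' hx hy m n h := by simp [hx m n h, hy m n h]
  algebraMap_mem' r m n h := by simp

/-- The completed tensor square `lim (A ⧸ I ^ n) ⊗ (A ⧸ I ^ n)` of the `I`-adic completion. -/
def CompletedTensor : Type _ := completedTensorSubalgebra k I

instance CompletedTensor.instRing : Ring (CompletedTensor k I) :=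
  inferInstanceAs (Ring (completedTensorSubalgebra k I))
instance CompletedTensor.instAlgebra : Algebra k (CompletedTensor k I) :=
  inferInstanceAs (Algebra k (completedTensorSubalgebra k I))

/-- The projection of the completed tensor square to `(A ⧸ I ^ n) ⊗ (A ⧸ I ^ n)`. -/
def CompletedTensor.proj (n : ℕ) : CompletedTensor k I →ₐ[k] (A ⧸ I ^ n) ⊗[k] (A ⧸ I ^ n) :=
  (Pi.evalAlgHom k (fun n => (A ⧸ I ^ n) ⊗[k] (A ⧸ I ^ n)) n).comp
    (completedTensorSubalgebra k I).val

theorem CompletedTensor.ext {x y : CompletedTensor k I}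
    (h : ∀ n, CompletedTensor.proj k I n x = CompletedTensor.proj k I n y) : x = y :=
  Subtype.ext (funext h)

/-- A compatible family of algebra maps to `A ⧸ I ^ n` gives an algebra map to the completion. -/
def Completion.lift {B : Type*} [Ring B] [Algebra k B] (f : ∀ n : ℕ, B →ₐ[k] A ⧸ I ^ n)
    (hf : ∀ m n (h : m ≤ n) b, transition k I h (f n b) = f m b) : B →ₐ[k] Completion k I :=
  AlgHom.codRestrict (AlgHom.pi f) (completionSubalgebra k I) fun b m n h => hf m n h b

/-- A compatible family of algebra maps to `(A ⧸ I ^ n) ⊗ (A ⧸ I ^ n)` gives an algebra map to the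
completed tensor square. -/
def CompletedTensor.lift {B : Type*} [Ring B] [Algebra k B]
    (f : ∀ n : ℕ, B →ₐ[k] (A ⧸ I ^ n) ⊗[k] (A ⧸ I ^ n))
    (hf : ∀ m n (h : m ≤ n) b,
      Algebra.TensorProduct.map (transition k I h) (transition k I h) (f n b) = f m b) :
    B →ₐ[k] CompletedTensor k I :=
  AlgHom.codRestrict (AlgHom.pi f) (completedTensorSubalgebra k I) fun b m n h => hf m n h b

theorem Completion.transition_proj {m n : ℕ} (h : m ≤ n) (x : Completion k I) :
    transition k I h (Completion.proj k I n x) = Completion.proj k I m x := x.2 m n h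

theorem CompletedTensor.transition_proj {m n : ℕ} (h : m ≤ n) (x : CompletedTensor k I) :
    Algebra.TensorProduct.map (transition k I h) (transition k I h) (CompletedTensor.proj k I n x) =
      CompletedTensor.proj k I m x := x.2 m n h

/-- The element `x ⊗ 1` of the completed tensor square. -/
def CompletedTensor.inl : Completion k I →ₐ[k] CompletedTensor k I :=
  CompletedTensor.lift k I (fun n =>
    (Algebra.TensorProduct.includeLeft (R := k) (S := k) (A := A ⧸ I ^ n) (B := A ⧸ I ^ n)).comp
      (Completion.proj k I n)) fun m n h x => by
    simp [Completion.transition_proj]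

/-- The element `1 ⊗ x` of the completed tensor square. -/
def CompletedTensor.inr : Completion k I →ₐ[k] CompletedTensor k I :=
  CompletedTensor.lift k I (fun n =>
    (Algebra.TensorProduct.includeRight (R := k) (A := A ⧸ I ^ n) (B := A ⧸ I ^ n)).comp
      (Completion.proj k I n)) fun m n h x => by
    simp [Completion.transition_proj]

/-- The `n`-th term of the inverse limit filtration of the completion: the kernel of the
projection to `A ⧸ I ^ n`. -/
def Completion.filtration (n : ℕ) : Submodule k (Completion k I) :=
  LinearMap.ker (Completion.proj k I n).toLinearMap

theorem Completion.mul_mem_filtration {m n : ℕ} {x y : Completion k I}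
    (hx : x ∈ Completion.filtration k I m) (hy : y ∈ Completion.filtration k I n) :
    x * y ∈ Completion.filtration k I (m + n) := by
  have hx' : Completion.proj k I m x = 0 := hx
  have hy' : Completion.proj k I n y = 0 := hy
  obtain ⟨a, ha⟩ := Ideal.Quotient.mk_surjective (Completion.proj k I (m + n) x)
  obtain ⟨b, hb⟩ := Ideal.Quotient.mk_surjective (Completion.proj k I (m + n) y)
  rw [← Completion.transition_proj k I (Nat.le_add_right m n), ← ha] at hx'
  rw [← Completion.transition_proj k I (Nat.le_add_left n m), ← hb] at hy'
  change Completion.proj k I (m + n) (x * y) = 0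
  rw [map_mul, ← ha, ← hb, ← map_mul]
  exact Ideal.Quotient.eq_zero_iff_mem.2 (mul_mem_pow k I
    (Ideal.Quotient.eq_zero_iff_mem.1 hx') (Ideal.Quotient.eq_zero_iff_mem.1 hy'))

theorem Completion.mem_filtration_zero (x : Completion k I) :
    x ∈ Completion.filtration k I 0 := by
  change Completion.proj k I 0 x = 0
  obtain ⟨a, ha⟩ := Ideal.Quotient.mk_surjective (Completion.proj k I 0 x)
  rw [← ha, Ideal.Quotient.eq_zero_iff_mem, Submodule.pow_zero, Ideal.one_eq_top]
  trivial

/-- A filtration-preserving algebra map from `B`, filtered by the powers of `J`, to the `I`-adic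
completion of `A` extends to the `J`-adic completion of `B`. -/
def Completion.extend {B : Type*} [Ring B] [Algebra k B] (J : Ideal B) [J.IsTwoSided]
    (φ : B →ₐ[k] Completion k I)
    (hφ : ∀ n, ∀ b ∈ J ^ n, φ b ∈ Completion.filtration k I n) :
    Completion k J →ₐ[k] Completion k I :=
  Completion.lift k I (fun n =>
    (Ideal.Quotient.liftₐ (J ^ n) ((Completion.proj k I n).comp φ) (hφ n)).comp
      (Completion.proj k J n)) fun m n h x => by
    obtain ⟨b, hb⟩ := Ideal.Quotient.mk_surjective (Completion.proj k J n x)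
    have hm : Completion.proj k J m x = Ideal.Quotient.mk _ b := by
      rw [← Completion.transition_proj k J h, ← hb]; rfl
    simp only [AlgHom.comp_apply, hm, ← hb]
    exact Completion.transition_proj k I h (φ b)

/-- The graded piece `I ^ n / I ^ (n + 1)`. -/
abbrev Gr (n : ℕ) : Type _ := pow k I n ⧸ (pow k I (n + 1)).submoduleOf (pow k I n)

/-- The class in `I ^ n / I ^ (n + 1)` of an element of `I ^ n`. -/
abbrev Gr.mk (n : ℕ) : pow k I n →ₗ[k] Gr k I n := Submodule.mkQ _

theorem Gr.mk_eq_iff {n : ℕ} {a b : pow k I n} :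
    Gr.mk k I n a = Gr.mk k I n b ↔ (a : A) - b ∈ pow k I (n + 1) := by
  rw [Submodule.mkQ_apply, Submodule.mkQ_apply, Submodule.Quotient.eq]; rfl

theorem Gr.mk_eq_zero_iff {n : ℕ} {a : pow k I n} :
    Gr.mk k I n a = 0 ↔ (a : A) ∈ pow k I (n + 1) := by
  rw [Submodule.mkQ_apply, Submodule.Quotient.mk_eq_zero]; rfl

/-- The multiplication `Gr i × Gr j → Gr (i + j)` induced by that of `A`. -/
def Gr.mul {i j n : ℕ} (h : i + j = n) : Gr k I i →ₗ[k] Gr k I j →ₗ[k] Gr k I n :=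
  Submodule.liftQ _
    (LinearMap.mk₂ k (fun (a : pow k I i) (b : Gr k I j) =>
      Submodule.liftQ ((pow k I (j + 1)).submoduleOf (pow k I j))
        ((Gr.mk k I n).comp (LinearMap.codRestrict (pow k I n)
          ((LinearMap.mulLeft k (a : A)).comp (pow k I j).subtype)
          (fun b => h ▸ mul_mem_pow k I a.2 b.2)))
        (fun b hb => (Gr.mk_eq_zero_iff k I).2
          (by have := mul_mem_pow k I a.2 (show (b : A) ∈ pow k I (j + 1) from hb)
              rwa [← add_assoc, h] at this)) b)
      (fun a a' b => by
        obtain ⟨b, rfl⟩ := Submodule.mkQ_surjective _ b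
        exact congrArg (Gr.mk k I n) (Subtype.ext (add_mul (a : A) a' b)))
      (fun c a b => by
        obtain ⟨b, rfl⟩ := Submodule.mkQ_surjective _ b
        exact congrArg (Gr.mk k I n) (Subtype.ext (smul_mul_assoc c (a : A) b)))
      (fun a b b' => map_add _ b b')
      (fun c a b => map_smul _ c b))
    (fun a ha => by
      refine LinearMap.ext fun b => ?_
      obtain ⟨b, rfl⟩ := Submodule.mkQ_surjective _ b
      refine (Gr.mk_eq_zero_iff k I).2 ?_
      have := mul_mem_pow k I (show (a : A) ∈ pow k I (i + 1) from ha) b.2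
      rwa [show i + 1 + j = n + 1 by omega] at this)

theorem Gr.mul_mk {i j n : ℕ} (h : i + j = n) (a : pow k I i) (b : pow k I j) :
    Gr.mul k I h (Gr.mk k I i a) (Gr.mk k I j b) =
      Gr.mk k I n ⟨(a : A) * b, h ▸ mul_mem_pow k I a.2 b.2⟩ := rfl

theorem Gr.mk_eq_mul_sub_mul {i j n : ℕ} (h : i + j = n) (h' : j + i = n) (a : pow k I i)
    (b : pow k I j) (c : pow k I n) (hc : (c : A) - ((a : A) * b - b * a) ∈ pow k I (n + 1)) :
    Gr.mk k I n c = Gr.mul k I h (Gr.mk k I i a) (Gr.mk k I j b) -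
      Gr.mul k I h' (Gr.mk k I j b) (Gr.mk k I i a) := by
  rw [Gr.mul_mk, Gr.mul_mk, ← map_sub, Gr.mk_eq_iff]
  exact hc

/-- The degree completion `∏ₙ I ^ n / I ^ (n + 1)` of the associated graded algebra. -/
def GrHat : Type _ := ∀ n, Gr k I n

instance GrHat.instAddCommGroup : AddCommGroup (GrHat k I) := inferInstanceAs (AddCommGroup (∀ n, Gr k I n))
instance GrHat.instModule : Module k (GrHat k I) := inferInstanceAs (Module k (∀ n, Gr k I n))

/-- The unit of the associated graded algebra is the class of `1` in degree `0`. -/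
instance GrHat.instOne : One (GrHat k I) :=
  ⟨Pi.single (M := fun n => Gr k I n) 0 (Gr.mk k I 0 ⟨1, one_mem_pow_zero k I⟩)⟩

/-- The product of the completed associated graded algebra is the Cauchy product. -/
instance GrHat.instMul : Mul (GrHat k I) :=
  ⟨fun x y n => ∑ p : Finset.HasAntidiagonal.antidiagonal n,
    Gr.mul k I (Finset.HasAntidiagonal.mem_antidiagonal.1 p.2) (x p.1.1) (y p.1.2)⟩

/-- Power series whose `n`-th coefficient is in `I ^ n`. -/
def reesSubring : Subring (PowerSeries A) where
  carrier := {f | ∀ n, PowerSeries.coeff n f ∈ pow k I n}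
  mul_mem' {f g} hf hg n := by
    rw [PowerSeries.coeff_mul]
    refine sum_mem fun p hp => ?_
    rw [← Finset.HasAntidiagonal.mem_antidiagonal.1 hp]
    exact mul_mem_pow k I (hf p.1) (hg p.2)
  one_mem' n := by
    rw [PowerSeries.coeff_one]
    split_ifs with h
    · subst h; exact one_mem_pow_zero k I
    · exact zero_mem _
  add_mem' hf hg n := by rw [map_add]; exact add_mem (hf n) (hg n)
  zero_mem' n := by rw [map_zero]; exact zero_mem _
  neg_mem' hf n := by rw [map_neg]; exact neg_mem (hf n)

/-- Taking classes of coefficients. -/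
def reesToGr (f : reesSubring k I) : GrHat k I :=
  fun n => Gr.mk k I n ⟨PowerSeries.coeff n f.1, f.2 n⟩

theorem reesToGr_surjective : Function.Surjective (reesToGr k I) := fun x => by
  choose a ha using fun n => Submodule.mkQ_surjective _ (x n)
  refine ⟨⟨PowerSeries.mk fun n => (a n : A), fun n => ?_⟩, ?_⟩
  · rw [PowerSeries.coeff_mk]; exact (a n).2
  · funext n
    rw [← ha n]
    exact congrArg (Gr.mk k I n) (Subtype.ext (PowerSeries.coeff_mk n fun n => (a n : A)))

theorem reesToGr_add (f g : reesSubring k I) :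
    reesToGr k I (f + g) = reesToGr k I f + reesToGr k I g := by
  funext n
  exact congrArg (Gr.mk k I n) (Subtype.ext (map_add (PowerSeries.coeff n) f.1 g.1))

theorem reesToGr_one : reesToGr k I 1 = 1 := by
  funext n
  rcases eq_or_ne n 0 with rfl | h
  · refine Eq.trans ?_ (Pi.single_eq_same (M := fun n => Gr k I n) 0 _).symm
    exact congrArg (Gr.mk k I 0) (Subtype.ext (by simp))
  · refine Eq.trans ?_ (Pi.single_eq_of_ne (M := fun n => Gr k I n) h _).symm
    refine (Gr.mk_eq_zero_iff k I).2 ?_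
    simp [PowerSeries.coeff_one, h]

theorem reesToGr_mul (f g : reesSubring k I) :
    reesToGr k I (f * g) = reesToGr k I f * reesToGr k I g := by
  funext n
  change _ = ∑ p : Finset.HasAntidiagonal.antidiagonal n, _
  simp only [reesToGr, Gr.mul_mk]
  rw [← map_sum]
  refine congrArg (Gr.mk k I n) (Subtype.ext ?_)
  simp only [AddSubmonoidClass.coe_finsetSum]
  rw [Finset.sum_coe_sort (Finset.HasAntidiagonal.antidiagonal n)
    (fun p => PowerSeries.coeff p.1 f.1 * PowerSeries.coeff p.2 g.1)]
  exact PowerSeries.coeff_mul n f.1 g.1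

instance GrHat.instRing : Ring (GrHat k I) where
  __ := GrHat.instAddCommGroup k I
  mul_assoc x y z := by
    obtain ⟨x, rfl⟩ := reesToGr_surjective k I x
    obtain ⟨y, rfl⟩ := reesToGr_surjective k I y
    obtain ⟨z, rfl⟩ := reesToGr_surjective k I z
    simp only [← reesToGr_mul, mul_assoc]
  one_mul x := by
    obtain ⟨x, rfl⟩ := reesToGr_surjective k I x
    rw [← reesToGr_one, ← reesToGr_mul, one_mul]
  mul_one x := by
    obtain ⟨x, rfl⟩ := reesToGr_surjective k I x
    rw [← reesToGr_one, ← reesToGr_mul, mul_one]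
  left_distrib x y z := by
    obtain ⟨x, rfl⟩ := reesToGr_surjective k I x
    obtain ⟨y, rfl⟩ := reesToGr_surjective k I y
    obtain ⟨z, rfl⟩ := reesToGr_surjective k I z
    simp only [← reesToGr_mul, ← reesToGr_add, mul_add]
  right_distrib x y z := by
    obtain ⟨x, rfl⟩ := reesToGr_surjective k I x
    obtain ⟨y, rfl⟩ := reesToGr_surjective k I y
    obtain ⟨z, rfl⟩ := reesToGr_surjective k I z
    simp only [← reesToGr_mul, ← reesToGr_add, add_mul]
  zero_mul x := by
    funext n
    exact Finset.sum_eq_zero fun p _ => by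
      rw [show (0 : GrHat k I) p.1.1 = 0 from rfl, map_zero, LinearMap.zero_apply]
  mul_zero x := by
    funext n
    exact Finset.sum_eq_zero fun p _ => by
      rw [show (0 : GrHat k I) p.1.2 = 0 from rfl, map_zero]

instance GrHat.instAlgebra : Algebra k (GrHat k I) :=
  Algebra.ofModule
    (fun c x y => by
      funext n
      change (∑ p : Finset.HasAntidiagonal.antidiagonal n, _ : Gr k I n) =
        c • (∑ p : Finset.HasAntidiagonal.antidiagonal n, _ : Gr k I n)
      rw [Finset.smul_sum]
      refine Finset.sum_congr rfl fun p _ => ?_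
      rw [show (c • x) p.1.1 = c • x p.1.1 from rfl, map_smul, LinearMap.smul_apply])
    (fun c x y => by
      funext n
      change (∑ p : Finset.HasAntidiagonal.antidiagonal n, _ : Gr k I n) =
        c • (∑ p : Finset.HasAntidiagonal.antidiagonal n, _ : Gr k I n)
      rw [Finset.smul_sum]
      refine Finset.sum_congr rfl fun p _ => ?_
      rw [show (c • y) p.1.2 = c • y p.1.2 from rfl, map_smul])

/-- The component in degree `n` of an element of the completed associated graded algebra. -/
def GrHat.component (n : ℕ) : GrHat k I →ₗ[k] Gr k I n where
  toFun x := x n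
  map_add' _ _ := rfl
  map_smul' _ _ := rfl

theorem GrHat.lie_apply (x y : GrHat k I) (n : ℕ) :
    ⁅x, y⁆ n = ∑ p : Finset.HasAntidiagonal.antidiagonal n,
      (Gr.mul k I (Finset.HasAntidiagonal.mem_antidiagonal.1 p.2) (x p.1.1) (y p.1.2) -
        Gr.mul k I ((add_comm _ _).trans (Finset.HasAntidiagonal.mem_antidiagonal.1 p.2))
          (y p.1.2) (x p.1.1)) := by
  let e : Finset.HasAntidiagonal.antidiagonal n ≃ Finset.HasAntidiagonal.antidiagonal n :=
    { toFun := fun p => ⟨p.1.swap, Finset.HasAntidiagonal.mem_antidiagonal.2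
        ((add_comm _ _).trans (Finset.HasAntidiagonal.mem_antidiagonal.1 p.2))⟩
      invFun := fun p => ⟨p.1.swap, Finset.HasAntidiagonal.mem_antidiagonal.2
        ((add_comm _ _).trans (Finset.HasAntidiagonal.mem_antidiagonal.1 p.2))⟩
      left_inv := fun p => rfl
      right_inv := fun p => rfl }
  rw [Finset.sum_sub_distrib]
  change (x * y) n - (y * x) n = _
  refine congrArg (fun t : Gr k I n => (x * y) n - t) ?_
  exact (Equiv.sum_comp e (fun p : Finset.HasAntidiagonal.antidiagonal n =>
      Gr.mul k I (Finset.HasAntidiagonal.mem_antidiagonal.1 p.2) (y p.1.1) (x p.1.2))).symm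

/-- The filtration `∏_{j ≥ n} I ^ j / I ^ (j + 1)` of the completed associated graded algebra. -/
def GrHat.filtration (n : ℕ) : Submodule k (GrHat k I) where
  carrier := {x | ∀ j < n, x j = 0}
  zero_mem' _ _ := rfl
  add_mem' {x y} hx hy j hj := by
    rw [show (x + y) j = x j + y j from rfl, hx j hj, hy j hj, add_zero]
  smul_mem' c x hx j hj := by rw [show (c • x) j = c • x j from rfl, hx j hj, smul_zero]

theorem GrHat.mul_mem_filtration {m n : ℕ} {x y : GrHat k I}
    (hx : x ∈ GrHat.filtration k I m) (hy : y ∈ GrHat.filtration k I n) :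
    x * y ∈ GrHat.filtration k I (m + n) := fun l hl =>
  Finset.sum_eq_zero fun p _ => by
    have hp := Finset.HasAntidiagonal.mem_antidiagonal.1 p.2
    rcases lt_or_ge p.1.1 m with h | h
    · rw [hx _ h, map_zero, LinearMap.zero_apply]
    · rw [hy _ (by omega), map_zero]

theorem GrHat.mem_filtration_zero (x : GrHat k I) : x ∈ GrHat.filtration k I 0 :=
  fun _ hj => absurd hj (Nat.not_lt_zero _)

/-- The map `B ⧸ J ^ N → Gr n`, `n < N`, induced by a filtration-preserving linear map from `B`,
filtered by the powers of `J`, to the completed associated graded algebra of `A`. -/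
def GrHat.extendLevel {B : Type*} [Ring B] [Algebra k B] (J : Ideal B) [J.IsTwoSided]
    (φ : B →ₗ[k] GrHat k I)
    (hφ : ∀ n, ∀ b ∈ J ^ n, φ b ∈ GrHat.filtration k I n) {n N : ℕ} (h : n < N) :
    (B ⧸ J ^ N) →ₗ[k] Gr k I n :=
  (Submodule.liftQ (pow k J N) ((GrHat.component k I n).comp φ)
      (fun b hb => hφ N b hb n h)).comp
    (Submodule.Quotient.restrictScalarsEquiv k (J ^ N)).symm.toLinearMap

/-- A filtration-preserving linear map from `B`, filtered by the powers of `J`, to the completed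
associated graded algebra of `A` extends to the `J`-adic completion of `B`. -/
def GrHat.extend {B : Type*} [Ring B] [Algebra k B] (J : Ideal B) [J.IsTwoSided]
    (φ : B →ₗ[k] GrHat k I)
    (hφ : ∀ n, ∀ b ∈ J ^ n, φ b ∈ GrHat.filtration k I n) :
    Completion k J →ₗ[k] GrHat k I :=
  LinearMap.pi (φ := fun n => Gr k I n) fun n =>
    (GrHat.extendLevel k I J φ hφ n.lt_succ_self).comp (Completion.proj k J (n + 1)).toLinearMap

end Adic

section Tensor

variable (k : Type*) {A : Type*} [Field k] [Ring A] [Algebra k A] (I : Ideal A) [I.IsTwoSided]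

/-- The tensor product filtration `∑_{i + j = n} I ^ i ⊗ I ^ j` of `A ⊗ A`. -/
def tensorPow (n : ℕ) : Submodule k (A ⊗[k] A) :=
  Submodule.span k {t | ∃ i j, i + j = n ∧ ∃ a ∈ pow k I i, ∃ b ∈ pow k I j, a ⊗ₜ[k] b = t}

theorem tmul_mem_tensorPow {i j n : ℕ} (h : i + j = n) {a b : A} (ha : a ∈ pow k I i)
    (hb : b ∈ pow k I j) : a ⊗ₜ[k] b ∈ tensorPow k I n :=
  Submodule.subset_span ⟨i, j, h, a, ha, b, hb, rfl⟩

theorem mul_mem_tensorPow {m n : ℕ} {s t : A ⊗[k] A} (hs : s ∈ tensorPow k I m)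
    (ht : t ∈ tensorPow k I n) : s * t ∈ tensorPow k I (m + n) := by
  have h : tensorPow k I m * tensorPow k I n ≤ tensorPow k I (m + n) := by
    rw [tensorPow, tensorPow, Submodule.span_mul_span]
    refine Submodule.span_le.2 ?_
    rintro _ ⟨_, ⟨i, j, hij, a, ha, b, hb, rfl⟩, _, ⟨i', j', hij', a', ha', b', hb', rfl⟩, rfl⟩
    simp only [Algebra.TensorProduct.tmul_mul_tmul]
    exact tmul_mem_tensorPow k I (by omega) (mul_mem_pow k I ha ha') (mul_mem_pow k I hb hb')
  exact h (Submodule.mul_mem_mul hs ht)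

theorem pow_antitone {m n : ℕ} (h : m ≤ n) : pow k I n ≤ pow k I m :=
  fun _ ha => Ideal.pow_le_pow_right h ha

theorem mk_tensor_eq_zero {i j n : ℕ} (h : i + j ≤ n + 1) {t : A ⊗[k] A}
    (ht : t ∈ tensorPow k I n) :
    Algebra.TensorProduct.map (Ideal.Quotient.mkₐ k (I ^ i)) (Ideal.Quotient.mkₐ k (I ^ j)) t
      = 0 := by
  induction ht using Submodule.span_induction with
  | mem t ht =>
    obtain ⟨i', j', hij, a, ha, b, hb, rfl⟩ := ht
    rw [Algebra.TensorProduct.map_tmul]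
    rcases le_or_gt i i' with hi | hi
    · rw [show Ideal.Quotient.mkₐ k (I ^ i) a = 0 from
        Ideal.Quotient.eq_zero_iff_mem.2 (pow_antitone k I hi ha), TensorProduct.zero_tmul]
    · rw [show Ideal.Quotient.mkₐ k (I ^ j) b = 0 from
        Ideal.Quotient.eq_zero_iff_mem.2 (pow_antitone k I (by omega : j ≤ j') hb),
        TensorProduct.tmul_zero]
  | zero => exact map_zero _
  | add s t _ _ hs ht => rw [map_add, hs, ht, add_zero]
  | smul c t _ ht => rw [map_smul, ht, smul_zero]

/-- The inclusion of `I ^ n / I ^ (n + 1)` in `A ⧸ I ^ (n + 1)`. -/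
def Gr.incl (n : ℕ) : Gr k I n →ₗ[k] A ⧸ I ^ (n + 1) :=
  Submodule.liftQ _ ((Ideal.Quotient.mkₐ k (I ^ (n + 1))).toLinearMap.comp (pow k I n).subtype)
    fun _ ha => Ideal.Quotient.eq_zero_iff_mem.2 ha

theorem Gr.incl_injective (n : ℕ) : Function.Injective (Gr.incl k I n) := by
  refine (injective_iff_map_eq_zero _).2 fun x hx => ?_
  obtain ⟨a, rfl⟩ := Submodule.mkQ_surjective _ x
  exact (Gr.mk_eq_zero_iff k I).2 (Ideal.Quotient.eq_zero_iff_mem.1 hx)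

theorem Gr.incl_tensor_injective (i j : ℕ) :
    Function.Injective (TensorProduct.map (Gr.incl k I i) (Gr.incl k I j)) :=
  TensorProduct.map_injective_of_flat_flat _ _ (Gr.incl_injective k I i) (Gr.incl_injective k I j)

theorem mk_tensor_mem_range {i j n : ℕ} (h : i + j = n) {t : A ⊗[k] A}
    (ht : t ∈ tensorPow k I n) :
    Algebra.TensorProduct.map (Ideal.Quotient.mkₐ k (I ^ (i + 1)))
      (Ideal.Quotient.mkₐ k (I ^ (j + 1))) t ∈
      LinearMap.range (TensorProduct.map (Gr.incl k I i) (Gr.incl k I j)) := by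
  induction ht using Submodule.span_induction with
  | mem t ht =>
    obtain ⟨i', j', hij, a, ha, b, hb, rfl⟩ := ht
    rw [Algebra.TensorProduct.map_tmul]
    rcases lt_trichotomy i i' with hi | rfl | hi
    · rw [show Ideal.Quotient.mkₐ k (I ^ (i + 1)) a = 0 from
        Ideal.Quotient.eq_zero_iff_mem.2 (pow_antitone k I hi ha), TensorProduct.zero_tmul]
      exact zero_mem _
    · obtain rfl : j = j' := by omega
      exact ⟨Gr.mk k I i ⟨a, ha⟩ ⊗ₜ Gr.mk k I j ⟨b, hb⟩, rfl⟩
    · rw [show Ideal.Quotient.mkₐ k (I ^ (j + 1)) b = 0 from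
        Ideal.Quotient.eq_zero_iff_mem.2 (pow_antitone k I (by omega : j + 1 ≤ j') hb),
        TensorProduct.tmul_zero]
      exact zero_mem _
  | zero => rw [map_zero]; exact zero_mem _
  | add s t _ _ hs ht => rw [map_add]; exact add_mem hs ht
  | smul c t _ ht => rw [map_smul]; exact Submodule.smul_mem _ c ht

/-- The projection of `∑_{a + b = n} I ^ a ⊗ I ^ b` to the summand `Gr i ⊗ Gr j` of its associated
graded piece `⨁_{a + b = n} Gr a ⊗ Gr b`, where `i + j = n`. -/
def grTensorProj {i j n : ℕ} (h : i + j = n) : tensorPow k I n →ₗ[k] Gr k I i ⊗[k] Gr k I j :=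
  (LinearEquiv.ofInjective _ (Gr.incl_tensor_injective k I i j)).symm.toLinearMap.comp
    (LinearMap.codRestrict _
      ((Algebra.TensorProduct.map (Ideal.Quotient.mkₐ k (I ^ (i + 1)))
        (Ideal.Quotient.mkₐ k (I ^ (j + 1)))).toLinearMap.comp (tensorPow k I n).subtype)
      fun t => mk_tensor_mem_range k I h t.2)

theorem incl_grTensorProj {i j n : ℕ} (h : i + j = n) (t : tensorPow k I n) :
    TensorProduct.map (Gr.incl k I i) (Gr.incl k I j) (grTensorProj k I h t) =
      Algebra.TensorProduct.map (Ideal.Quotient.mkₐ k (I ^ (i + 1)))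
        (Ideal.Quotient.mkₐ k (I ^ (j + 1))) (t : A ⊗[k] A) :=
  congrArg Subtype.val (LinearEquiv.apply_symm_apply
    (LinearEquiv.ofInjective _ (Gr.incl_tensor_injective k I i j)) _)

theorem grTensorProj_tmul {i j n : ℕ} (h : i + j = n) (a : pow k I i) (b : pow k I j) :
    grTensorProj k I h ⟨a.1 ⊗ₜ b.1, tmul_mem_tensorPow k I h a.2 b.2⟩ =
      Gr.mk k I i a ⊗ₜ Gr.mk k I j b :=
  Gr.incl_tensor_injective k I i j (incl_grTensorProj k I h _)

/-- The completed tensor square of the completed associated graded algebra: the degree completion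
`∏_{i, j} Gr i ⊗ Gr j` of the tensor square of the associated graded algebra. -/
abbrev GrTensor : Type _ := ∀ i j, Gr k I i ⊗[k] Gr k I j

/-- The element `x ⊗ y` of the completed tensor square. -/
def GrTensor.tmul (x y : GrHat k I) : GrTensor k I := fun i j => x i ⊗ₜ y j

/-- The completed tensor square of the extension of `φ` to the completion of `B`. Its component in
`Gr i ⊗ Gr j` only depends on the projection to `(B ⧸ J ^ (i + j + 1)) ⊗ (B ⧸ J ^ (i + j + 1))`. -/
def GrTensor.extend {B : Type*} [Ring B] [Algebra k B] (J : Ideal B) [J.IsTwoSided]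
    (φ : B →ₗ[k] GrHat k I)
    (hφ : ∀ n, ∀ b ∈ J ^ n, φ b ∈ GrHat.filtration k I n) :
    CompletedTensor k J →ₗ[k] GrTensor k I :=
  LinearMap.pi fun i => LinearMap.pi fun j =>
    (TensorProduct.map
      (GrHat.extendLevel k I J φ hφ (n := i) (N := i + j + 1) (by omega))
      (GrHat.extendLevel k I J φ hφ (n := j) (N := i + j + 1) (by omega))).comp
      (CompletedTensor.proj k J (i + j + 1)).toLinearMap

end Tensor

section GroupAlgebra

variable (k G : Type*) [Field k] [Group G]

/-- The augmentation ideal of the group algebra. -/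
def augIdeal : Ideal (MonoidAlgebra k G) :=
  RingHom.ker (Bialgebra.counitAlgHom k (MonoidAlgebra k G))

instance : (augIdeal k G).IsTwoSided :=
  inferInstanceAs (RingHom.ker (Bialgebra.counitAlgHom k (MonoidAlgebra k G))).IsTwoSided

variable {G} in
theorem of_sub_one_mem (g : G) : MonoidAlgebra.of k G g - 1 ∈ augIdeal k G := by
  rw [augIdeal, RingHom.mem_ker]
  simp

theorem comul_sub_mem (a : MonoidAlgebra k G) :
    Bialgebra.comulAlgHom k (MonoidAlgebra k G) a -
      Bialgebra.counitAlgHom k (MonoidAlgebra k G) a • 1 ∈ tensorPow k (augIdeal k G) 1 := by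
  induction a using MonoidAlgebra.induction_on with
  | of g =>
    have h : Bialgebra.comulAlgHom k (MonoidAlgebra k G) (MonoidAlgebra.of k G g) -
        Bialgebra.counitAlgHom k (MonoidAlgebra k G) (MonoidAlgebra.of k G g) • 1 =
        (MonoidAlgebra.of k G g - 1) ⊗ₜ[k] MonoidAlgebra.of k G g +
          1 ⊗ₜ[k] (MonoidAlgebra.of k G g - 1) := by
      simp [TensorProduct.sub_tmul, TensorProduct.tmul_sub, Algebra.TensorProduct.one_def]
    rw [h]
    have h1 : MonoidAlgebra.of k G g - 1 ∈ pow k (augIdeal k G) 1 := by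
      rw [mem_pow, Submodule.pow_one]; exact of_sub_one_mem k g
    refine add_mem (tmul_mem_tensorPow k _ (i := 1) (j := 0) rfl h1 ?_)
      (tmul_mem_tensorPow k _ (i := 0) (j := 1) rfl (one_mem_pow_zero k _) h1)
    rw [mem_pow, Submodule.pow_zero, Ideal.one_eq_top]
    trivial
  | add a b ha hb =>
    rw [map_add, map_add, add_smul, add_sub_add_comm]
    exact add_mem ha hb
  | smul r a ha =>
    have h := Submodule.smul_mem _ r ha
    rw [smul_sub, ← smul_assoc] at h
    rwa [map_smul, map_smul]

theorem comul_mem {n : ℕ} {a : MonoidAlgebra k G} (ha : a ∈ pow k (augIdeal k G) n) :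
    Bialgebra.comulAlgHom k (MonoidAlgebra k G) a ∈ tensorPow k (augIdeal k G) n := by
  induction n generalizing a with
  | zero =>
    have h : ∀ t : MonoidAlgebra k G ⊗[k] MonoidAlgebra k G, t ∈ tensorPow k (augIdeal k G) 0 := by
      intro t
      induction t using TensorProduct.induction_on with
      | zero => exact zero_mem _
      | tmul x y =>
        refine tmul_mem_tensorPow k _ (i := 0) (j := 0) rfl ?_ ?_ <;>
        · rw [mem_pow, Submodule.pow_zero, Ideal.one_eq_top]
          trivial
      | add s t hs ht => exact add_mem hs ht
    exact h _
  | succ n ih =>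
    rw [mem_pow, Submodule.pow_succ] at ha
    induction ha using Submodule.mul_induction_on' with
    | mem_mul_mem a ha b hb =>
      rw [map_mul]
      refine mul_mem_tensorPow k _ (ih ha) ?_
      have := comul_sub_mem k G b
      rwa [show Bialgebra.counitAlgHom k (MonoidAlgebra k G) b = 0 from hb, zero_smul,
        sub_zero] at this
    | add a _ b _ ha hb => rw [map_add]; exact add_mem ha hb

/-- The `I`-adic completion of the group algebra. -/
abbrev GroupAlgebraHat : Type _ :=
  Completion k (augIdeal k G)

/-- The completed associated graded algebra of the group algebra. -/
abbrev GrGroupAlgebraHat : Type _ := GrHat k (augIdeal k G)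

/-- The map `kG ⧸ I ^ (2 * n) → (kG ⧸ I ^ n) ⊗ (kG ⧸ I ^ n)` induced by the comultiplication. -/
def comulLevel (n : ℕ) : (MonoidAlgebra k G ⧸ augIdeal k G ^ (2 * n)) →ₐ[k]
    (MonoidAlgebra k G ⧸ augIdeal k G ^ n) ⊗[k] (MonoidAlgebra k G ⧸ augIdeal k G ^ n) :=
  Ideal.Quotient.liftₐ _
    ((Algebra.TensorProduct.map (Ideal.Quotient.mkₐ k (augIdeal k G ^ n))
      (Ideal.Quotient.mkₐ k (augIdeal k G ^ n))).comp
      (Bialgebra.comulAlgHom k (MonoidAlgebra k G)))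
    fun _ ha => mk_tensor_eq_zero k _ (by omega) (comul_mem k G ha)

/-- The comultiplication of the completed group algebra, with values in the completed tensor
square, induced by that of the group algebra. -/
def completedComul : GroupAlgebraHat k G →ₐ[k] CompletedTensor k (augIdeal k G) :=
  CompletedTensor.lift k _ (fun n => (comulLevel k G n).comp (Completion.proj k _ (2 * n)))
    fun m n h x => by
      obtain ⟨b, hb⟩ := Ideal.Quotient.mk_surjective (Completion.proj k _ (2 * n) x)
      have hm : Completion.proj k _ (2 * m) x = Ideal.Quotient.mk _ b := by
        rw [← Completion.transition_proj k _ (show 2 * m ≤ 2 * n by omega), ← hb]; rfl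
      simp only [AlgHom.comp_apply, hm, ← hb]
      change _ = (Algebra.TensorProduct.map (Ideal.Quotient.mkₐ k (augIdeal k G ^ m))
        (Ideal.Quotient.mkₐ k (augIdeal k G ^ m))) (Bialgebra.comulAlgHom k (MonoidAlgebra k G) b)
      change (Algebra.TensorProduct.map (transition k _ h) (transition k _ h))
        ((Algebra.TensorProduct.map (Ideal.Quotient.mkₐ k (augIdeal k G ^ n))
        (Ideal.Quotient.mkₐ k (augIdeal k G ^ n)))
          (Bialgebra.comulAlgHom k (MonoidAlgebra k G) b)) = _
      generalize Bialgebra.comulAlgHom k (MonoidAlgebra k G) b = t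
      induction t using TensorProduct.induction_on with
      | zero => simp only [map_zero]
      | tmul x y => rfl
      | add s t hs ht => simp only [map_add, hs, ht]

/-- The component `Gr n → Gr i ⊗ Gr j`, `i + j = n`, of the associated graded map of the
comultiplication of the group algebra. -/
def grComulComponent {i j n : ℕ} (h : i + j = n) : Gr k (augIdeal k G) n →ₗ[k]
    Gr k (augIdeal k G) i ⊗[k] Gr k (augIdeal k G) j :=
  Submodule.liftQ _
    ((grTensorProj k _ h).comp (LinearMap.restrict
      (Bialgebra.comulAlgHom k (MonoidAlgebra k G)).toLinearMap fun _ ha => comul_mem k G ha))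
    fun a ha => Gr.incl_tensor_injective k _ i j (by
      rw [map_zero]
      exact (incl_grTensorProj k _ h _).trans
        (mk_tensor_eq_zero k _ (by omega) (comul_mem k G (n := n + 1) ha)))

/-- The comultiplication of the completed associated graded algebra: the degree completion of the
associated graded map of the comultiplication of the group algebra. -/
def grComul : GrGroupAlgebraHat k G →ₗ[k] GrTensor k (augIdeal k G) :=
  LinearMap.pi fun i => LinearMap.pi fun j =>
    (grComulComponent k G (rfl : i + j = i + j)).comp (GrHat.component k _ (i + j))

/-- The set of primitive elements of the completed associated graded algebra. -/
def grPrimitives : Set (GrGroupAlgebraHat k G) :=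
  {x | grComul k G x = GrTensor.tmul k _ x 1 + GrTensor.tmul k _ 1 x}

/-- The subspace of primitive elements of the completed group algebra. -/
def primitives : Submodule k (GroupAlgebraHat k G) :=
  LinearMap.eqLocus (completedComul k G).toLinearMap
    ((CompletedTensor.inl k (augIdeal k G)).toLinearMap +
      (CompletedTensor.inr k (augIdeal k G)).toLinearMap)

theorem map_lie_of_primitive {R S : Type*} [Ring R] [Algebra k R] [Ring S] [Algebra k S]
    (f l r : R →ₐ[k] S) (hlr : ∀ u v, l u * r v = r v * l u) {x y : R} (hx : f x = l x + r x)
    (hy : f y = l y + r y) : f ⁅x, y⁆ = l ⁅x, y⁆ + r ⁅x, y⁆ := by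
  simp only [LieRing.of_associative_ring_bracket, map_sub, map_mul, hx, hy, add_mul, mul_add, hlr]
  abel

theorem inl_mul_inr (u v : GroupAlgebraHat k G) :
    CompletedTensor.inl k (augIdeal k G) u * CompletedTensor.inr k (augIdeal k G) v =
      CompletedTensor.inr k (augIdeal k G) v * CompletedTensor.inl k (augIdeal k G) u := by
  refine CompletedTensor.ext k _ fun n => ?_
  have h (p q : MonoidAlgebra k G ⧸ augIdeal k G ^ n) :
      (p ⊗ₜ[k] (1 : MonoidAlgebra k G ⧸ augIdeal k G ^ n)) *
        ((1 : MonoidAlgebra k G ⧸ augIdeal k G ^ n) ⊗ₜ[k] q) =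
      ((1 : MonoidAlgebra k G ⧸ augIdeal k G ^ n) ⊗ₜ[k] q) *
        (p ⊗ₜ[k] (1 : MonoidAlgebra k G ⧸ augIdeal k G ^ n)) := by
    simp only [Algebra.TensorProduct.tmul_mul_tmul, one_mul, mul_one]
  exact h (Completion.proj k _ n u) (Completion.proj k _ n v)

/-- The Malcev Lie algebra of `G`: the primitive elements of the completed group algebra, with the
commutator bracket. -/
def malcev : LieSubalgebra k (GroupAlgebraHat k G) where
  __ := primitives k G
  lie_mem' {x y} hx hy := map_lie_of_primitive k (completedComul k G)
    (CompletedTensor.inl k (augIdeal k G)) (CompletedTensor.inr k (augIdeal k G))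
    (inl_mul_inr k G) (x := x) (y := y) hx hy

/-- The `n`-th term of the filtration of the Malcev Lie algebra induced by the completed group
algebra. -/
def malcevFiltration (n : ℕ) : Submodule k (malcev k G) :=
  (Completion.filtration k (augIdeal k G) n).comap (malcev k G).toSubmodule.subtype

end GroupAlgebra

section LowerCentral

open scoped commutatorElement

variable (G : Type*) [Group G]

/-- The lower central series `Γ₁ = G`, `Γₙ₊₁ = [Γₙ, G]`, extended by `Γ₀ = G`. -/
def lcs (n : ℕ) : Subgroup G := (⊤ : Subgroup G).lowerCentralSeries (n - 1)

instance lcs_normal (n : ℕ) : (lcs G n).Normal :=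
  inferInstanceAs ((⊤ : Subgroup G).lowerCentralSeries (n - 1)).Normal

theorem lcs_zero : lcs G 0 = ⊤ := rfl

theorem lcs_one : lcs G 1 = ⊤ := rfl

theorem lcs_succ (n : ℕ) : lcs G (n + 2) = ⁅lcs G (n + 1), ⊤⁆ := rfl

theorem lcs_antitone : Antitone (lcs G) := fun _ _ h =>
  Subgroup.lowerCentralSeries_antitone _ (by omega)

theorem commutator_lcs_one (n : ℕ) : ⁅lcs G n, (⊤ : Subgroup G)⁆ ≤ lcs G (n + 1) := by
  rcases n with _ | n
  · exact le_top
  · exact le_rfl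

theorem three_subgroups {H K L N : Subgroup G} [hN : N.Normal] (h1 : ⁅⁅K, L⁆, H⁆ ≤ N)
    (h2 : ⁅⁅L, H⁆, K⁆ ≤ N) : ⁅⁅H, K⁆, L⁆ ≤ N := by
  have key : ∀ P : Subgroup G, P ≤ N ↔ P.map (QuotientGroup.mk' N) = ⊥ := fun P => by
    rw [Subgroup.map_eq_bot_iff, QuotientGroup.ker_mk']
  rw [key, Subgroup.map_commutator, Subgroup.map_commutator] at h1 h2 ⊢
  exact Subgroup.commutator_commutator_eq_bot_of_rotate h1 h2

theorem commutator_lcs_le (i j : ℕ) : ⁅lcs G i, lcs G j⁆ ≤ lcs G (i + j) := by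
  induction i generalizing j with
  | zero =>
    rw [zero_add]
    exact Subgroup.commutator_le_right _ _
  | succ i ih =>
    rcases i with _ | i
    · rw [Subgroup.commutator_comm, zero_add, add_comm]
      exact (Subgroup.commutator_mono le_rfl le_top).trans (commutator_lcs_one G j)
    · rw [lcs_succ]
      refine three_subgroups G ?_ ?_
      · rw [Subgroup.commutator_comm ⊤, Subgroup.commutator_comm]
        refine (Subgroup.commutator_mono le_rfl (commutator_lcs_one G j)).trans ?_
        refine (ih (j + 1)).trans (lcs_antitone G (by omega))
      · rw [Subgroup.commutator_comm (lcs G j)]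
        refine (Subgroup.commutator_mono (ih j) le_top).trans ?_
        refine (commutator_lcs_one G _).trans (lcs_antitone G (by omega))

variable {G} in
theorem commutator_mem_lcs {i j n : ℕ} (h : i + j = n) {x y : G} (hx : x ∈ lcs G i)
    (hy : y ∈ lcs G j) : ⁅x, y⁆ ∈ lcs G n :=
  h ▸ commutator_lcs_le G i j (Subgroup.commutator_mem_commutator hx hy)

/-- The group `Γₙ / Γₙ₊₁`. -/
abbrev LcsQuotient (n : ℕ) : Type _ := lcs G n ⧸ (lcs G (n + 1)).subgroupOf (lcs G n)

variable {G} in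
theorem LcsQuotient.mk_eq_iff {n : ℕ} {x y : lcs G n} :
    (x : LcsQuotient G n) = y ↔ (x : G)⁻¹ * y ∈ lcs G (n + 1) := by
  rw [QuotientGroup.eq]; rfl

instance LcsQuotient.instCommGroup (n : ℕ) : CommGroup (LcsQuotient G n) where
  mul_comm a b := by
    obtain ⟨x, rfl⟩ := QuotientGroup.mk_surjective a
    obtain ⟨y, rfl⟩ := QuotientGroup.mk_surjective b
    rw [← QuotientGroup.mk_mul, ← QuotientGroup.mk_mul, LcsQuotient.mk_eq_iff]
    have h : ((x * y : lcs G n) : G)⁻¹ * (y * x : lcs G n) = ⁅(y : G)⁻¹, (x : G)⁻¹⁆ := by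
      simp [commutatorElement_def, mul_assoc]
    rw [h]
    exact commutator_lcs_one G n
      (Subgroup.commutator_mem_commutator (inv_mem y.2) (Subgroup.mem_top _))

/-- The abelian group `grₙ(G) = Γₙ / Γₙ₊₁`, written additively. It is trivial for `n = 0`. -/
abbrev GrGroup (n : ℕ) : Type _ := Additive (LcsQuotient G n)

variable {G} in
/-- The class in `grₙ(G)` of an element of `Γₙ`. -/
def GrGroup.mk {n : ℕ} (x : G) (hx : x ∈ lcs G n) : GrGroup G n :=
  Additive.ofMul (QuotientGroup.mk (⟨x, hx⟩ : lcs G n))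

variable {G} in
theorem GrGroup.mk_surjective {n : ℕ} (a : GrGroup G n) : ∃ x hx, GrGroup.mk x hx = a := by
  obtain ⟨x, hx⟩ := QuotientGroup.mk_surjective a.toMul
  exact ⟨x.1, x.2, congrArg Additive.ofMul hx⟩

variable {G} in
theorem GrGroup.mk_eq_iff {n : ℕ} {x y : G} {hx : x ∈ lcs G n} {hy : y ∈ lcs G n} :
    GrGroup.mk x hx = GrGroup.mk y hy ↔ x⁻¹ * y ∈ lcs G (n + 1) :=
  Additive.ofMul.injective.eq_iff.trans LcsQuotient.mk_eq_iff

variable {G} in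
theorem GrGroup.mk_mul {n : ℕ} {x y : G} (hx : x ∈ lcs G n) (hy : y ∈ lcs G n) :
    GrGroup.mk (x * y) (mul_mem hx hy) = GrGroup.mk x hx + GrGroup.mk y hy := rfl

variable {G} in
theorem GrGroup.mk_one {n : ℕ} : GrGroup.mk (1 : G) (one_mem (lcs G n)) = 0 := rfl

variable {G} in
theorem GrGroup.mk_inv {n : ℕ} {x : G} (hx : x ∈ lcs G n) :
    GrGroup.mk x⁻¹ (inv_mem hx) = -GrGroup.mk x hx := rfl

variable {G} in
theorem conj_mem_lcs {n : ℕ} {x : G} (g : G) (hx : x ∈ lcs G n) : g * x * g⁻¹ ∈ lcs G n :=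
  (lcs_normal G n).conj_mem x hx g

variable {G} in
theorem GrGroup.mk_conj {n : ℕ} {x : G} (g : G) (hx : x ∈ lcs G n) :
    GrGroup.mk (g * x * g⁻¹) (conj_mem_lcs g hx) = GrGroup.mk x hx := by
  rw [GrGroup.mk_eq_iff]
  have h : (g * x * g⁻¹)⁻¹ * x = ⁅x⁻¹, g⁆⁻¹ := by
    simp [commutatorElement_def, mul_assoc]
  rw [h]
  exact inv_mem (commutator_lcs_one G n
    (Subgroup.commutator_mem_commutator (inv_mem hx) (Subgroup.mem_top _)))

variable {G} in
theorem GrGroup.mk_congr {n : ℕ} {x y : G} (h : x = y) (hx : x ∈ lcs G n) :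
    GrGroup.mk x hx = GrGroup.mk y (h ▸ hx) := by subst h; rfl

variable {G} in
theorem bracket_mul_right {i j n : ℕ} (h : i + j = n) {x y z : G} (hx : x ∈ lcs G i)
    (hy : y ∈ lcs G j) (hz : z ∈ lcs G j) :
    GrGroup.mk ⁅x, y * z⁆ (commutator_mem_lcs h hx (mul_mem hy hz)) =
      GrGroup.mk ⁅x, y⁆ (commutator_mem_lcs h hx hy) +
        GrGroup.mk ⁅x, z⁆ (commutator_mem_lcs h hx hz) := by
  have e : ⁅x, y * z⁆ = ⁅x, y⁆ * (y * ⁅x, z⁆ * y⁻¹) := by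
    simp [commutatorElement_def, mul_assoc]
  rw [GrGroup.mk_congr e, GrGroup.mk_mul (commutator_mem_lcs h hx hy)
    (conj_mem_lcs y (commutator_mem_lcs h hx hz)), GrGroup.mk_conj]

variable {G} in
theorem bracket_mul_left {i j n : ℕ} (h : i + j = n) {x y z : G} (hx : x ∈ lcs G i)
    (hy : y ∈ lcs G i) (hz : z ∈ lcs G j) :
    GrGroup.mk ⁅x * y, z⁆ (commutator_mem_lcs h (mul_mem hx hy) hz) =
      GrGroup.mk ⁅x, z⁆ (commutator_mem_lcs h hx hz) +
        GrGroup.mk ⁅y, z⁆ (commutator_mem_lcs h hy hz) := by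
  have e : ⁅x * y, z⁆ = (x * ⁅y, z⁆ * x⁻¹) * ⁅x, z⁆ := by
    simp [commutatorElement_def, mul_assoc]
  rw [GrGroup.mk_congr e, GrGroup.mk_mul (conj_mem_lcs x (commutator_mem_lcs h hy hz))
    (commutator_mem_lcs h hx hz), GrGroup.mk_conj, add_comm]

/-- The bracket `grᵢ(G) × grⱼ(G) → grᵢ₊ⱼ(G)` induced by the group commutator. -/
def GrGroup.bracket {i j n : ℕ} (h : i + j = n) : GrGroup G i →+ GrGroup G j →+ GrGroup G n :=
  MonoidHom.toAdditiveLeft (QuotientGroup.lift _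
    ({ toFun := fun x => Multiplicative.ofAdd (MonoidHom.toAdditiveLeft (QuotientGroup.lift _
        ({ toFun := fun y => Multiplicative.ofAdd
             (GrGroup.mk ⁅(x : G), (y : G)⁆ (commutator_mem_lcs h x.2 y.2))
           map_one' := by
             refine congrArg Multiplicative.ofAdd ?_
             exact (GrGroup.mk_congr (commutatorElement_one_right (x : G)) _).trans GrGroup.mk_one
           map_mul' := fun y z =>
             congrArg Multiplicative.ofAdd (bracket_mul_right h x.2 y.2 z.2) } :
          lcs G j →* Multiplicative (GrGroup G n))
        (fun y hy => by
          refine congrArg Multiplicative.ofAdd (?_ : _ = (0 : GrGroup G n))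
          rw [← GrGroup.mk_one, GrGroup.mk_eq_iff]
          rw [mul_one]
          exact inv_mem (commutator_mem_lcs (by omega) x.2 hy))))
       map_one' := by
        refine congrArg Multiplicative.ofAdd (AddMonoidHom.ext fun a => ?_)
        obtain ⟨y, hy, rfl⟩ := GrGroup.mk_surjective a
        exact (GrGroup.mk_congr (commutatorElement_one_left y) _).trans GrGroup.mk_one
       map_mul' := fun x z => by
        refine congrArg Multiplicative.ofAdd (AddMonoidHom.ext fun a => ?_)
        obtain ⟨y, hy, rfl⟩ := GrGroup.mk_surjective a
        exact bracket_mul_left h x.2 z.2 hy } :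
      lcs G i →* Multiplicative (GrGroup G j →+ GrGroup G n))
    (fun x hx => by
      refine congrArg Multiplicative.ofAdd (AddMonoidHom.ext fun a => ?_)
      obtain ⟨y, hy, rfl⟩ := GrGroup.mk_surjective a
      change GrGroup.mk ⁅(x : G), y⁆ _ = 0
      rw [← GrGroup.mk_one, GrGroup.mk_eq_iff, mul_one]
      exact inv_mem (commutator_mem_lcs (by omega) hx hy)))

variable {G} in
theorem GrGroup.bracket_mk {i j n : ℕ} (h : i + j = n) {x y : G} (hx : x ∈ lcs G i)
    (hy : y ∈ lcs G j) :
    GrGroup.bracket G h (GrGroup.mk x hx) (GrGroup.mk y hy) =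
      GrGroup.mk ⁅x, y⁆ (commutator_mem_lcs h hx hy) := rfl

theorem GrGroup.bracket_skew {i j n : ℕ} (h : i + j = n) (h' : j + i = n) (a : GrGroup G i)
    (b : GrGroup G j) : GrGroup.bracket G h a b = -GrGroup.bracket G h' b a := by
  obtain ⟨x, hx, rfl⟩ := GrGroup.mk_surjective a
  obtain ⟨y, hy, rfl⟩ := GrGroup.mk_surjective b
  rw [GrGroup.bracket_mk, GrGroup.bracket_mk, ← GrGroup.mk_inv]
  exact GrGroup.mk_congr (commutatorElement_inv y x).symm _

/-- The Jacobi identity, from the Hall–Witt identity. -/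
theorem GrGroup.bracket_jacobi {i j l p q r n : ℕ} (hp : i + j = p) (hq : j + l = q)
    (hr : l + i = r) (hpn : p + l = n) (hqn : q + i = n) (hrn : r + j = n)
    (a : GrGroup G i) (b : GrGroup G j) (c : GrGroup G l) :
    GrGroup.bracket G hpn (GrGroup.bracket G hp a b) c +
      GrGroup.bracket G hqn (GrGroup.bracket G hq b c) a +
      GrGroup.bracket G hrn (GrGroup.bracket G hr c a) b = 0 := by
  obtain ⟨x, hx, rfl⟩ := GrGroup.mk_surjective a
  obtain ⟨y, hy, rfl⟩ := GrGroup.mk_surjective b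
  obtain ⟨z, hz, rfl⟩ := GrGroup.mk_surjective c
  have e1 : GrGroup.bracket G hpn (GrGroup.bracket G hp (.mk x hx) (.mk y hy)) (.mk z hz) =
      GrGroup.mk ⁅⁅x, y⁆, y * z * y⁻¹⁆
        (commutator_mem_lcs hpn (commutator_mem_lcs hp hx hy) (conj_mem_lcs y hz)) := by
    rw [← GrGroup.mk_conj y hz, GrGroup.bracket_mk, GrGroup.bracket_mk]
  have e2 : GrGroup.bracket G hqn (GrGroup.bracket G hq (.mk y hy) (.mk z hz)) (.mk x hx) =
      GrGroup.mk ⁅⁅y, z⁆, z * x * z⁻¹⁆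
        (commutator_mem_lcs hqn (commutator_mem_lcs hq hy hz) (conj_mem_lcs z hx)) := by
    rw [← GrGroup.mk_conj z hx, GrGroup.bracket_mk, GrGroup.bracket_mk]
  have e3 : GrGroup.bracket G hrn (GrGroup.bracket G hr (.mk z hz) (.mk x hx)) (.mk y hy) =
      GrGroup.mk ⁅⁅z, x⁆, x * y * x⁻¹⁆
        (commutator_mem_lcs hrn (commutator_mem_lcs hr hz hx) (conj_mem_lcs x hy)) := by
    rw [← GrGroup.mk_conj x hy, GrGroup.bracket_mk, GrGroup.bracket_mk]
  rw [e1, e2, e3, ← GrGroup.mk_mul, ← GrGroup.mk_mul]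
  exact (GrGroup.mk_congr (commutatorElement_commutatorElement_conj_mul x y z) _).trans
    GrGroup.mk_one

end LowerCentral

section GrLie

variable (k G : Type*) [Field k] [Group G]

/-- The vector space `grₙ(G) ⊗ k`. -/
abbrev GrLiePiece (n : ℕ) : Type _ := k ⊗[ℤ] GrGroup G n

/-- The `k`-bilinear extension of the bracket `grᵢ(G) × grⱼ(G) → grᵢ₊ⱼ(G)`. -/
def GrLiePiece.bracket {i j n : ℕ} (h : i + j = n) :
    GrLiePiece k G i →ₗ[k] GrLiePiece k G j →ₗ[k] GrLiePiece k G n :=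
  LinearMap.liftBaseChange k (AddMonoidHom.toIntLinearMap (AddMonoidHom.mk'
    (fun a => (AddMonoidHom.toIntLinearMap (GrGroup.bracket G h a)).baseChange k)
    (fun a b => by
      rw [← LinearMap.baseChange_add]
      refine congrArg _ (LinearMap.ext fun c => ?_)
      change GrGroup.bracket G h (a + b) c = GrGroup.bracket G h a c + GrGroup.bracket G h b c
      rw [map_add, AddMonoidHom.add_apply])))

theorem GrLiePiece.bracket_tmul {i j n : ℕ} (h : i + j = n) (c d : k) (a : GrGroup G i)
    (b : GrGroup G j) :
    GrLiePiece.bracket k G h (c ⊗ₜ a) (d ⊗ₜ b) = (c * d) ⊗ₜ GrGroup.bracket G h a b := by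
  simp [GrLiePiece.bracket, TensorProduct.smul_tmul']

theorem GrLiePiece.bracket_skew {i j n : ℕ} (h : i + j = n) (h' : j + i = n)
    (x : GrLiePiece k G i) (y : GrLiePiece k G j) :
    GrLiePiece.bracket k G h x y = -GrLiePiece.bracket k G h' y x := by
  induction x using TensorProduct.induction_on with
  | zero => simp
  | add x x' hx hx' => simp only [map_add, LinearMap.add_apply, hx, hx', neg_add]
  | tmul c a =>
    induction y using TensorProduct.induction_on with
    | zero => simp
    | add y y' hy hy' => simp only [map_add, LinearMap.add_apply, hy, hy', neg_add]
    | tmul d b =>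
      rw [bracket_tmul, bracket_tmul, GrGroup.bracket_skew G h h', TensorProduct.tmul_neg,
        mul_comm]

theorem GrLiePiece.bracket_jacobi {i j l p q r n : ℕ} (hp : i + j = p) (hq : j + l = q)
    (hr : l + i = r) (hpn : p + l = n) (hqn : q + i = n) (hrn : r + j = n)
    (x : GrLiePiece k G i) (y : GrLiePiece k G j) (z : GrLiePiece k G l) :
    bracket k G hpn (bracket k G hp x y) z + bracket k G hqn (bracket k G hq y z) x +
      bracket k G hrn (bracket k G hr z x) y = 0 := by
  induction x using TensorProduct.induction_on with
  | zero => simp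
  | add x x' hx hx' =>
    simp only [map_add, LinearMap.add_apply]
    rw [← add_zero (0 : GrLiePiece k G n)]
    nth_rewrite 1 [← hx]
    rw [← hx']
    abel
  | tmul c a =>
    induction y using TensorProduct.induction_on with
    | zero => simp
    | add y y' hy hy' =>
      simp only [map_add, LinearMap.add_apply]
      rw [← add_zero (0 : GrLiePiece k G n)]
      nth_rewrite 1 [← hy]
      rw [← hy']
      abel
    | tmul d b =>
      induction z using TensorProduct.induction_on with
      | zero => simp
      | add z z' hz hz' =>
        simp only [map_add, LinearMap.add_apply]
        rw [← add_zero (0 : GrLiePiece k G n)]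
        nth_rewrite 1 [← hz]
        rw [← hz']
        abel
      | tmul e w =>
        simp only [bracket_tmul]
        rw [show d * e * c = c * d * e by ring, show e * c * d = c * d * e by ring,
          ← TensorProduct.tmul_add, ← TensorProduct.tmul_add,
          GrGroup.bracket_jacobi G hp hq hr hpn hqn hrn, TensorProduct.tmul_zero]

theorem GrLiePiece.bracket_leibniz {i j l p q r n : ℕ} (hp : i + j = p) (hq : j + l = q)
    (hr : i + l = r) (hpn : p + l = n) (hqn : i + q = n) (hrn : j + r = n)
    (x : GrLiePiece k G i) (y : GrLiePiece k G j) (z : GrLiePiece k G l) :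
    bracket k G hqn x (bracket k G hq y z) =
      bracket k G hpn (bracket k G hp x y) z + bracket k G hrn y (bracket k G hr x z) := by
  have h := bracket_jacobi k G hp hq (by omega : l + i = r) hpn (by omega) (by omega) x y z
  rw [bracket_skew k G (by omega : q + i = n) hqn, bracket_skew k G (by omega : r + j = n) hrn,
    bracket_skew k G (by omega : l + i = r) hr, map_neg, neg_neg] at h
  rw [add_right_comm, add_neg_eq_zero] at h
  exact h.symm

/-- The bracket, extended by zero to all degrees. -/
def GrLiePiece.br (i j n : ℕ) : GrLiePiece k G i →ₗ[k] GrLiePiece k G j →ₗ[k] GrLiePiece k G n :=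
  if h : i + j = n then bracket k G h else 0

theorem GrLiePiece.br_of_eq {i j n : ℕ} (h : i + j = n) : br k G i j n = bracket k G h := dif_pos h

theorem GrLiePiece.br_of_ne {i j n : ℕ} (h : i + j ≠ n) : br k G i j n = 0 := dif_neg h

/-- The degree completion `∏ₙ grₙ(G) ⊗ k` of the associated graded Lie algebra of `G`. -/
def GrLieHat : Type _ := ∀ n, GrLiePiece k G n

instance GrLieHat.instAddCommGroup : AddCommGroup (GrLieHat k G) :=
  inferInstanceAs (AddCommGroup (∀ n, GrLiePiece k G n))
instance GrLieHat.instModule : Module k (GrLieHat k G) :=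
  inferInstanceAs (Module k (∀ n, GrLiePiece k G n))

instance GrLieHat.instBracket : Bracket (GrLieHat k G) (GrLieHat k G) :=
  ⟨fun x y n => ∑ p : Finset.HasAntidiagonal.antidiagonal n,
    GrLiePiece.bracket k G (Finset.HasAntidiagonal.mem_antidiagonal.1 p.2) (x p.1.1) (y p.1.2)⟩

theorem GrLieHat.bracket_apply (x y : GrLieHat k G) {n N : ℕ} (h : n ≤ N) :
    ⁅x, y⁆ n = ∑ i ∈ Finset.range (N + 1), ∑ j ∈ Finset.range (N + 1),
      GrLiePiece.br k G i j n (x i) (y j) := by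
  have h1 : ⁅x, y⁆ n = ∑ p : Finset.HasAntidiagonal.antidiagonal n,
      GrLiePiece.br k G p.1.1 p.1.2 n (x p.1.1) (y p.1.2) :=
    Finset.sum_congr rfl fun p _ => by
      rw [GrLiePiece.br_of_eq k G (Finset.HasAntidiagonal.mem_antidiagonal.1 p.2)]
  rw [h1, Finset.sum_coe_sort (Finset.HasAntidiagonal.antidiagonal n)
    (fun p => GrLiePiece.br k G p.1 p.2 n (x p.1) (y p.2)), ← Finset.sum_product']
  refine Finset.sum_subset (fun p hp => ?_) fun p _ hp => ?_
  · have := Finset.HasAntidiagonal.mem_antidiagonal.1 hp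
    rw [Finset.mem_product, Finset.mem_range, Finset.mem_range]
    omega
  · rw [GrLiePiece.br_of_ne k G fun e => hp (Finset.HasAntidiagonal.mem_antidiagonal.2 e)]
    rfl

theorem GrLiePiece.br_leibniz {i j l n : ℕ} (x : GrLiePiece k G i) (y : GrLiePiece k G j)
    (z : GrLiePiece k G l) :
    ∑ m ∈ Finset.range (n + 1), br k G i m n x (br k G j l m y z) =
      ∑ m ∈ Finset.range (n + 1), br k G m l n (br k G i j m x y) z +
        ∑ m ∈ Finset.range (n + 1), br k G j m n y (br k G i l m x z) := by
  by_cases h : i + j + l = n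
  · rw [Finset.sum_eq_single (j + l), Finset.sum_eq_single (i + j), Finset.sum_eq_single (i + l),
      br_of_eq k G (rfl : j + l = j + l), br_of_eq k G (rfl : i + j = i + j),
      br_of_eq k G (rfl : i + l = i + l), br_of_eq k G (by omega : i + (j + l) = n),
      br_of_eq k G h, br_of_eq k G (by omega : j + (i + l) = n)]
    · exact bracket_leibniz k G _ _ _ _ _ _ x y z
    · intro m _ hm
      rw [br_of_ne k G (Ne.symm hm), LinearMap.zero_apply, LinearMap.zero_apply, map_zero]
    · intro hm; exact absurd (Finset.mem_range.2 (by omega)) hm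
    · intro m _ hm
      rw [br_of_ne k G (Ne.symm hm), LinearMap.zero_apply, LinearMap.zero_apply, map_zero,
        LinearMap.zero_apply]
    · intro hm; exact absurd (Finset.mem_range.2 (by omega)) hm
    · intro m _ hm
      rw [br_of_ne k G (Ne.symm hm), LinearMap.zero_apply, LinearMap.zero_apply, map_zero]
    · intro hm; exact absurd (Finset.mem_range.2 (by omega)) hm
  · rw [Finset.sum_eq_zero, Finset.sum_eq_zero, Finset.sum_eq_zero, add_zero]
    · intro m _
      by_cases hm : i + l = m
      · rw [br_of_ne k G (by omega : j + m ≠ n)]; rfl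
      · rw [br_of_ne k G hm, LinearMap.zero_apply, LinearMap.zero_apply, map_zero]
    · intro m _
      by_cases hm : i + j = m
      · rw [br_of_ne k G (by omega : m + l ≠ n)]; rfl
      · rw [br_of_ne k G hm, LinearMap.zero_apply, LinearMap.zero_apply, map_zero,
          LinearMap.zero_apply]
    · intro m _
      by_cases hm : j + l = m
      · rw [br_of_ne k G (by omega : i + m ≠ n)]; rfl
      · rw [br_of_ne k G hm, LinearMap.zero_apply, LinearMap.zero_apply, map_zero]

theorem GrLieHat.leibniz (x y z : GrLieHat k G) :
    ⁅x, ⁅y, z⁆⁆ = ⁅⁅x, y⁆, z⁆ + ⁅y, ⁅x, z⁆⁆ := by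
  funext n
  change _ = ⁅⁅x, y⁆, z⁆ n + ⁅y, ⁅x, z⁆⁆ n
  have e1 : ⁅x, ⁅y, z⁆⁆ n = ∑ i ∈ Finset.range (n + 1), ∑ j ∈ Finset.range (n + 1),
      ∑ l ∈ Finset.range (n + 1), ∑ m ∈ Finset.range (n + 1),
        GrLiePiece.br k G i m n (x i) (GrLiePiece.br k G j l m (y j) (z l)) := by
    rw [bracket_apply k G _ _ le_rfl]
    refine Finset.sum_congr rfl fun i _ => ?_
    rw [Finset.sum_congr rfl fun m hm => by
      rw [bracket_apply k G y z (Nat.lt_succ_iff.1 (Finset.mem_range.1 hm)), map_sum]]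
    rw [Finset.sum_comm]
    refine Finset.sum_congr rfl fun j _ => ?_
    simp only [map_sum]
    rw [Finset.sum_comm]
  have e2 : ⁅⁅x, y⁆, z⁆ n = ∑ i ∈ Finset.range (n + 1), ∑ j ∈ Finset.range (n + 1),
      ∑ l ∈ Finset.range (n + 1), ∑ m ∈ Finset.range (n + 1),
        GrLiePiece.br k G m l n (GrLiePiece.br k G i j m (x i) (y j)) (z l) := by
    rw [bracket_apply k G _ _ le_rfl]
    rw [Finset.sum_congr rfl fun m hm => Finset.sum_congr rfl fun l _ => by
      rw [bracket_apply k G x y (Nat.lt_succ_iff.1 (Finset.mem_range.1 hm)), map_sum,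
        LinearMap.sum_apply]]
    rw [Finset.sum_congr rfl fun m _ => Finset.sum_comm, Finset.sum_comm]
    refine Finset.sum_congr rfl fun i _ => ?_
    simp only [map_sum, LinearMap.sum_apply]
    rw [Finset.sum_congr rfl fun m _ => Finset.sum_comm, Finset.sum_comm]
    refine Finset.sum_congr rfl fun j _ => ?_
    rw [Finset.sum_comm]
  have e3 : ⁅y, ⁅x, z⁆⁆ n = ∑ i ∈ Finset.range (n + 1), ∑ j ∈ Finset.range (n + 1),
      ∑ l ∈ Finset.range (n + 1), ∑ m ∈ Finset.range (n + 1),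
        GrLiePiece.br k G j m n (y j) (GrLiePiece.br k G i l m (x i) (z l)) := by
    rw [bracket_apply k G _ _ le_rfl]
    rw [Finset.sum_comm (s := Finset.range (n + 1)) (t := Finset.range (n + 1))
      (f := fun i j => ∑ l ∈ Finset.range (n + 1), ∑ m ∈ Finset.range (n + 1),
        GrLiePiece.br k G j m n (y j) (GrLiePiece.br k G i l m (x i) (z l)))]
    refine Finset.sum_congr rfl fun j _ => ?_
    rw [Finset.sum_congr rfl fun m hm => by
      rw [bracket_apply k G x z (Nat.lt_succ_iff.1 (Finset.mem_range.1 hm)), map_sum]]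
    rw [Finset.sum_comm]
    refine Finset.sum_congr rfl fun i _ => ?_
    simp only [map_sum]
    rw [Finset.sum_comm]
  rw [e1, e2, e3]
  rw [← Finset.sum_add_distrib]
  refine Finset.sum_congr rfl fun i _ => ?_
  rw [← Finset.sum_add_distrib]
  refine Finset.sum_congr rfl fun j _ => ?_
  rw [← Finset.sum_add_distrib]
  refine Finset.sum_congr rfl fun l _ => ?_
  exact GrLiePiece.br_leibniz k G (x i) (y j) (z l)

instance GrLieHat.instLieRing [CharZero k] : LieRing (GrLieHat k G) where
  add_lie x y z := by
    funext n
    change _ = ⁅x, z⁆ n + ⁅y, z⁆ n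
    simp only [bracket_apply k G _ _ (le_refl n), ← Finset.sum_add_distrib]
    refine Finset.sum_congr rfl fun i _ => Finset.sum_congr rfl fun j _ => ?_
    rw [show (x + y) i = x i + y i from rfl, map_add, LinearMap.add_apply]
  lie_add x y z := by
    funext n
    change _ = ⁅x, y⁆ n + ⁅x, z⁆ n
    simp only [bracket_apply k G _ _ (le_refl n), ← Finset.sum_add_distrib]
    refine Finset.sum_congr rfl fun i _ => Finset.sum_congr rfl fun j _ => ?_
    rw [show (y + z) j = y j + z j from rfl, map_add]
  lie_self x := by
    funext n
    have h : ⁅x, x⁆ n = -⁅x, x⁆ n := by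
      rw [bracket_apply k G _ _ (le_refl n)]
      nth_rewrite 2 [Finset.sum_comm]
      rw [← Finset.sum_neg_distrib]
      refine Finset.sum_congr rfl fun i _ => ?_
      rw [← Finset.sum_neg_distrib]
      refine Finset.sum_congr rfl fun j _ => ?_
      by_cases h : i + j = n
      · rw [GrLiePiece.br_of_eq k G h, GrLiePiece.br_of_eq k G (by omega : j + i = n)]
        exact GrLiePiece.bracket_skew k G _ _ _ _
      · rw [GrLiePiece.br_of_ne k G h, GrLiePiece.br_of_ne k G (by omega : j + i ≠ n)]
        simp
    have h2 : (2 : k) • ⁅x, x⁆ n = 0 := by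
      rw [two_smul]
      nth_rewrite 1 [h]
      exact neg_add_cancel _
    exact (smul_eq_zero.1 h2).resolve_left two_ne_zero
  leibniz_lie := GrLieHat.leibniz k G

instance GrLieHat.instLieAlgebra [CharZero k] : LieAlgebra k (GrLieHat k G) where
  lie_smul c x y := by
    funext n
    change _ = c • ⁅x, y⁆ n
    simp only [bracket_apply k G _ _ (le_refl n), Finset.smul_sum]
    refine Finset.sum_congr rfl fun i _ => Finset.sum_congr rfl fun j _ => ?_
    rw [show (c • y) j = c • y j from rfl, map_smul]

/-- The filtration `∏_{j ≥ n} grⱼ(G) ⊗ k` of the completed associated graded Lie algebra. -/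
def GrLieHat.filtration (n : ℕ) : Submodule k (GrLieHat k G) where
  carrier := {x | ∀ j < n, x j = 0}
  zero_mem' _ _ := rfl
  add_mem' {x y} hx hy j hj := by
    rw [show (x + y) j = x j + y j from rfl, hx j hj, hy j hj, add_zero]
  smul_mem' c x hx j hj := by rw [show (c • x) j = c • x j from rfl, hx j hj, smul_zero]

end GrLie

section Canonical

open scoped commutatorElement

variable (k G : Type*) [Field k] [Group G]

variable {G} in
theorem of_mul_of_inv (g : G) :
    MonoidAlgebra.of k G g * MonoidAlgebra.of k G g⁻¹ = 1 := by
  rw [← map_mul, mul_inv_cancel, map_one]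

variable {G} in
theorem of_commutator_sub_one (g h : G) :
    MonoidAlgebra.of k G ⁅g, h⁆ - 1 =
      ((MonoidAlgebra.of k G g - 1) * (MonoidAlgebra.of k G h - 1) -
        (MonoidAlgebra.of k G h - 1) * (MonoidAlgebra.of k G g - 1)) *
        MonoidAlgebra.of k G (g⁻¹ * h⁻¹) := by
  have e : ((MonoidAlgebra.of k G g - 1) * (MonoidAlgebra.of k G h - 1) -
        (MonoidAlgebra.of k G h - 1) * (MonoidAlgebra.of k G g - 1)) =
      MonoidAlgebra.of k G (g * h) - MonoidAlgebra.of k G (h * g) := by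
    rw [map_mul, map_mul]; noncomm_ring
  rw [e, sub_mul, ← map_mul, ← map_mul, commutatorElement_def]
  rw [show h * g * (g⁻¹ * h⁻¹) = 1 by group, map_one, show g * h * (g⁻¹ * h⁻¹) = g * h * g⁻¹ * h⁻¹ by group]

theorem pow_mul_mem {n : ℕ} {a : MonoidAlgebra k G} (ha : a ∈ pow k (augIdeal k G) n)
    (b : MonoidAlgebra k G) : a * b ∈ pow k (augIdeal k G) n :=
  Ideal.mul_mem_right b _ ha

/-- The elements `g` with `g - 1 ∈ I ^ n` form a subgroup. -/
def dimensionSubgroup (n : ℕ) : Subgroup G where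
  carrier := {g | MonoidAlgebra.of k G g - 1 ∈ pow k (augIdeal k G) n}
  one_mem' := by
    change MonoidAlgebra.of k G 1 - 1 ∈ pow k (augIdeal k G) n
    rw [map_one, sub_self]; exact zero_mem _
  mul_mem' {g h} hg hh := by
    change MonoidAlgebra.of k G (g * h) - 1 ∈ pow k (augIdeal k G) n
    have e : MonoidAlgebra.of k G (g * h) - 1 =
        (MonoidAlgebra.of k G g - 1) * MonoidAlgebra.of k G h + (MonoidAlgebra.of k G h - 1) := by
      rw [map_mul]; noncomm_ring
    rw [e]
    exact add_mem (pow_mul_mem k G hg _) hh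
  inv_mem' {g} hg := by
    change MonoidAlgebra.of k G g⁻¹ - 1 ∈ pow k (augIdeal k G) n
    have e : MonoidAlgebra.of k G g⁻¹ - 1 =
        -((MonoidAlgebra.of k G g - 1) * MonoidAlgebra.of k G g⁻¹) := by
      rw [sub_mul, of_mul_of_inv]; noncomm_ring
    rw [e]
    exact neg_mem (pow_mul_mem k G hg _)

variable {G} in
theorem sub_one_mem_pow {n : ℕ} {g : G} (hg : g ∈ lcs G n) :
    MonoidAlgebra.of k G g - 1 ∈ pow k (augIdeal k G) n := by
  have h1 : ∀ g : G, MonoidAlgebra.of k G g - 1 ∈ pow k (augIdeal k G) 1 := fun g => by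
    rw [mem_pow, Submodule.pow_one]; exact of_sub_one_mem k g
  have key : ∀ n, lcs G (n + 1) ≤ dimensionSubgroup k G (n + 1) := by
    intro n
    induction n with
    | zero => exact fun g _ => h1 g
    | succ n ih =>
      rw [lcs_succ, Subgroup.commutator_le]
      intro x hx y _
      change MonoidAlgebra.of k G ⁅x, y⁆ - 1 ∈ pow k (augIdeal k G) (n + 1 + 1)
      rw [of_commutator_sub_one]
      have hx' : MonoidAlgebra.of k G x - 1 ∈ pow k (augIdeal k G) (n + 1) := ih hx
      refine pow_mul_mem k G (sub_mem (mul_mem_pow k _ hx' (h1 y)) ?_) _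
      have := mul_mem_pow k _ (h1 y) hx'
      rwa [show 1 + (n + 1) = n + 1 + 1 by omega] at this
  rcases n with _ | n
  · rw [mem_pow, Submodule.pow_zero, Ideal.one_eq_top]; trivial
  · exact key n hg

/-- The canonical map `grₙ(G) → I ^ n / I ^ (n + 1)`, `[g] ↦ [g - 1]`. -/
def quillenGroup (n : ℕ) : GrGroup G n →+ Gr k (augIdeal k G) n :=
  MonoidHom.toAdditiveLeft (QuotientGroup.lift _
    ({ toFun := fun g => Multiplicative.ofAdd
         (Gr.mk k (augIdeal k G) n ⟨MonoidAlgebra.of k G g - 1, sub_one_mem_pow k g.2⟩)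
       map_one' := by
         refine congrArg Multiplicative.ofAdd ((Gr.mk_eq_zero_iff k _).2 ?_)
         change MonoidAlgebra.of k G 1 - 1 ∈ _
         rw [map_one, sub_self]; exact zero_mem _
       map_mul' := fun g h => by
         refine congrArg Multiplicative.ofAdd (Eq.trans ?_ (map_add (Gr.mk k _ n) _ _))
         refine (Gr.mk_eq_iff k _).2 ?_
         change MonoidAlgebra.of k G ((g : G) * h) - 1 - ((MonoidAlgebra.of k G (g : G) - 1) +
           (MonoidAlgebra.of k G (h : G) - 1)) ∈ _
         have e : MonoidAlgebra.of k G ((g : G) * h) - 1 - ((MonoidAlgebra.of k G (g : G) - 1) +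
             (MonoidAlgebra.of k G (h : G) - 1)) =
             (MonoidAlgebra.of k G (g : G) - 1) * (MonoidAlgebra.of k G (h : G) - 1) := by
           rw [map_mul]; noncomm_ring
         rw [e]
         refine mul_mem_pow k _ (sub_one_mem_pow k g.2) ?_
         exact sub_one_mem_pow k (n := 1) (Subgroup.mem_top _) } :
      lcs G n →* Multiplicative (Gr k (augIdeal k G) n))
    (fun g hg => congrArg Multiplicative.ofAdd
      ((Gr.mk_eq_zero_iff k _).2 (sub_one_mem_pow k (n := n + 1) hg))))

/-- The canonical map `grₙ(G) ⊗ k → I ^ n / I ^ (n + 1)`. -/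
def quillenPiece (n : ℕ) : GrLiePiece k G n →ₗ[k] Gr k (augIdeal k G) n :=
  LinearMap.liftBaseChange k (AddMonoidHom.toIntLinearMap (quillenGroup k G n))

theorem quillenPiece_tmul {n : ℕ} (c : k) (a : GrGroup G n) :
    quillenPiece k G n (c ⊗ₜ a) = c • quillenGroup k G n a := rfl

variable {G} in
theorem quillenGroup_mk {n : ℕ} {g : G} (hg : g ∈ lcs G n) :
    quillenGroup k G n (GrGroup.mk g hg) =
      Gr.mk k (augIdeal k G) n ⟨MonoidAlgebra.of k G g - 1, sub_one_mem_pow k hg⟩ := rfl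

theorem quillenGroup_bracket {i j n : ℕ} (h : i + j = n) (h' : j + i = n)
    (a : GrGroup G i) (b : GrGroup G j) :
    quillenGroup k G n (GrGroup.bracket G h a b) =
      Gr.mul k (augIdeal k G) h (quillenGroup k G i a) (quillenGroup k G j b) -
        Gr.mul k (augIdeal k G) h' (quillenGroup k G j b) (quillenGroup k G i a) := by
  obtain ⟨x, hx, rfl⟩ := GrGroup.mk_surjective a
  obtain ⟨y, hy, rfl⟩ := GrGroup.mk_surjective b
  rw [GrGroup.bracket_mk, quillenGroup_mk, quillenGroup_mk, quillenGroup_mk]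
  refine Gr.mk_eq_mul_sub_mul k (augIdeal k G) h h' _ _ _ ?_
  have h0 := mul_mem_pow k (augIdeal k G) (sub_one_mem_pow k hx) (sub_one_mem_pow k hy)
  have h1 := mul_mem_pow k (augIdeal k G) (sub_one_mem_pow k hy) (sub_one_mem_pow k hx)
  rw [h] at h0
  rw [h'] at h1
  change MonoidAlgebra.of k G ⁅x, y⁆ - 1 -
    ((MonoidAlgebra.of k G x - 1) * (MonoidAlgebra.of k G y - 1) -
      (MonoidAlgebra.of k G y - 1) * (MonoidAlgebra.of k G x - 1)) ∈ pow k (augIdeal k G) (n + 1)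
  rw [of_commutator_sub_one, ← mul_sub_one]
  exact mul_mem_pow k _ (sub_mem h0 h1) (sub_one_mem_pow k (n := 1) (Subgroup.mem_top _))

theorem quillenPiece_bracket {i j n : ℕ} (h : i + j = n) (h' : j + i = n)
    (x : GrLiePiece k G i) (y : GrLiePiece k G j) :
    quillenPiece k G n (GrLiePiece.bracket k G h x y) =
      Gr.mul k (augIdeal k G) h (quillenPiece k G i x) (quillenPiece k G j y) -
        Gr.mul k (augIdeal k G) h' (quillenPiece k G j y) (quillenPiece k G i x) := by
  induction x using TensorProduct.induction_on with
  | zero => simp only [map_zero, LinearMap.zero_apply, sub_zero]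
  | add x x' hx hx' =>
    simp only [map_add, LinearMap.add_apply, hx, hx']
    exact (add_sub_add_comm _ _ _ _).symm
  | tmul c a =>
    induction y using TensorProduct.induction_on with
    | zero => simp only [map_zero, LinearMap.zero_apply, sub_zero]
    | add y y' hy hy' =>
      simp only [map_add, LinearMap.add_apply, hy, hy']
      exact (add_sub_add_comm _ _ _ _).symm
    | tmul d b =>
      rw [GrLiePiece.bracket_tmul, quillenPiece_tmul, quillenPiece_tmul, quillenPiece_tmul,
        quillenGroup_bracket k G h h', map_smul, map_smul, map_smul, map_smul,
        LinearMap.smul_apply, LinearMap.smul_apply, smul_smul, smul_smul, smul_sub, mul_comm d c]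

variable [CharZero k]

/-- The canonical Lie algebra map from the completed associated graded Lie algebra of `G` to the
completed associated graded algebra of its group algebra. -/
def quillenHat : GrLieHat k G →ₗ⁅k⁆ GrGroupAlgebraHat k G where
  toFun x n := quillenPiece k G n (x n)
  map_add' x y := funext fun n => map_add (quillenPiece k G n) (x n) (y n)
  map_smul' c x := funext fun n => map_smul (quillenPiece k G n) c (x n)
  map_lie' {x y} := by
    funext n
    refine Eq.trans ?_ (GrHat.lie_apply k (augIdeal k G) _ _ n).symm
    refine (map_sum (quillenPiece k G n) _ _).trans ?_
    exact Finset.sum_congr rfl fun p _ => quillenPiece_bracket k G _ _ _ _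

end Canonical

section Enveloping

variable (k : Type*) [Field k] (L : Type*) [LieRing L] [LieAlgebra k L]

/-- The augmentation ideal of the universal enveloping algebra. -/
def envAug : Ideal (UniversalEnvelopingAlgebra k L) :=
  RingHom.ker (UniversalEnvelopingAlgebra.lift k (0 : L →ₗ⁅k⁆ k))

instance envAug_isTwoSided : (envAug k L).IsTwoSided :=
  inferInstanceAs (RingHom.ker (UniversalEnvelopingAlgebra.lift k (0 : L →ₗ⁅k⁆ k))).IsTwoSided

/-- The completed enveloping algebra: the completion of the universal enveloping algebra with
respect to the powers of its augmentation ideal. -/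
abbrev EnvHat : Type _ := Completion k (envAug k L)

variable {L}

theorem env_pow_mem {B : Type*} [Ring B] [Algebra k B] (W : ℕ → Submodule k B)
    (h0 : ∀ x, x ∈ W 0) (hW : ∀ {m n x y}, x ∈ W m → y ∈ W n → x * y ∈ W (m + n))
    (φ : UniversalEnvelopingAlgebra k L →ₐ[k] B)
    (hφ : ∀ x, φ (UniversalEnvelopingAlgebra.ι k x) ∈ W 1) (n : ℕ)
    {b : UniversalEnvelopingAlgebra k L} (hb : b ∈ envAug k L ^ n) : φ b ∈ W n := by
  have h1 : ∀ b ∈ envAug k L, φ b ∈ W 1 := by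
    intro b hb
    let K : Ideal B :=
      { carrier := W 1
        add_mem' := fun hx hy => add_mem hx hy
        zero_mem' := zero_mem _
        smul_mem' := fun c x hx => by simpa using hW (h0 c) hx }
    have : K.IsTwoSided :=
      ⟨fun c hx => show _ ∈ W 1 by simpa using hW (show _ ∈ W 1 from hx) (h0 c)⟩
    have e : (Ideal.Quotient.mkₐ k K).comp φ = (Algebra.ofId k (B ⧸ K)).comp
        (UniversalEnvelopingAlgebra.lift k (0 : L →ₗ⁅k⁆ k)) := by
      refine UniversalEnvelopingAlgebra.hom_ext _ (LieHom.ext fun x => ?_)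
      refine Eq.trans (b := 0) (Ideal.Quotient.eq_zero_iff_mem.2 (hφ x)) ?_
      change _ = (Algebra.ofId k (B ⧸ K)) ((UniversalEnvelopingAlgebra.lift k (0 : L →ₗ⁅k⁆ k))
        (UniversalEnvelopingAlgebra.ι k x))
      rw [UniversalEnvelopingAlgebra.lift_ι_apply, LieHom.zero_apply, map_zero]
    have hb' := DFunLike.congr_fun e b
    rw [AlgHom.comp_apply, AlgHom.comp_apply, (RingHom.mem_ker.1 hb : _ = (0 : k)), map_zero] at hb'
    exact Ideal.Quotient.eq_zero_iff_mem.1 hb'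
  induction n generalizing b with
  | zero => exact h0 _
  | succ n ih =>
    rw [Submodule.pow_succ] at hb
    induction hb using Submodule.mul_induction_on' with
    | mem_mul_mem x hx y hy => rw [map_mul]; exact hW (ih hx) (h1 y hy)
    | add x _ y _ hx hy => rw [map_add]; exact add_mem hx hy

theorem ι_mem_envAug (x : L) : UniversalEnvelopingAlgebra.ι k x ∈ envAug k L := by
  rw [envAug, RingHom.mem_ker]
  exact UniversalEnvelopingAlgebra.lift_ι_apply k (0 : L →ₗ⁅k⁆ k) x

variable {L' : Type*} [LieRing L'] [LieAlgebra k L']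

/-- The map of enveloping algebras induced by a map of Lie algebras. -/
def envMap (f : L →ₗ⁅k⁆ L') :
    UniversalEnvelopingAlgebra k L →ₐ[k] UniversalEnvelopingAlgebra k L' :=
  UniversalEnvelopingAlgebra.lift k ((UniversalEnvelopingAlgebra.ι k).comp f)

/-- The map of completed enveloping algebras induced by a map of Lie algebras. -/
def envHatMap (f : L →ₗ⁅k⁆ L') : EnvHat k L →ₐ[k] EnvHat k L' :=
  Completion.extend k (envAug k L') (envAug k L)
    ((toCompletion k (envAug k L')).comp (envMap k f))
    fun n _ hb => env_pow_mem k (Completion.filtration k (envAug k L'))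
      (Completion.mem_filtration_zero k _) (Completion.mul_mem_filtration k _) _
      (fun x => by
        rw [AlgHom.comp_apply, envMap, UniversalEnvelopingAlgebra.lift_ι_apply]
        refine Ideal.Quotient.eq_zero_iff_mem.2 ?_
        rw [Submodule.pow_one]
        exact ι_mem_envAug k (f x)) n hb

end Enveloping

section Main

variable (k G : Type*) [Field k] [Group G]

theorem malcev_mem_filtration_one (x : malcev k G) :
    (x : GroupAlgebraHat k G) ∈ Completion.filtration k (augIdeal k G) 1 := by
  obtain ⟨x, hx⟩ := x
  have hx' : completedComul k G x = CompletedTensor.inl k _ x + CompletedTensor.inr k _ x := hx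
  obtain ⟨a, ha⟩ := Ideal.Quotient.mk_surjective (Completion.proj k (augIdeal k G) (2 * 1) x)
  have ha1 : Completion.proj k (augIdeal k G) 1 x = Ideal.Quotient.mkₐ k (augIdeal k G ^ 1) a := by
    rw [← Completion.transition_proj k _ (show 1 ≤ 2 * 1 by omega), ← ha]; rfl
  have h := congrArg (CompletedTensor.proj k (augIdeal k G) 1) hx'
  have hl : CompletedTensor.proj k (augIdeal k G) 1 (completedComul k G x) =
      comulLevel k G 1 (Completion.proj k (augIdeal k G) (2 * 1) x) := rfl
  have hr1 : CompletedTensor.proj k (augIdeal k G) 1 (CompletedTensor.inl k _ x) =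
      Completion.proj k (augIdeal k G) 1 x ⊗ₜ[k] 1 := rfl
  have hr2 : CompletedTensor.proj k (augIdeal k G) 1 (CompletedTensor.inr k _ x) =
      1 ⊗ₜ[k] Completion.proj k (augIdeal k G) 1 x := rfl
  rw [map_add, hl, hr1, hr2, ha1, ← ha] at h
  let ε := Bialgebra.counitAlgHom k (MonoidAlgebra k G)
  let εb : (MonoidAlgebra k G ⧸ augIdeal k G ^ 1) →ₐ[k] k :=
    Ideal.Quotient.liftₐ _ ε fun b hb => by
      rw [Submodule.pow_one] at hb; exact hb
  let μ := (Algebra.TensorProduct.lmul' k (S := k)).comp (Algebra.TensorProduct.map εb εb)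
  have hμ : (μ.comp (Algebra.TensorProduct.map (Ideal.Quotient.mkₐ k (augIdeal k G ^ 1))
      (Ideal.Quotient.mkₐ k (augIdeal k G ^ 1)))).comp
        (Bialgebra.comulAlgHom k (MonoidAlgebra k G)) = ε := by
    ext g
    have e1 : εb (Ideal.Quotient.mkₐ k (augIdeal k G ^ 1) (MonoidAlgebra.single g (1 : k))) =
      ε (MonoidAlgebra.single g (1 : k)) := rfl
    have e2 : ε (MonoidAlgebra.single g (1 : k)) = 1 := by simp [ε]
    simp only [AlgHom.comp_apply, Bialgebra.comulAlgHom_apply, MonoidAlgebra.comul_single,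
      CommSemiring.comul_apply, TensorProduct.map_tmul, Algebra.TensorProduct.map_tmul, μ,
      MonoidAlgebra.lsingle_apply, e1, e2, Algebra.TensorProduct.lmul'_apply_tmul, mul_one]
  have h2 := congrArg μ h
  have h3 : μ (comulLevel k G 1 (Ideal.Quotient.mk _ a)) = ε a := DFunLike.congr_fun hμ a
  have h4 : μ (Ideal.Quotient.mkₐ k (augIdeal k G ^ 1) a ⊗ₜ[k] 1) = ε a := by
    change εb (Ideal.Quotient.mkₐ k (augIdeal k G ^ 1) a) * εb 1 = _
    rw [map_one, mul_one]; rfl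
  have h5 : μ (1 ⊗ₜ[k] Ideal.Quotient.mkₐ k (augIdeal k G ^ 1) a) = ε a := by
    change εb 1 * εb (Ideal.Quotient.mkₐ k (augIdeal k G ^ 1) a) = _
    rw [map_one, one_mul]; rfl
  rw [h3, map_add, h4, h5, left_eq_add] at h2
  change Completion.proj k (augIdeal k G) 1 x = 0
  rw [ha1]
  refine Ideal.Quotient.eq_zero_iff_mem.2 ?_
  rw [Submodule.pow_one]
  exact h2

/-- The algebra map from the completed enveloping algebra of the Malcev Lie algebra to the
completed group algebra induced by the inclusion of the Malcev Lie algebra. -/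
def malcevEnv : EnvHat k (malcev k G) →ₐ[k] GroupAlgebraHat k G :=
  Completion.extend k (augIdeal k G) (envAug k (malcev k G))
    (UniversalEnvelopingAlgebra.lift k (malcev k G).incl)
    fun n _ hb => env_pow_mem k (Completion.filtration k (augIdeal k G))
      (Completion.mem_filtration_zero k _) (Completion.mul_mem_filtration k _) _
      (fun x => by
        rw [UniversalEnvelopingAlgebra.lift_ι_apply]
        exact malcev_mem_filtration_one k G x) n hb

theorem quillenPiece_zero (x : GrLiePiece k G 0) : quillenPiece k G 0 x = 0 := by
  induction x using TensorProduct.induction_on with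
  | zero => exact map_zero _
  | add x y hx hy => rw [map_add, hx, hy, add_zero]
  | tmul c a =>
    obtain ⟨g, hg, rfl⟩ := GrGroup.mk_surjective a
    rw [quillenPiece_tmul, quillenGroup_mk,
      (Gr.mk_eq_zero_iff k (augIdeal k G)).2 (sub_one_mem_pow k (n := 1) (Subgroup.mem_top g)),
      smul_zero]

/-- A Taylor expansion of `G`: a multiplicative map `E` from `G` to the completed associated graded
algebra of `kG` whose linear extension to `kG` preserves filtrations and induces the identity of
the associated graded algebra, and whose values are group-like. -/
@[ext]
structure TaylorExpansion where
  /-- The map `E`. -/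
  toHom : G →* GrGroupAlgebraHat k G
  filtered : ∀ n, ∀ a ∈ augIdeal k G ^ n,
    MonoidAlgebra.lift k _ G toHom a ∈ GrHat.filtration k (augIdeal k G) n
  gr_eq_id : ∀ n (a : pow k (augIdeal k G) n),
    MonoidAlgebra.lift k _ G toHom (a : MonoidAlgebra k G) n = Gr.mk k (augIdeal k G) n a
  groupLike : ∀ g, grComul k G (toHom g) = GrTensor.tmul k _ (toHom g) (toHom g)

namespace TaylorExpansion

variable {k G} (E : TaylorExpansion k G)

/-- The linear extension of `E` to the group algebra. -/
def linearExtension : MonoidAlgebra k G →ₐ[k] GrGroupAlgebraHat k G :=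
  MonoidAlgebra.lift k _ G E.toHom

/-- The map `Ê` from the completed group algebra to the completed associated graded algebra induced
by `E`. -/
def hat : GroupAlgebraHat k G →ₗ[k] GrGroupAlgebraHat k G :=
  GrHat.extend k _ _ E.linearExtension.toLinearMap E.filtered

/-- The completed tensor square of `Ê`. -/
def hatTensor : CompletedTensor k (augIdeal k G) →ₗ[k] GrTensor k (augIdeal k G) :=
  GrTensor.extend k _ _ E.linearExtension.toLinearMap E.filtered

/-- `Ê` is a filtration-preserving isomorphism of complete Hopf algebras which induces the identity
of the associated graded algebra. -/
structure IsHopfIso : Prop where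
  bijective : Function.Bijective E.hat
  map_one : E.hat 1 = 1
  map_mul : ∀ x y, E.hat (x * y) = E.hat x * E.hat y
  map_comul : ∀ x, grComul k G (E.hat x) = E.hatTensor (completedComul k G x)
  mem_filtration_iff : ∀ n x, E.hat x ∈ GrHat.filtration k (augIdeal k G) n ↔
    x ∈ Completion.filtration k (augIdeal k G) n
  gr_eq_id : ∀ n (a : pow k (augIdeal k G) n) (x : GroupAlgebraHat k G),
    Completion.proj k _ (n + 1) x = Ideal.Quotient.mk _ (a : MonoidAlgebra k G) →
      E.hat x n = Gr.mk k _ n a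

end TaylorExpansion

variable [CharZero k]

/-- The map from the completed enveloping algebra of the completed associated graded Lie algebra of
`G` to the completed associated graded algebra of `kG` induced by the canonical map. -/
def grEnv : EnvHat k (GrLieHat k G) →ₗ[k] GrGroupAlgebraHat k G :=
  GrHat.extend k (augIdeal k G) (envAug k (GrLieHat k G))
    (UniversalEnvelopingAlgebra.lift k (quillenHat k G)).toLinearMap
    fun n _ hb => env_pow_mem k (GrHat.filtration k (augIdeal k G))
      (GrHat.mem_filtration_zero k _) (GrHat.mul_mem_filtration k _)
      (UniversalEnvelopingAlgebra.lift k (quillenHat k G))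
      (fun x => by
        rw [UniversalEnvelopingAlgebra.lift_ι_apply]
        intro j hj
        obtain rfl : j = 0 := by omega
        exact quillenPiece_zero k G (x 0)) n hb

/-- A filtration-preserving Lie algebra isomorphism from the Malcev Lie algebra of `G` to the
degree completion of the associated graded Lie algebra of `G` which induces the identity on
associated graded Lie algebras. Both `grₙ` of the Malcev Lie algebra and `grₙ(G) ⊗ k` are compared
inside `I ^ n / I ^ (n + 1)`: if `x` is congruent to `a ∈ I ^ n` modulo the `(n + 1)`-st term of the
filtration, then the component of its image in degree `n` corresponds to the class of `a`. -/
@[ext]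
structure FilteredLieIso where
  /-- The Lie algebra isomorphism. -/
  toEquiv : malcev k G ≃ₗ⁅k⁆ GrLieHat k G
  filtered : ∀ n, ∀ x ∈ malcevFiltration k G n, toEquiv x ∈ GrLieHat.filtration k G n
  gr_eq_id : ∀ n (a : pow k (augIdeal k G) n) (x : malcev k G),
    Completion.proj k (augIdeal k G) (n + 1) x = Ideal.Quotient.mk _ (a : MonoidAlgebra k G) →
      quillenPiece k G n (toEquiv x n) = Gr.mk k (augIdeal k G) n a

end Main

end TaylorExp

end

/-! All statements are reduced to associated graded objects, and completeness carries them back.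
Write I for the augmentation ideal and m for the Malcev Lie algebra. Three facts carry the theorem.

(1) Primitive classes in I^n/I^(n+1) are Lie polynomials in degree one
(`HopfData.mk_mem_of_primitive`). The Dynkin operator D(a) = ∑ j S(a')a'', with j the degree of a'',
satisfies D(ax) = [D(a), x] for a of positive degree and x of degree one, while D(a) = n a if a is
primitive of degree n; in characteristic 0 one divides by n. For kG this shows that q maps onto the
primitives. For enveloping algebras it takes the place of the Poincaré–Birkhoff–Witt theorem.

(2) Quillen's map from grₙ(G) ⊗ k to I^n/I^(n+1) is injective (`quillenPiece_injective`). Dually,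
every character of Γₙ/Γₙ₊₁ has to extend to a linear form on kG which vanishes on I^(n+1). It is
extended from Γₙ up to G, adjoining one element t to a subgroup K at a time
(`CharactersExtend.sup_zpowers`): the larger group acts on a truncation of kK, where t acts by
conjugation followed by multiplication by a p-th root of t^p, given by the binomial series.

(3) The logarithm of a group element is primitive and has the leading term of g - 1 (`exists_log`),
so the graded pieces of m are those of gr(G) ⊗ k. As these are generated by finitely many elements
of degree one, completeness puts the filtrations of m and of the completed gr(G) ⊗ k inside the
algebraic lower central series (`filtration_le_lieGamma`).

From (1) and (3), together with (2) in the graded case, the maps from the enveloping algebras to the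
two complete algebras are strict for the filtrations (`env_mem_pow_of_map_mem`). They are also onto
in the graded sense, so θ₁ and θ₂ are bijective.

For the correspondence, Ê is filtered with gr(Ê) = id, hence bijective. It respects
comultiplications because E is group-like, so it restricts to primitives. Conversely, θ₂ ∘ Û(α) ∘
θ₁⁻¹ is a filtered algebra map. It is the identity on gr because gr(kG) is generated in degree one,
where all classes are primitive; it respects comultiplications because it does so on the dense image
of U(m). Its restriction to G is the expansion. The two constructions are inverse to each other
since filtered algebra maps that agree on m agree everywhere. -/

noncomputable section

namespace TaylorExp

/-! ### The tensor product filtration of A ⊗ A. -/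

section TensorFiltration

variable (k : Type*) {A : Type*} [Field k] [Ring A] [Algebra k A] (I : Ideal A) [I.IsTwoSided]

theorem mem_pow_zero (a : A) : a ∈ pow k I 0 := by
  rw [mem_pow, Submodule.pow_zero, Ideal.one_eq_top]; trivial

theorem mem_pow_one {a : A} : a ∈ pow k I 1 ↔ a ∈ I := by
  rw [mem_pow, Submodule.pow_one]

/-- Induction on the number of factors for the powers of an ideal. -/
theorem pow_induction {P : ℕ → A → Prop} (h0 : ∀ a, P 0 a)
    (hadd : ∀ n, ∀ a ∈ pow k I n, ∀ b ∈ pow k I n, P n a → P n b → P n (a + b))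
    (hmul : ∀ n, ∀ a ∈ pow k I n, ∀ b ∈ I, P n a → P (n + 1) (a * b)) {n : ℕ} {a : A}
    (ha : a ∈ pow k I n) : P n a := by
  induction n generalizing a with
  | zero => exact h0 a
  | succ n ih =>
    rw [mem_pow, Submodule.pow_succ] at ha
    induction ha using Submodule.mul_induction_on' with
    | mem_mul_mem a ha b hb => exact hmul n a ha b hb (ih ha)
    | add a ha' b hb' ha hb =>
      rw [← Submodule.pow_succ] at ha' hb'
      exact hadd _ _ ha' _ hb' ha hb

theorem mem_tensorPow_zero (t : A ⊗[k] A) : t ∈ tensorPow k I 0 := by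
  induction t using TensorProduct.induction_on with
  | zero => exact zero_mem _
  | tmul x y =>
    exact tmul_mem_tensorPow k I (i := 0) (j := 0) rfl (mem_pow_zero k I x) (mem_pow_zero k I y)
  | add s t hs ht => exact add_mem hs ht

theorem tensorPow_succ_le (n : ℕ) : tensorPow k I (n + 1) ≤ tensorPow k I n := by
  refine Submodule.span_le.2 ?_
  rintro _ ⟨i, j, h, a, ha, b, hb, rfl⟩
  rcases i with _ | i
  · exact tmul_mem_tensorPow k I (i := 0) (j := n) (by omega) ha
      (pow_antitone k I (by omega) hb)
  · exact tmul_mem_tensorPow k I (i := i) (j := j) (by omega) (pow_antitone k I (by omega) ha) hb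

theorem tensorPow_antitone : Antitone (tensorPow k I) :=
  antitone_nat_of_succ_le (tensorPow_succ_le k I)

/-- The filtration term is only a span inside A ⊗ A, so the usual extensionality for tensor products
does not apply to it. -/
theorem tensorPow_hom_ext {n : ℕ} {M : Type*} [AddCommGroup M] [Module k M]
    {f g : tensorPow k I n →ₗ[k] M}
    (h : ∀ i j (hij : i + j = n) (a : pow k I i) (b : pow k I j),
      f ⟨a.1 ⊗ₜ b.1, tmul_mem_tensorPow k I hij a.2 b.2⟩ =
        g ⟨a.1 ⊗ₜ b.1, tmul_mem_tensorPow k I hij a.2 b.2⟩) : f = g := by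
  ext ⟨t, ht⟩
  induction ht using Submodule.span_induction with
  | mem t ht =>
    obtain ⟨i, j, hij, a, ha, b, hb, rfl⟩ := ht
    exact h i j hij ⟨a, ha⟩ ⟨b, hb⟩
  | zero => exact (map_zero f).trans (map_zero g).symm
  | add s t hs' ht' hs ht =>
    exact (map_add f ⟨s, hs'⟩ ⟨t, ht'⟩).trans
      ((congrArg₂ (· + ·) hs ht).trans (map_add g ⟨s, hs'⟩ ⟨t, ht'⟩).symm)
  | smul c t ht' ht =>
    exact (map_smul f c ⟨t, ht'⟩).trans
      ((congrArg (c • ·) ht).trans (map_smul g c ⟨t, ht'⟩).symm)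

theorem grTensorProj_eq_zero {i j n : ℕ} (h : i + j = n) (t : tensorPow k I n)
    (ht : (t : A ⊗[k] A) ∈ tensorPow k I (n + 1)) : grTensorProj k I h t = 0 :=
  Gr.incl_tensor_injective k I i j (by
    rw [map_zero, incl_grTensorProj]
    exact mk_tensor_eq_zero k I (by omega) ht)

/-- Since i + j = i' + j', either i < i' or j < j', and then one of the two factors lies in the next
power of I. -/
theorem grTensorProj_tmul_of_ne {i j i' j' n : ℕ} (h : i + j = n) (h' : i' + j' = n)
    (hne : i ≠ i') (a : pow k I i') (b : pow k I j') :
    grTensorProj k I h ⟨a.1 ⊗ₜ b.1, tmul_mem_tensorPow k I h' a.2 b.2⟩ = 0 :=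
  Gr.incl_tensor_injective k I i j (by
    rw [map_zero, incl_grTensorProj, Algebra.TensorProduct.map_tmul]
    rcases lt_or_ge i i' with hi | hi
    · rw [show Ideal.Quotient.mkₐ k (I ^ (i + 1)) a.1 = 0 from
        Ideal.Quotient.eq_zero_iff_mem.2 (pow_antitone k I hi a.2), TensorProduct.zero_tmul]
    · rw [show Ideal.Quotient.mkₐ k (I ^ (j + 1)) b.1 = 0 from
        Ideal.Quotient.eq_zero_iff_mem.2 (pow_antitone k I (by omega : j + 1 ≤ j') b.2),
        TensorProduct.tmul_zero])

theorem Gr.mk_eq_mk {n : ℕ} {a b : A} {ha : a ∈ pow k I n} {hb : b ∈ pow k I n}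
    (h : a - b ∈ pow k I (n + 1)) : Gr.mk k I n ⟨a, ha⟩ = Gr.mk k I n ⟨b, hb⟩ :=
  (Gr.mk_eq_iff k I).2 h

end TensorFiltration

/-! ### Filtered Hopf algebras and the Dynkin operator. -/

/-- A comultiplication, a counit and an antipode on an algebra such that the given ideal is the
kernel of the counit and its elements are primitive modulo `∑_{i + j = 2} I ^ i ⊗ I ^ j`. -/
structure HopfData (k : Type*) {A : Type*} [Field k] [Ring A] [Algebra k A] (I : Ideal A)
    [I.IsTwoSided] where
  /-- The comultiplication. -/
  comul : A →ₐ[k] A ⊗[k] A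
  /-- The counit. -/
  counit : A →ₐ[k] k
  /-- The antipode. -/
  anti : A →ₗ[k] A
  mem_iff : ∀ a, a ∈ I ↔ counit a = 0
  comul_sub_mem : ∀ a ∈ I, comul a - (a ⊗ₜ 1 + 1 ⊗ₜ a) ∈ tensorPow k I 2
  counit_comul : ∀ a, Algebra.TensorProduct.lid k A
    (Algebra.TensorProduct.map counit (AlgHom.id k A) (comul a)) = a
  anti_one : anti 1 = 1
  anti_mul : ∀ a b, anti (a * b) = anti b * anti a
  anti_add_mem : ∀ a ∈ I, anti a + a ∈ pow k I 2
  anti_comul : ∀ a, LinearMap.mul' k A (anti.rTensor A (comul a)) = algebraMap k A (counit a)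

namespace HopfData

variable {k : Type*} {A : Type*} [Field k] [Ring A] [Algebra k A] {I : Ideal A} [I.IsTwoSided]
  (H : HopfData k I)

theorem comul_mem_one {a : A} (ha : a ∈ I) : H.comul a ∈ tensorPow k I 1 := by
  have h := tensorPow_succ_le k I 1 (H.comul_sub_mem a ha)
  have ha' := (mem_pow_one k I).2 ha
  have h' : a ⊗ₜ[k] (1 : A) + 1 ⊗ₜ a ∈ tensorPow k I 1 :=
    add_mem (tmul_mem_tensorPow k I (i := 1) (j := 0) rfl ha' (one_mem_pow_zero k I))
      (tmul_mem_tensorPow k I (i := 0) (j := 1) rfl (one_mem_pow_zero k I) ha')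
  simpa using add_mem h h'

theorem comul_mem {n : ℕ} {a : A} (ha : a ∈ pow k I n) : H.comul a ∈ tensorPow k I n := by
  refine pow_induction k I (P := fun n a => H.comul a ∈ tensorPow k I n)
    (fun a => mem_tensorPow_zero k I _) (fun n a _ b _ ha hb => ?_) (fun n a _ b hb h => ?_) ha
  · rw [map_add]; exact add_mem ha hb
  · rw [map_mul]; exact mul_mem_tensorPow k I h (H.comul_mem_one hb)

theorem anti_mem {n : ℕ} {a : A} (ha : a ∈ pow k I n) : H.anti a ∈ pow k I n := by
  refine pow_induction k I (P := fun n a => H.anti a ∈ pow k I n)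
    (fun a => mem_pow_zero k I _) (fun n a _ b _ ha hb => ?_) (fun n a _ b hb h => ?_) ha
  · rw [map_add]; exact add_mem ha hb
  · rw [H.anti_mul, add_comm n 1]
    refine mul_mem_pow k I ?_ h
    have h1 := sub_mem (pow_antitone k I one_le_two (H.anti_add_mem b hb))
      ((mem_pow_one k I).2 hb)
    rwa [add_sub_cancel_right] at h1

theorem counit_eq_zero {n : ℕ} (hn : 0 < n) {a : A} (ha : a ∈ pow k I n) : H.counit a = 0 :=
  (H.mem_iff a).1 ((mem_pow_one k I).1 (pow_antitone k I hn ha))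

theorem sub_counit_mem (a : A) : a - algebraMap k A (H.counit a) ∈ I := by
  rw [H.mem_iff, map_sub, AlgHom.commutes]; exact sub_self _

/-- The map of associated graded spaces induced by the antipode. -/
def grAnti (n : ℕ) : Gr k I n →ₗ[k] Gr k I n :=
  Submodule.mapQ _ _ (H.anti.restrict fun _ ha => H.anti_mem ha)
    fun a ha => H.anti_mem (n := n + 1) (a := a) ha

/-- The map `∑_{i + j = n} I ^ i ⊗ I ^ j → I ^ n / I ^ (n + 1)` induced by `a ⊗ b ↦ j S(a) b`
on `I ^ i ⊗ I ^ j`. -/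
def dynkin (n : ℕ) : tensorPow k I n →ₗ[k] Gr k I n :=
  ∑ p : Finset.HasAntidiagonal.antidiagonal n, (p.1.2 : k) •
    (TensorProduct.lift (Gr.mul k I (Finset.HasAntidiagonal.mem_antidiagonal.1 p.2)) ∘ₗ
      TensorProduct.map (H.grAnti p.1.1) LinearMap.id ∘ₗ
        grTensorProj k I (Finset.HasAntidiagonal.mem_antidiagonal.1 p.2))

theorem dynkin_tmul {i j n : ℕ} (h : i + j = n) (a : pow k I i) (b : pow k I j) :
    H.dynkin n ⟨a.1 ⊗ₜ b.1, tmul_mem_tensorPow k I h a.2 b.2⟩ =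
      (j : k) • Gr.mk k I n ⟨H.anti a * b, h ▸ mul_mem_pow k I (H.anti_mem a.2) b.2⟩ := by
  rw [dynkin, LinearMap.sum_apply, Finset.sum_eq_single
    ⟨(i, j), Finset.HasAntidiagonal.mem_antidiagonal.2 h⟩]
  · rw [LinearMap.smul_apply, LinearMap.comp_apply, LinearMap.comp_apply, grTensorProj_tmul,
      TensorProduct.map_tmul, TensorProduct.lift.tmul]
    rfl
  · intro p _ hp
    have hp' : p.1.1 ≠ i := fun e => hp (Subtype.ext (Prod.ext e (by
      have := Finset.HasAntidiagonal.mem_antidiagonal.1 p.2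
      dsimp only
      omega)))
    rw [LinearMap.smul_apply, LinearMap.comp_apply, LinearMap.comp_apply,
      grTensorProj_tmul_of_ne k I _ h hp', map_zero, map_zero, smul_zero]
  · intro h'; exact absurd (Finset.mem_univ _) h'

/-- Consequently the operator only sees leading terms, and a comultiplication may be replaced by
anything congruent to it in the next degree. -/
theorem dynkin_eq_zero {n : ℕ} (t : tensorPow k I n)
    (ht : (t : A ⊗[k] A) ∈ tensorPow k I (n + 1)) : H.dynkin n t = 0 := by
  rw [dynkin, LinearMap.sum_apply]
  refine Finset.sum_eq_zero fun p _ => ?_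
  rw [LinearMap.smul_apply, LinearMap.comp_apply, LinearMap.comp_apply,
    grTensorProj_eq_zero k I _ t ht, map_zero, map_zero, smul_zero]

theorem mul_anti_mem {n : ℕ} {t : A ⊗[k] A} (ht : t ∈ tensorPow k I n) :
    LinearMap.mul' k A (H.anti.rTensor A t) ∈ pow k I n := by
  induction ht using Submodule.span_induction with
  | mem t ht =>
    obtain ⟨i, j, rfl, a, ha, b, hb, rfl⟩ := ht
    exact mul_mem_pow k I (H.anti_mem ha) hb
  | zero => rw [map_zero, map_zero]; exact zero_mem _
  | add s t _ _ hs ht => rw [map_add, map_add]; exact add_mem hs ht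
  | smul c t _ ht => rw [map_smul, map_smul]; exact Submodule.smul_mem _ c ht

theorem primitive_mem_tensorPow_one {x : A} (hx : x ∈ I) :
    x ⊗ₜ[k] (1 : A) + 1 ⊗ₜ x ∈ tensorPow k I 1 :=
  add_mem (tmul_mem_tensorPow k I (i := 1) (j := 0) rfl ((mem_pow_one k I).2 hx)
      (one_mem_pow_zero k I))
    (tmul_mem_tensorPow k I (i := 0) (j := 1) rfl (one_mem_pow_zero k I) ((mem_pow_one k I).2 hx))

/-- For t = a ⊗ b with b of degree j, the factor x ⊗ 1 contributes j S(ax)b, which is congruent to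
-j x S(a)b, and 1 ⊗ x contributes (j + 1) S(a)bx. The j-fold parts form the commutator; the
remaining copy of S(a)bx is the last summand. -/
theorem dynkin_mul_primitive {n : ℕ} (t : tensorPow k I n) {x : A} (hx : x ∈ pow k I 1) :
    H.dynkin (n + 1) ⟨t.1 * (x ⊗ₜ 1 + 1 ⊗ₜ x), mul_mem_tensorPow k I t.2
        (primitive_mem_tensorPow_one ((mem_pow_one k I).1 hx))⟩ =
      Gr.mul k I rfl (H.dynkin n t) (Gr.mk k I 1 ⟨x, hx⟩) -
        Gr.mul k I (add_comm 1 n) (Gr.mk k I 1 ⟨x, hx⟩) (H.dynkin n t) +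
      Gr.mk k I (n + 1) ⟨LinearMap.mul' k A (H.anti.rTensor A t.1) * x,
        mul_mem_pow k I (H.mul_anti_mem t.2) hx⟩ := by
  let f : tensorPow k I n →ₗ[k] Gr k I (n + 1) := H.dynkin (n + 1) ∘ₗ
    LinearMap.restrict (LinearMap.mulRight k (x ⊗ₜ[k] (1 : A) + 1 ⊗ₜ x)) (fun t ht =>
      mul_mem_tensorPow k I ht (primitive_mem_tensorPow_one ((mem_pow_one k I).1 hx)))
  let g : tensorPow k I n →ₗ[k] Gr k I (n + 1) :=
    ((Gr.mul k I (rfl : n + 1 = n + 1)).flip (Gr.mk k I 1 ⟨x, hx⟩) -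
      Gr.mul k I (add_comm 1 n) (Gr.mk k I 1 ⟨x, hx⟩)) ∘ₗ H.dynkin n +
    Gr.mk k I (n + 1) ∘ₗ LinearMap.restrict
      (LinearMap.mulRight k x ∘ₗ LinearMap.mul' k A ∘ₗ H.anti.rTensor A)
      (fun t ht => mul_mem_pow k I (H.mul_anti_mem ht) hx)
  have hf : ∀ t, f t = H.dynkin (n + 1) ⟨t.1 * (x ⊗ₜ 1 + 1 ⊗ₜ x), mul_mem_tensorPow k I t.2
      (primitive_mem_tensorPow_one ((mem_pow_one k I).1 hx))⟩ := fun t => rfl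
  have hg : ∀ t, g t = Gr.mul k I rfl (H.dynkin n t) (Gr.mk k I 1 ⟨x, hx⟩) -
      Gr.mul k I (add_comm 1 n) (Gr.mk k I 1 ⟨x, hx⟩) (H.dynkin n t) +
      Gr.mk k I (n + 1) ⟨LinearMap.mul' k A (H.anti.rTensor A t.1) * x,
        mul_mem_pow k I (H.mul_anti_mem t.2) hx⟩ := fun t => rfl
  rw [← hf, ← hg]
  clear_value f g
  suffices f = g from DFunLike.congr_fun this t
  refine tensorPow_hom_ext k I fun i j h a b => ?_
  have hx' := H.anti_add_mem x ((mem_pow_one k I).1 hx)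
  have e1 : f ⟨a.1 ⊗ₜ b.1, tmul_mem_tensorPow k I h a.2 b.2⟩ =
      H.dynkin (n + 1) ⟨(a.1 * x) ⊗ₜ b.1, tmul_mem_tensorPow k I (i := i + 1) (by omega)
        (mul_mem_pow k I a.2 hx) b.2⟩ +
      H.dynkin (n + 1) ⟨a.1 ⊗ₜ (b.1 * x), tmul_mem_tensorPow k I (j := j + 1) (by omega)
        a.2 (mul_mem_pow k I b.2 hx)⟩ := by
    rw [hf, ← map_add (H.dynkin (n + 1))]
    refine congrArg (H.dynkin (n + 1)) (Subtype.ext ?_)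
    change (a.1 ⊗ₜ[k] b.1) * (x ⊗ₜ 1 + 1 ⊗ₜ x) = (a.1 * x) ⊗ₜ b.1 + a.1 ⊗ₜ (b.1 * x)
    rw [mul_add, Algebra.TensorProduct.tmul_mul_tmul, Algebra.TensorProduct.tmul_mul_tmul,
      mul_one, mul_one]
  rw [e1, H.dynkin_tmul (by omega) ⟨a.1 * x, mul_mem_pow k I a.2 hx⟩ b,
    H.dynkin_tmul (by omega) a ⟨b.1 * x, mul_mem_pow k I b.2 hx⟩]
  have e3 : Gr.mk k I (n + 1) ⟨LinearMap.mul' k A (H.anti.rTensor A (a.1 ⊗ₜ b.1)) * x,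
      mul_mem_pow k I (H.mul_anti_mem (tmul_mem_tensorPow k I h a.2 b.2)) hx⟩ =
      Gr.mk k I (n + 1) ⟨H.anti a.1 * b.1 * x, mul_mem_pow k I
        (h ▸ mul_mem_pow k I (H.anti_mem a.2) b.2) hx⟩ := rfl
  rw [hg, e3, H.dynkin_tmul h, map_smul, map_smul, LinearMap.smul_apply, Gr.mul_mk, Gr.mul_mk,
    ← map_smul, ← map_smul, ← map_smul, ← map_smul, ← map_add, ← map_sub, ← map_add]
  refine Gr.mk_eq_mk k I ?_
  change (j : k) • (H.anti (a.1 * x) * b.1) + ((j + 1 : ℕ) : k) • (H.anti a.1 * (b.1 * x)) -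
    ((j : k) • (H.anti a.1 * b.1 * x) - (j : k) • (x * (H.anti a.1 * b.1)) +
      H.anti a.1 * b.1 * x) ∈ pow k I (n + 1 + 1)
  -- The antipode is -1 on I/I^2, so the discrepancy contains the factor S(x) + x, which is in I^2.
  have e2 : (j : k) • (H.anti (a.1 * x) * b.1) +
      ((j + 1 : ℕ) : k) • (H.anti a.1 * (b.1 * x)) -
      ((j : k) • (H.anti a.1 * b.1 * x) - (j : k) • (x * (H.anti a.1 * b.1)) +
        H.anti a.1 * b.1 * x) = (j : k) • ((H.anti x + x) * (H.anti a.1 * b.1)) := by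
    rw [H.anti_mul]
    push_cast
    simp only [mul_assoc, add_mul, smul_add, add_smul, one_smul]
    abel
  rw [e2]
  refine Submodule.smul_mem _ _ ?_
  have := mul_mem_pow k I hx' (mul_mem_pow k I (H.anti_mem a.2) b.2)
  rwa [h, show 2 + n = n + 1 + 1 by omega] at this

/-- Δ(ax) is congruent to Δ(a)(x ⊗ 1 + 1 ⊗ x), and by the antipode axiom the extra summand is ε(a)x,
which vanishes in positive degree. This is the recursion D(ax) = [D(a), x]. -/
theorem dynkin_comul_mul {n : ℕ} (hn : 0 < n) {a x : A} (ha : a ∈ pow k I n)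
    (hx : x ∈ pow k I 1) :
    H.dynkin (n + 1) ⟨H.comul (a * x), H.comul_mem (mul_mem_pow k I ha hx)⟩ =
      Gr.mul k I rfl (H.dynkin n ⟨H.comul a, H.comul_mem ha⟩) (Gr.mk k I 1 ⟨x, hx⟩) -
        Gr.mul k I (add_comm 1 n) (Gr.mk k I 1 ⟨x, hx⟩)
          (H.dynkin n ⟨H.comul a, H.comul_mem ha⟩) := by
  have h := H.dynkin_mul_primitive ⟨H.comul a, H.comul_mem ha⟩ hx
  have e : Gr.mk k I (n + 1) ⟨LinearMap.mul' k A (H.anti.rTensor A (H.comul a)) * x,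
      mul_mem_pow k I (H.mul_anti_mem (H.comul_mem ha)) hx⟩ = 0 := by
    rw [Gr.mk_eq_zero_iff]
    dsimp only
    rw [H.anti_comul, H.counit_eq_zero hn ha, map_zero, zero_mul]
    exact zero_mem _
  rw [e, add_zero] at h
  rw [← h, ← sub_eq_zero, ← map_sub]
  refine H.dynkin_eq_zero _ ?_
  change H.comul (a * x) - H.comul a * (x ⊗ₜ 1 + 1 ⊗ₜ x) ∈ tensorPow k I (n + 2)
  rw [map_mul, ← mul_sub]
  exact mul_mem_tensorPow k I (H.comul_mem ha) (H.comul_sub_mem x ((mem_pow_one k I).1 hx))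

/-- Start of the recursion: the weight j is 0 on x ⊗ 1 and 1 on 1 ⊗ x. -/
theorem dynkin_comul_one {x : A} (hx : x ∈ pow k I 1) :
    H.dynkin 1 ⟨H.comul x, H.comul_mem hx⟩ = Gr.mk k I 1 ⟨x, hx⟩ := by
  have hx0 := (mem_pow_one k I).1 hx
  have h1 := one_mem_pow_zero k I
  have e : H.dynkin 1 ⟨H.comul x, H.comul_mem hx⟩ =
      H.dynkin 1 ⟨x ⊗ₜ 1, tmul_mem_tensorPow k I (i := 1) (j := 0) rfl hx h1⟩ +
      H.dynkin 1 ⟨1 ⊗ₜ x, tmul_mem_tensorPow k I (i := 0) (j := 1) rfl h1 hx⟩ := by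
    rw [← map_add, ← sub_eq_zero, ← map_sub]
    exact H.dynkin_eq_zero _ (H.comul_sub_mem x hx0)
  rw [e, H.dynkin_tmul (i := 1) (j := 0) rfl ⟨x, hx⟩ ⟨1, h1⟩,
    H.dynkin_tmul (i := 0) (j := 1) rfl ⟨1, h1⟩ ⟨x, hx⟩, Nat.cast_zero, zero_smul, zero_add,
    Nat.cast_one, one_smul]
  exact congrArg (Gr.mk k I 1) (Subtype.ext (by
    change H.anti 1 * x = x
    rw [H.anti_one, one_mul]))

/-- In degree zero every element is a scalar modulo I, so there the antipode acts as the counit. The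
component of bidegree (0, n) is therefore governed by the counit axiom. -/
theorem mul_grAnti_zero {n : ℕ} (hn : 0 < n) {a : A} (ha : a ∈ pow k I n) :
    TensorProduct.lift (Gr.mul k I (zero_add n)) (TensorProduct.map (H.grAnti 0) LinearMap.id
      (grTensorProj k I (zero_add n) ⟨H.comul a, H.comul_mem ha⟩)) = Gr.mk k I n ⟨a, ha⟩ := by
  -- The map ε ⊗ id, with which the left-hand side is compared on pure tensors.
  let c : A ⊗[k] A →ₗ[k] A := (Algebra.TensorProduct.lid k A).toLinearMap ∘ₗ
    (Algebra.TensorProduct.map H.counit (AlgHom.id k A)).toLinearMap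
  have hct (a b : A) : c (a ⊗ₜ b) = H.counit a • b := by
    simp [c]
  have hc : ∀ t ∈ tensorPow k I n, c t ∈ pow k I n := by
    intro t ht
    induction ht using Submodule.span_induction with
    | mem t ht =>
      obtain ⟨i, j, h, a, ha, b, hb, rfl⟩ := ht
      rw [hct]
      rcases Nat.eq_zero_or_pos i with rfl | hi
      · obtain rfl : j = n := by omega
        exact Submodule.smul_mem _ _ hb
      · rw [H.counit_eq_zero hi ha, zero_smul]; exact zero_mem _
    | zero => rw [map_zero]; exact zero_mem _
    | add s t _ _ hs ht => rw [map_add]; exact add_mem hs ht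
    | smul r t _ ht => rw [map_smul]; exact Submodule.smul_mem _ r ht
  have key : TensorProduct.lift (Gr.mul k I (zero_add n)) ∘ₗ
      TensorProduct.map (H.grAnti 0) LinearMap.id ∘ₗ grTensorProj k I (zero_add n) =
      Gr.mk k I n ∘ₗ LinearMap.restrict c hc := by
    refine tensorPow_hom_ext k I fun i j h a b => ?_
    rcases Nat.eq_zero_or_pos i with rfl | hi
    · obtain rfl : j = n := by omega
      rw [LinearMap.comp_apply, LinearMap.comp_apply, grTensorProj_tmul, TensorProduct.map_tmul,
        TensorProduct.lift.tmul]
      change Gr.mk k I j ⟨H.anti a.1 * b.1, _⟩ = Gr.mk k I j ⟨c (a.1 ⊗ₜ b.1), _⟩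
      refine Gr.mk_eq_mk k I ?_
      rw [hct]
      have h1 := H.sub_counit_mem a.1
      have h2 : H.anti a.1 - algebraMap k A (H.counit a.1) ∈ pow k I 1 := by
        have := H.anti_mem ((mem_pow_one k I).2 h1)
        rwa [map_sub, Algebra.algebraMap_eq_smul_one, map_smul, H.anti_one,
          ← Algebra.algebraMap_eq_smul_one] at this
      have h3 := mul_mem_pow k I h2 b.2
      rwa [sub_mul, ← Algebra.smul_def, add_comm 1 j] at h3
    · rw [LinearMap.comp_apply, LinearMap.comp_apply,
        grTensorProj_tmul_of_ne k I _ h (by omega), map_zero, map_zero]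
      refine Eq.symm ((Gr.mk_eq_zero_iff k I).2 ?_)
      change c (a.1 ⊗ₜ b.1) ∈ _
      rw [hct, H.counit_eq_zero hi a.2, zero_smul]
      exact zero_mem _
  refine (DFunLike.congr_fun key ⟨H.comul a, H.comul_mem ha⟩).trans ?_
  exact congrArg (Gr.mk k I n) (Subtype.ext (H.counit_comul a))

/-- A primitive class of degree `n` in the associated graded algebra is a Lie polynomial in classes
of degree one: it belongs to every graded subspace which contains these and is closed under brackets
with them. -/
theorem mk_mem_of_primitive [CharZero k] (P : ∀ n, Submodule k (Gr k I n))
    (h1 : ∀ x (hx : x ∈ pow k I 1), Gr.mk k I 1 ⟨x, hx⟩ ∈ P 1)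
    (hP : ∀ n, 0 < n → ∀ z ∈ P n, ∀ x (hx : x ∈ pow k I 1),
      Gr.mul k I rfl z (Gr.mk k I 1 ⟨x, hx⟩) -
        Gr.mul k I (add_comm 1 n) (Gr.mk k I 1 ⟨x, hx⟩) z ∈ P (n + 1))
    {n : ℕ} (hn : 0 < n) {a : A} (ha : a ∈ pow k I n)
    (hprim : ∀ i j (h : i + j = n), 0 < i → 0 < j →
      grTensorProj k I h ⟨H.comul a, H.comul_mem ha⟩ = 0) :
    Gr.mk k I n ⟨a, ha⟩ ∈ P n := by
  -- Without any primitivity, the Dynkin image of an element is a sum of left normed brackets of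
  -- elements of I.
  have key : ∀ (n : ℕ) (a : A) (_ : a ∈ pow k I n), 0 < n →
      ∀ ha : a ∈ pow k I n, H.dynkin n ⟨H.comul a, H.comul_mem ha⟩ ∈ P n := by
    intro n a ha
    refine pow_induction k I (P := fun n a => 0 < n → ∀ ha : a ∈ pow k I n,
      H.dynkin n ⟨H.comul a, H.comul_mem ha⟩ ∈ P n) ?_ ?_ ?_ ha
    · intro a h; exact absurd h (lt_irrefl 0)
    · intro n a ha' b hb' iha ihb hn ha
      have e : (⟨H.comul (a + b), H.comul_mem ha⟩ : tensorPow k I n) =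
          ⟨H.comul a, H.comul_mem ha'⟩ + ⟨H.comul b, H.comul_mem hb'⟩ :=
        Subtype.ext (map_add H.comul a b)
      rw [e, map_add]
      exact add_mem (iha hn ha') (ihb hn hb')
    · intro n a ha x hx ih _ hax
      have hx' := (mem_pow_one k I).2 hx
      rcases Nat.eq_zero_or_pos n with rfl | hn
      · rw [H.dynkin_comul_one hax]
        exact h1 _ hax
      · rw [H.dynkin_comul_mul hn ha hx']
        exact hP n hn _ (ih hn ha) x hx'
  -- Primitivity leaves the bidegrees (0, n) and (n, 0), and the second has weight j = 0.
  have e : H.dynkin n ⟨H.comul a, H.comul_mem ha⟩ = (n : k) • Gr.mk k I n ⟨a, ha⟩ := by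
    rw [dynkin, LinearMap.sum_apply, Finset.sum_eq_single
      ⟨(0, n), Finset.HasAntidiagonal.mem_antidiagonal.2 (zero_add n)⟩]
    · rw [LinearMap.smul_apply]
      exact congrArg ((n : k) • ·) (H.mul_grAnti_zero hn ha)
    · intro p _ hp
      have hp' := Finset.HasAntidiagonal.mem_antidiagonal.1 p.2
      rcases Nat.eq_zero_or_pos p.1.2 with h0 | h0
      · have h00 : (p.1.2 : k) = 0 := by rw [h0, Nat.cast_zero]
        rw [LinearMap.smul_apply, h00, zero_smul]
      · rcases Nat.eq_zero_or_pos p.1.1 with h2 | h2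
        · exact absurd (Subtype.ext (Prod.ext h2 (by dsimp only; omega))) hp
        · rw [LinearMap.smul_apply, LinearMap.comp_apply, LinearMap.comp_apply,
            hprim _ _ hp' h2 h0, map_zero, map_zero, smul_zero]
    · intro h'; exact absurd (Finset.mem_univ _) h'
  have h := Submodule.smul_mem _ ((n : k)⁻¹) (key n a ha hn ha)
  rwa [e, smul_smul, inv_mul_cancel₀ (Nat.cast_ne_zero.2 hn.ne'), one_smul] at h

end HopfData

/-! ### The group algebra as a filtered Hopf algebra. -/

section GroupAlgebraHopf

variable (k G : Type*) [Field k] [Group G]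

theorem comul_of (g : G) : Bialgebra.comulAlgHom k (MonoidAlgebra k G) (MonoidAlgebra.of k G g) =
    MonoidAlgebra.of k G g ⊗ₜ MonoidAlgebra.of k G g := by
  simp

/-- The augmentation ideal is spanned by the elements `g - 1`. -/
theorem augIdeal_eq_span {a : MonoidAlgebra k G} (ha : a ∈ augIdeal k G) :
    a ∈ Submodule.span k (Set.range fun g : G => MonoidAlgebra.of k G g - 1) := by
  have key : ∀ a : MonoidAlgebra k G,
      a - algebraMap k _ (Bialgebra.counitAlgHom k (MonoidAlgebra k G) a) ∈
      Submodule.span k (Set.range fun g : G => MonoidAlgebra.of k G g - 1) := by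
    intro a
    induction a using MonoidAlgebra.induction_on with
    | of g =>
      refine Submodule.subset_span ⟨g, ?_⟩
      simp [MonoidAlgebra.one_def]
    | add a b ha hb =>
      rw [map_add, map_add, add_sub_add_comm]
      exact add_mem ha hb
    | smul r a ha =>
      rw [map_smul, Algebra.algebraMap_eq_smul_one, smul_assoc, ← smul_sub,
        ← Algebra.algebraMap_eq_smul_one]
      exact Submodule.smul_mem _ r ha
  have h := key a
  rwa [show Bialgebra.counitAlgHom k (MonoidAlgebra k G) a = 0 from ha, map_zero, sub_zero] at h

/-- The defect from primitivity is (g - 1) ⊗ (g - 1), of twice the degree of g - 1. Hence the class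
of g - 1 is primitive in each positive degree n with g - 1 in I^n. -/
theorem comul_of_sub_one (g : G) :
    Bialgebra.comulAlgHom k (MonoidAlgebra k G) (MonoidAlgebra.of k G g - 1) =
      ((MonoidAlgebra.of k G g - 1) ⊗ₜ 1 + 1 ⊗ₜ (MonoidAlgebra.of k G g - 1)) +
        (MonoidAlgebra.of k G g - 1) ⊗ₜ (MonoidAlgebra.of k G g - 1) := by
  rw [map_sub, map_one, comul_of, Algebra.TensorProduct.one_def]
  simp only [TensorProduct.sub_tmul, TensorProduct.tmul_sub]
  abel

/-- The Hopf algebra structure of the group algebra. -/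
def groupHopf : HopfData k (augIdeal k G) where
  comul := Bialgebra.comulAlgHom k (MonoidAlgebra k G)
  counit := Bialgebra.counitAlgHom k (MonoidAlgebra k G)
  anti := HopfAlgebra.antipode k
  mem_iff _ := Iff.rfl
  comul_sub_mem a ha := by
    let f : MonoidAlgebra k G →ₗ[k] MonoidAlgebra k G ⊗[k] MonoidAlgebra k G :=
      (Bialgebra.comulAlgHom k (MonoidAlgebra k G)).toLinearMap -
        (Algebra.TensorProduct.includeLeft.toLinearMap (R := k) +
          Algebra.TensorProduct.includeRight.toLinearMap)
    have h : Submodule.span k (Set.range fun g : G => MonoidAlgebra.of k G g - 1) ≤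
        (tensorPow k (augIdeal k G) 2).comap f := by
      refine Submodule.span_le.2 ?_
      rintro _ ⟨g, rfl⟩
      change Bialgebra.comulAlgHom k (MonoidAlgebra k G) (MonoidAlgebra.of k G g - 1) -
        ((MonoidAlgebra.of k G g - 1) ⊗ₜ 1 + 1 ⊗ₜ (MonoidAlgebra.of k G g - 1)) ∈
          tensorPow k (augIdeal k G) 2
      rw [comul_of_sub_one, add_sub_cancel_left]
      have := (mem_pow_one k _).2 (of_sub_one_mem k g)
      exact tmul_mem_tensorPow k _ (i := 1) (j := 1) rfl this this
    exact h (augIdeal_eq_span k G ha)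
  counit_comul a := by
    have h := Coalgebra.rTensor_counit_comul (R := k) a
    have e : ∀ t : MonoidAlgebra k G ⊗[k] MonoidAlgebra k G,
        Algebra.TensorProduct.map (Bialgebra.counitAlgHom k (MonoidAlgebra k G))
          (AlgHom.id k (MonoidAlgebra k G)) t = Coalgebra.counit.rTensor _ t := fun t => rfl
    rw [e]
    exact (congrArg _ h).trans (by simp)
  anti_one := HopfAlgebra.antipode_one
  anti_mul a b := HopfAlgebra.antipode_mul_antidistrib a b
  anti_add_mem a ha := by
    have h := augIdeal_eq_span k G ha
    clear ha
    induction h using Submodule.span_induction with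
    | mem a h =>
      obtain ⟨g, rfl⟩ := h
      dsimp only
      have e : HopfAlgebra.antipode k (MonoidAlgebra.of k G g - 1) +
          (MonoidAlgebra.of k G g - 1) =
          -((MonoidAlgebra.of k G g - 1) * (MonoidAlgebra.of k G g⁻¹ - 1)) := by
        have h1 : HopfAlgebra.antipode k (MonoidAlgebra.of k G g) = MonoidAlgebra.of k G g⁻¹ := by
          simp
        rw [map_sub, HopfAlgebra.antipode_one, h1, sub_mul, mul_sub, of_mul_of_inv]
        noncomm_ring
      rw [e]
      exact neg_mem (mul_mem_pow k _ (m := 1) (n := 1) ((mem_pow_one k _).2 (of_sub_one_mem k g))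
        ((mem_pow_one k _).2 (of_sub_one_mem k g⁻¹)))
    | zero => rw [map_zero, zero_add]; exact zero_mem _
    | add a b _ _ ha hb => rw [map_add, add_add_add_comm]; exact add_mem ha hb
    | smul c a _ ha => rw [map_smul, ← smul_add]; exact Submodule.smul_mem _ c ha
  anti_comul a := HopfAlgebra.mul_antipode_rTensor_comul_apply a

end GroupAlgebraHopf

/-! ### The enveloping algebra as a filtered Hopf algebra. -/

section EnvelopingHopf

open UniversalEnvelopingAlgebra

variable (k L : Type*) [Field k] [LieRing L] [LieAlgebra k L]

/-- The universal property gives a map to the subalgebra generated by L. Followed by the inclusion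
it is the identity on L, hence the identity. -/
theorem env_adjoin : Algebra.adjoin k (Set.range (ι k : L → UniversalEnvelopingAlgebra k L)) = ⊤ := by
  let S := Algebra.adjoin k (Set.range (ι k : L → UniversalEnvelopingAlgebra k L))
  let j : L →ₗ⁅k⁆ S :=
    { toFun := fun x => ⟨ι k x, Algebra.subset_adjoin ⟨x, rfl⟩⟩
      map_add' := fun x y => Subtype.ext (map_add (ι k) x y)
      map_smul' := fun c x => Subtype.ext (map_smul (ι k) c x)
      map_lie' := fun {x y} => Subtype.ext (LieHom.map_lie (ι k) x y) }
  have h : S.val.comp (lift k j) = AlgHom.id k _ := by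
    refine hom_ext _ (LieHom.ext fun x => ?_)
    change S.val (lift k j (ι k x)) = ι k x
    rw [lift_ι_apply]; rfl
  refine eq_top_iff.2 fun u _ => ?_
  rw [← show S.val (lift k j u) = u from DFunLike.congr_fun h u]
  exact (lift k j u).2

variable {k L} in
/-- Induction on the number of factors in the enveloping algebra. -/
theorem env_induction (W : Submodule k (UniversalEnvelopingAlgebra k L)) (h1 : 1 ∈ W)
    (hW : ∀ w ∈ W, ∀ x : L, w * ι k x ∈ W) (u : UniversalEnvelopingAlgebra k L) : u ∈ W := by
  have hu : u ∈ Algebra.adjoin k (Set.range (ι k : L → UniversalEnvelopingAlgebra k L)) := by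
    rw [env_adjoin]; trivial
  -- Stability of W under right multiplication by u is a property of u that passes to products.
  suffices ∀ w ∈ W, w * u ∈ W by simpa using this 1 h1
  induction hu using Algebra.adjoin_induction with
  | mem u h => obtain ⟨x, rfl⟩ := h; exact fun w hw => hW w hw x
  | algebraMap r =>
    intro w hw
    rw [← Algebra.commutes, ← Algebra.smul_def]
    exact Submodule.smul_mem _ r hw
  | add u v _ _ hu hv => intro w hw; rw [mul_add]; exact add_mem (hu w hw) (hv w hw)
  | mul u v _ _ hu hv => intro w hw; rw [← mul_assoc]; exact hv _ (hu w hw)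

/-- The comultiplication of the enveloping algebra. -/
def envComul : UniversalEnvelopingAlgebra k L →ₐ[k]
    UniversalEnvelopingAlgebra k L ⊗[k] UniversalEnvelopingAlgebra k L :=
  lift k
    { toFun := fun x => ι k x ⊗ₜ 1 + 1 ⊗ₜ ι k x
      map_add' := fun x y => by
        rw [map_add, TensorProduct.add_tmul, TensorProduct.tmul_add]; abel
      map_smul' := fun c x => by
        rw [map_smul, TensorProduct.tmul_smul, ← TensorProduct.smul_tmul', ← smul_add]; rfl
      map_lie' := fun {x y} => by
        simp only [LieHom.map_lie, LieRing.of_associative_ring_bracket, add_mul, mul_add,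
          Algebra.TensorProduct.tmul_mul_tmul, one_mul, mul_one, TensorProduct.sub_tmul,
          TensorProduct.tmul_sub]
        abel }

theorem envComul_ι (x : L) : envComul k L (ι k x) = ι k x ⊗ₜ 1 + 1 ⊗ₜ ι k x :=
  lift_ι_apply k _ x

theorem env_counit_comul (u : UniversalEnvelopingAlgebra k L) :
    Algebra.TensorProduct.lid k (UniversalEnvelopingAlgebra k L)
      (Algebra.TensorProduct.map (lift k (0 : L →ₗ⁅k⁆ k)) (AlgHom.id k _)
        (envComul k L u)) = u := by
  let f : UniversalEnvelopingAlgebra k L →ₗ[k] UniversalEnvelopingAlgebra k L :=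
    (Algebra.TensorProduct.lid k (UniversalEnvelopingAlgebra k L)).toLinearMap ∘ₗ
      (Algebra.TensorProduct.map (lift k (0 : L →ₗ⁅k⁆ k)) (AlgHom.id k _)).toLinearMap ∘ₗ
        (envComul k L).toLinearMap
  have hf : ∀ u, f u = Algebra.TensorProduct.lid k (UniversalEnvelopingAlgebra k L)
      (Algebra.TensorProduct.map (lift k (0 : L →ₗ⁅k⁆ k)) (AlgHom.id k _)
        (envComul k L u)) := fun _ => rfl
  rw [← hf]
  refine env_induction (LinearMap.eqLocus f LinearMap.id) ?_ ?_ u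
  · rw [LinearMap.mem_eqLocus, hf, map_one, map_one, map_one, LinearMap.id_apply]
  · intro u hu x
    rw [LinearMap.mem_eqLocus, hf, LinearMap.id_apply] at hu ⊢
    rw [map_mul, map_mul, map_mul, hu, envComul_ι, map_add, Algebra.TensorProduct.map_tmul,
      Algebra.TensorProduct.map_tmul, lift_ι_apply, map_add, map_one,
      Algebra.TensorProduct.lid_tmul, Algebra.TensorProduct.lid_tmul, LieHom.zero_apply, zero_smul,
      zero_add, map_one, one_smul, AlgHom.id_apply]

/-- The antipode of the enveloping algebra, as a map to the opposite algebra. -/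
def envAntiHom : UniversalEnvelopingAlgebra k L →ₐ[k] (UniversalEnvelopingAlgebra k L)ᵐᵒᵖ :=
  lift k
    { toFun := fun x => MulOpposite.op (-ι k x)
      map_add' := fun x y => by
        rw [map_add, neg_add, MulOpposite.op_add]
      map_smul' := fun c x => by
        rw [map_smul, ← smul_neg, MulOpposite.op_smul]; rfl
      map_lie' := fun {x y} => by
        simp only [LieHom.map_lie, LieRing.of_associative_ring_bracket, ← MulOpposite.op_mul,
          ← MulOpposite.op_sub, neg_mul_neg, neg_sub] }

/-- The antipode of the enveloping algebra. -/
def envAnti : UniversalEnvelopingAlgebra k L →ₗ[k] UniversalEnvelopingAlgebra k L :=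
  (MulOpposite.opLinearEquiv k).symm.toLinearMap ∘ₗ (envAntiHom k L).toLinearMap

theorem envAnti_mul (u v : UniversalEnvelopingAlgebra k L) :
    envAnti k L (u * v) = envAnti k L v * envAnti k L u :=
  (congrArg MulOpposite.unop (map_mul (envAntiHom k L) u v))

theorem envAnti_one : envAnti k L 1 = 1 :=
  congrArg MulOpposite.unop (map_one (envAntiHom k L))

theorem envAnti_ι (x : L) : envAnti k L (ι k x) = -ι k x :=
  congrArg MulOpposite.unop (lift_ι_apply k _ x)

theorem counit_envAnti (u : UniversalEnvelopingAlgebra k L) :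
    lift k (0 : L →ₗ⁅k⁆ k) (envAnti k L u) = lift k (0 : L →ₗ⁅k⁆ k) u := by
  refine env_induction (LinearMap.eqLocus ((lift k (0 : L →ₗ⁅k⁆ k)).toLinearMap ∘ₗ envAnti k L)
    (lift k (0 : L →ₗ⁅k⁆ k)).toLinearMap) ?_ ?_ u
  · change lift k (0 : L →ₗ⁅k⁆ k) (envAnti k L 1) = lift k (0 : L →ₗ⁅k⁆ k) 1
    rw [envAnti_one]
  · intro u _ x
    change lift k (0 : L →ₗ⁅k⁆ k) (envAnti k L (u * ι k x)) =
      lift k (0 : L →ₗ⁅k⁆ k) (u * ι k x)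
    rw [envAnti_mul, envAnti_ι, map_mul, map_mul, map_neg, lift_ι_apply, LieHom.zero_apply,
      neg_zero, zero_mul, mul_zero]

/-- The augmentation ideal of the enveloping algebra is spanned by `L` and its own square. -/
theorem envAug_sub_mem {u : UniversalEnvelopingAlgebra k L} (hu : u ∈ envAug k L) :
    ∃ x : L, u - ι k x ∈ pow k (envAug k L) 2 := by
  -- The subspace k + L + I^2 is everything by `env_induction`. The counit kills L and I^2, so for u
  -- in I the scalar part is zero.
  let W : Submodule k (UniversalEnvelopingAlgebra k L) :=
    Submodule.span k {1} ⊔ LinearMap.range (ι k : L →ₗ⁅k⁆ _).toLinearMap ⊔ pow k (envAug k L) 2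
  have hW : u ∈ W := by
    refine env_induction W ?_ ?_ u
    · exact Submodule.mem_sup_left (Submodule.mem_sup_left (Submodule.mem_span_singleton_self 1))
    · intro w hw x
      have hx : ι k x ∈ pow k (envAug k L) 1 := (mem_pow_one k _).2 (ι_mem_envAug k x)
      obtain ⟨w1, hw1, v, hv, rfl⟩ := Submodule.mem_sup.1 hw
      obtain ⟨c, hc, y, ⟨y, rfl⟩, rfl⟩ := Submodule.mem_sup.1 hw1
      obtain ⟨c, rfl⟩ := Submodule.mem_span_singleton.1 hc
      rw [add_mul, add_mul, smul_mul_assoc, one_mul]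
      refine add_mem (add_mem ?_ ?_) ?_
      · exact Submodule.smul_mem _ c (Submodule.mem_sup_left (Submodule.mem_sup_right ⟨x, rfl⟩))
      · exact Submodule.mem_sup_right (mul_mem_pow k _ (m := 1) (n := 1)
          ((mem_pow_one k _).2 (ι_mem_envAug k y)) hx)
      · exact Submodule.mem_sup_right (Ideal.mul_mem_right _ _ hv)
  obtain ⟨w1, hw1, v, hv, rfl⟩ := Submodule.mem_sup.1 hW
  obtain ⟨c, hc, y, ⟨y, rfl⟩, rfl⟩ := Submodule.mem_sup.1 hw1
  obtain ⟨c, rfl⟩ := Submodule.mem_span_singleton.1 hc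
  refine ⟨y, ?_⟩
  have h : UniversalEnvelopingAlgebra.lift k (0 : L →ₗ⁅k⁆ k)
    (c • 1 + (ι k : L →ₗ⁅k⁆ _).toLinearMap y + v) = 0 := hu
  have h1 : UniversalEnvelopingAlgebra.lift k (0 : L →ₗ⁅k⁆ k) v = 0 :=
    (mem_pow_one k _).1 (pow_antitone k (envAug k L) one_le_two hv)
  have h2 : UniversalEnvelopingAlgebra.lift k (0 : L →ₗ⁅k⁆ k)
    ((ι k : L →ₗ⁅k⁆ _).toLinearMap y) = 0 := ι_mem_envAug k y
  rw [map_add, map_add, h1, h2, map_smul, map_one, add_zero, add_zero, smul_eq_mul, mul_one] at h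
  rw [h, zero_smul, zero_add]
  convert hv using 1
  exact add_sub_cancel_left _ _

/-- The Hopf algebra structure of the enveloping algebra. -/
def envHopf : HopfData k (envAug k L) where
  comul := envComul k L
  counit := lift k (0 : L →ₗ⁅k⁆ k)
  anti := envAnti k L
  mem_iff _ := Iff.rfl
  comul_sub_mem u hu := by
    obtain ⟨x, hx⟩ := envAug_sub_mem k L hu
    have h2 : ∀ v ∈ pow k (envAug k L) 2, envComul k L v ∈ tensorPow k (envAug k L) 2 := by
      intro v hv
      refine env_pow_mem k (tensorPow k (envAug k L)) (mem_tensorPow_zero k _)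
        (mul_mem_tensorPow k _) (envComul k L) (fun x => ?_) 2 hv
      rw [envComul_ι]
      exact HopfData.primitive_mem_tensorPow_one (ι_mem_envAug k x)
    obtain ⟨v, rfl⟩ : ∃ v, u = ι k x + v := ⟨u - ι k x, by abel⟩
    rw [add_sub_cancel_left] at hx
    have h3 : v ⊗ₜ[k] 1 + 1 ⊗ₜ v ∈ tensorPow k (envAug k L) 2 :=
      add_mem (tmul_mem_tensorPow k _ (i := 2) (j := 0) rfl hx (one_mem_pow_zero k _))
        (tmul_mem_tensorPow k _ (i := 0) (j := 2) rfl (one_mem_pow_zero k _) hx)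
    rw [map_add, envComul_ι, TensorProduct.add_tmul, TensorProduct.tmul_add]
    convert sub_mem (h2 v hx) h3 using 1
    abel
  counit_comul := env_counit_comul k L
  anti_one := envAnti_one k L
  anti_mul := envAnti_mul k L
  anti_add_mem u hu := by
    obtain ⟨x, hx⟩ := envAug_sub_mem k L hu
    have h2 : ∀ v ∈ pow k (envAug k L) 2, envAnti k L v ∈ pow k (envAug k L) 2 := by
      intro v hv
      rw [mem_pow, Submodule.pow_succ, Submodule.pow_one] at hv
      have h1 : ∀ v ∈ envAug k L, envAnti k L v ∈ pow k (envAug k L) 1 := by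
        intro v hv
        refine (mem_pow_one k _).2 ?_
        change lift k (0 : L →ₗ⁅k⁆ k) (envAnti k L v) = 0
        rw [counit_envAnti]
        exact hv
      induction hv using Submodule.mul_induction_on' with
      | mem_mul_mem a ha b hb =>
        rw [envAnti_mul]; exact mul_mem_pow k _ (m := 1) (n := 1) (h1 b hb) (h1 a ha)
      | add a _ b _ ha hb => rw [map_add]; exact add_mem ha hb
    obtain ⟨v, rfl⟩ : ∃ v, u = ι k x + v := ⟨u - ι k x, by abel⟩
    rw [add_sub_cancel_left] at hx
    rw [map_add, envAnti_ι]
    convert add_mem (h2 v hx) hx using 1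
    abel
  anti_comul u := by
    let f : UniversalEnvelopingAlgebra k L →ₗ[k] UniversalEnvelopingAlgebra k L :=
      LinearMap.mul' k _ ∘ₗ (envAnti k L).rTensor _ ∘ₗ (envComul k L).toLinearMap
    let g : UniversalEnvelopingAlgebra k L →ₗ[k] UniversalEnvelopingAlgebra k L :=
      Algebra.linearMap k _ ∘ₗ (lift k (0 : L →ₗ⁅k⁆ k)).toLinearMap
    have hf : ∀ u, f u = LinearMap.mul' k _ ((envAnti k L).rTensor _ (envComul k L u)) :=
      fun _ => rfl
    have hg : ∀ u, g u = algebraMap k _ (lift k (0 : L →ₗ⁅k⁆ k) u) := fun _ => rfl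
    refine env_induction (LinearMap.eqLocus f g) ?_ ?_ u
    · change f 1 = g 1
      rw [hf, hg, map_one (envComul k L), map_one (lift k (0 : L →ₗ⁅k⁆ k)),
        map_one (algebraMap k _), Algebra.TensorProduct.one_def,
        LinearMap.rTensor_tmul, envAnti_one, LinearMap.mul'_apply, one_mul]
    · intro u hu x
      have hu' : f u = g u := hu
      change f (u * ι k x) = g (u * ι k x)
      rw [hf, hg] at hu'
      rw [hf, hg, map_mul (envComul k L), map_mul (lift k (0 : L →ₗ⁅k⁆ k)), lift_ι_apply, LieHom.zero_apply, mul_zero, map_zero,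
        envComul_ι]
      -- Multiplying t by Δ(x) turns its image under S ⊗ id and multiplication into a commutator
      -- with x. For t = Δ(u) that image is a scalar by induction, so the commutator vanishes.
      have h : ∀ t : UniversalEnvelopingAlgebra k L ⊗[k] UniversalEnvelopingAlgebra k L,
          LinearMap.mul' k _ ((envAnti k L).rTensor _ (t * (ι k x ⊗ₜ 1 + 1 ⊗ₜ ι k x))) =
          LinearMap.mul' k _ ((envAnti k L).rTensor _ t) * ι k x -
            ι k x * LinearMap.mul' k _ ((envAnti k L).rTensor _ t) := by
        intro t
        induction t using TensorProduct.induction_on with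
        | zero => simp only [zero_mul, map_zero, mul_zero, sub_zero]
        | tmul a b =>
          rw [mul_add, Algebra.TensorProduct.tmul_mul_tmul, Algebra.TensorProduct.tmul_mul_tmul,
            mul_one, mul_one, map_add, map_add, LinearMap.rTensor_tmul, LinearMap.rTensor_tmul,
            LinearMap.rTensor_tmul, LinearMap.mul'_apply, LinearMap.mul'_apply,
            LinearMap.mul'_apply, envAnti_mul, envAnti_ι]
          noncomm_ring
        | add s t hs ht =>
          rw [add_mul, map_add, map_add, hs, ht, map_add, map_add, add_mul, mul_add]
          abel
      rw [h, hu', Algebra.commutes, sub_self]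

end EnvelopingHopf

/-! ### Complete filtrations and successive approximation. -/

section CompleteFiltrations

variable {k : Type*} [Field k] {X Y : Type*} [AddCommGroup X] [Module k X] [AddCommGroup Y]
  [Module k Y]

/-- A filtration by subspaces is complete if every series whose `i`-th term is in the `i`-th
subspace converges. -/
def SeriesConverge (F : ℕ → Submodule k X) : Prop :=
  ∀ x : ℕ → X, (∀ i, x i ∈ F i) → ∃ y, ∀ N, y - ∑ i ∈ Finset.range N, x i ∈ F N

theorem SeriesConverge.shift {F : ℕ → Submodule k X} (hF : SeriesConverge F) (n : ℕ) :
    SeriesConverge fun i => F (n + i) := by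
  intro x hx
  -- The series is preceded by n zeros in order to fit the unshifted filtration.
  obtain ⟨y, hy⟩ := hF (fun i => if n ≤ i then x (i - n) else 0) (fun i => by
    split_ifs with h
    · have : x (i - n) ∈ F (n + (i - n)) := hx (i - n)
      rwa [Nat.add_sub_cancel' h] at this
    · exact zero_mem _)
  refine ⟨y, fun N => ?_⟩
  have h := hy (n + N)
  rwa [Finset.sum_range_add, Finset.sum_eq_zero (fun i hi => if_neg (by
      have := Finset.mem_range.1 hi
      omega)), zero_add, Finset.sum_congr rfl fun i _ => by
      rw [if_pos (Nat.le_add_right n i), Nat.add_sub_cancel_left]] at h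

theorem SeriesConverge.pi {ι : Type*} {F : ℕ → Submodule k X} (hF : SeriesConverge F) :
    SeriesConverge (X := ι → X) fun n => Submodule.pi Set.univ fun _ => F n := by
  intro x hx
  choose y hy using fun j => hF (fun i => x i j) (fun i => hx i j trivial)
  refine ⟨y, fun N j _ => ?_⟩
  rw [Pi.sub_apply, Finset.sum_apply]
  exact hy j N

/-- A filtered linear map from a complete to a separated space which is surjective on associated
graded spaces is surjective, also on the terms of the filtrations. -/
theorem exists_preimage_of_gr_surjective {F : ℕ → Submodule k X} {G : ℕ → Submodule k Y}
    (hF : SeriesConverge F) (hG : ∀ y, (∀ n, y ∈ G n) → y = 0) (f : X →ₗ[k] Y)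
    (hf : ∀ n, ∀ x ∈ F n, f x ∈ G n) (hs : ∀ n, ∀ y ∈ G n, ∃ x ∈ F n, y - f x ∈ G (n + 1))
    (hanti : Antitone G) {n : ℕ} {y : Y} (hy : y ∈ G n) : ∃ x ∈ F n, f x = y := by
  choose! g hgF hgG using hs
  -- The error left after i corrections; it lies in G (n + i).
  let z : ℕ → Y := fun i => Nat.rec y (fun i w => w - f (g (n + i) w)) i
  have hz : ∀ i, z i ∈ G (n + i) := fun i => by
    induction i with
    | zero => exact hy
    | succ i ih => exact hgG _ _ ih
  obtain ⟨x, hx⟩ := hF.shift n (fun i => g (n + i) (z i)) fun i => hgF _ _ (hz i)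
  have hsum : ∀ N, y - f (∑ i ∈ Finset.range N, g (n + i) (z i)) = z N := fun N => by
    induction N with
    | zero => rw [Finset.sum_range_zero, map_zero, sub_zero]; rfl
    | succ N ih =>
      rw [Finset.sum_range_succ, map_add, ← sub_sub, ih]
  refine ⟨x, by simpa using hx 0, sub_eq_zero.1 (hG _ fun m => ?_)⟩
  have key : ∀ N, f x - y ∈ G (n + N) := fun N => by
    have h1 := hf _ _ (hx N)
    rw [map_sub] at h1
    have h2 := hz N
    rw [← hsum N] at h2
    have := sub_mem h1 h2
    rwa [sub_sub_sub_cancel_right] at this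
  exact hanti (Nat.le_add_left m n) (key m)

/-- In degree n only the first n + 1 summands of the series are nonzero. -/
theorem seriesConverge_pi {V : ℕ → Type*} [∀ n, AddCommGroup (V n)] [∀ n, Module k (V n)]
    (F : ℕ → Submodule k (∀ n, V n)) (hF : ∀ n x, x ∈ F n ↔ ∀ j < n, x j = 0) :
    SeriesConverge F := by
  intro x hx
  refine ⟨fun n => ∑ i ∈ Finset.range (n + 1), x i n, fun N => (hF _ _).2 fun j hj => ?_⟩
  rw [Pi.sub_apply, Finset.sum_apply, sub_eq_zero]
  refine Finset.sum_subset (Finset.range_mono hj) fun i _ hi => ?_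
  exact (hF _ _).1 (hx i) j (by simpa using hi)

end CompleteFiltrations

/-! ### Separation and completeness of the completed algebras. -/

section Instances

variable (k : Type*) {A : Type*} [Field k] [Ring A] [Algebra k A] (I : Ideal A) [I.IsTwoSided]

theorem Completion.mem_filtration {n : ℕ} {x : Completion k I} :
    x ∈ Completion.filtration k I n ↔ Completion.proj k I n x = 0 := Iff.rfl

theorem Completion.filtration_antitone : Antitone (Completion.filtration k I) := fun m n h x hx => by
  rw [Completion.mem_filtration] at hx ⊢
  rw [← Completion.transition_proj k I h, hx, map_zero]

theorem Completion.ext {x y : Completion k I}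
    (h : ∀ n, Completion.proj k I n x = Completion.proj k I n y) : x = y :=
  Subtype.ext (funext h)

theorem Completion.separated (x : Completion k I) (h : ∀ n, x ∈ Completion.filtration k I n) :
    x = 0 :=
  Completion.ext k I fun n => (h n).trans (map_zero (Completion.proj k I n)).symm

theorem Completion.proj_toCompletion (n : ℕ) (a : A) :
    Completion.proj k I n (toCompletion k I a) = Ideal.Quotient.mk (I ^ n) a := rfl

theorem Completion.exists_toCompletion (n : ℕ) (x : Completion k I) :
    ∃ a : A, x - toCompletion k I a ∈ Completion.filtration k I n := by
  obtain ⟨a, ha⟩ := Ideal.Quotient.mk_surjective (Completion.proj k I n x)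
  refine ⟨a, ?_⟩
  rw [Completion.mem_filtration, map_sub, Completion.proj_toCompletion, ha, sub_self]

theorem Completion.toCompletion_mem {n : ℕ} {a : A} :
    toCompletion k I a ∈ Completion.filtration k I n ↔ a ∈ pow k I n := by
  rw [Completion.mem_filtration, Completion.proj_toCompletion, Ideal.Quotient.eq_zero_iff_mem,
    mem_pow]

theorem Completion.seriesConverge : SeriesConverge (Completion.filtration k I) := by
  intro x hx
  have h : ∀ m n, m ≤ n → Completion.proj k I m (∑ i ∈ Finset.range n, x i) =
      Completion.proj k I m (∑ i ∈ Finset.range m, x i) := fun m n hmn => by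
    rw [map_sum, map_sum]
    refine (Finset.sum_subset (Finset.range_mono hmn) fun i _ hi => ?_).symm
    exact Completion.filtration_antitone k I (by simpa using hi) (hx i)
  -- At level n all terms from the n-th on vanish, so the partial sum of n terms is already the
  -- limit there.
  let y : Completion k I := ⟨fun n => Completion.proj k I n (∑ i ∈ Finset.range n, x i),
    fun m n hmn => (Completion.transition_proj k I hmn _).trans (h m n hmn)⟩
  have hy : ∀ n, Completion.proj k I n y = Completion.proj k I n (∑ i ∈ Finset.range n, x i) :=
    fun n => rfl
  refine ⟨y, fun N => ?_⟩
  rw [Completion.mem_filtration, map_sub, hy, sub_self]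

theorem GrHat.filtration_antitone : Antitone (GrHat.filtration k I) :=
  fun _ _ h _ hx j hj => hx j (hj.trans_le h)

theorem GrHat.separated (x : GrHat k I) (h : ∀ n, x ∈ GrHat.filtration k I n) : x = 0 :=
  funext fun n => h (n + 1) n n.lt_succ_self

theorem CompletedTensor.proj_inl (n : ℕ) (x : Completion k I) :
    CompletedTensor.proj k I n (CompletedTensor.inl k I x) =
      Completion.proj k I n x ⊗ₜ 1 := rfl

theorem CompletedTensor.proj_inr (n : ℕ) (x : Completion k I) :
    CompletedTensor.proj k I n (CompletedTensor.inr k I x) =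
      1 ⊗ₜ Completion.proj k I n x := rfl

end Instances

/-! ### Completeness of the Malcev Lie algebra and of the graded Lie algebra. -/

section Malcev

variable (k G : Type*) [Field k] [Group G]

theorem proj_completedComul (n : ℕ) (x : GroupAlgebraHat k G) :
    CompletedTensor.proj k _ n (completedComul k G x) =
      comulLevel k G n (Completion.proj k _ (2 * n) x) := rfl

theorem comulLevel_mk (n : ℕ) (a : MonoidAlgebra k G) :
    comulLevel k G n (Ideal.Quotient.mk _ a) =
      Algebra.TensorProduct.map (Ideal.Quotient.mkₐ k (augIdeal k G ^ n))
        (Ideal.Quotient.mkₐ k (augIdeal k G ^ n))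
        (Bialgebra.comulAlgHom k (MonoidAlgebra k G) a) := rfl

theorem mem_malcev {x : GroupAlgebraHat k G} : x ∈ malcev k G ↔
    completedComul k G x = CompletedTensor.inl k _ x + CompletedTensor.inr k _ x := Iff.rfl

theorem mem_malcev_iff {x : GroupAlgebraHat k G} : x ∈ malcev k G ↔
    ∀ n, comulLevel k G n (Completion.proj k _ (2 * n) x) =
      Completion.proj k _ n x ⊗ₜ 1 + 1 ⊗ₜ Completion.proj k _ n x := by
  rw [mem_malcev]
  constructor
  · intro h n
    rw [← proj_completedComul, h, map_add]; rfl
  · intro h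
    refine CompletedTensor.ext k _ fun n => ?_
    rw [proj_completedComul, h, map_add]; rfl

/-- Primitivity is a closed condition: at level n it only involves x modulo the 2n-th term of the
filtration, because `comulLevel` starts from kG/I^(2n). -/
theorem mem_malcev_of_forall {x : GroupAlgebraHat k G}
    (h : ∀ n, ∃ y ∈ malcev k G, x - y ∈ Completion.filtration k (augIdeal k G) n) :
    x ∈ malcev k G := by
  rw [mem_malcev_iff]
  intro n
  obtain ⟨y, hy, hxy⟩ := h (2 * n)
  have e1 : Completion.proj k _ (2 * n) x = Completion.proj k _ (2 * n) y := by
    rwa [Completion.mem_filtration, map_sub, sub_eq_zero] at hxy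
  have e2 : Completion.proj k _ n x = Completion.proj k _ n y := by
    rw [← Completion.transition_proj k _ (show n ≤ 2 * n by omega), e1,
      Completion.transition_proj]
  rw [e1, e2]
  exact (mem_malcev_iff k G).1 hy n

theorem mem_malcevFiltration {n : ℕ} {x : malcev k G} : x ∈ malcevFiltration k G n ↔
    (x : GroupAlgebraHat k G) ∈ Completion.filtration k (augIdeal k G) n := Iff.rfl

theorem malcev_seriesConverge : SeriesConverge (malcevFiltration k G) := by
  intro x hx
  obtain ⟨y, hy⟩ := Completion.seriesConverge k (augIdeal k G)
    (fun i => (x i : GroupAlgebraHat k G)) hx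
  have hs : ∀ N, ∑ i ∈ Finset.range N, (x i : GroupAlgebraHat k G) =
      ((∑ i ∈ Finset.range N, x i : malcev k G) : GroupAlgebraHat k G) := fun N =>
    (map_sum (malcev k G).toSubmodule.subtype _ _).symm
  simp only [hs] at hy
  refine ⟨⟨y, mem_malcev_of_forall k G fun n => ⟨_, (∑ i ∈ Finset.range n, x i).2, hy n⟩⟩, hy⟩

theorem malcev_separated (x : malcev k G) (h : ∀ n, x ∈ malcevFiltration k G n) : x = 0 :=
  Subtype.ext (Completion.separated k _ _ h)

theorem malcevFiltration_antitone : Antitone (malcevFiltration k G) := fun _ _ h _ hx =>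
  Completion.filtration_antitone k _ h hx

theorem grLieHat_seriesConverge : SeriesConverge (GrLieHat.filtration k G) :=
  seriesConverge_pi (V := fun n => GrLiePiece k G n) (GrLieHat.filtration k G) fun _ _ => Iff.rfl

theorem grLieHat_separated (x : GrLieHat k G) (h : ∀ n, x ∈ GrLieHat.filtration k G n) : x = 0 :=
  funext fun n => h (n + 1) n n.lt_succ_self

theorem GrLieHat.filtration_antitone : Antitone (GrLieHat.filtration k G) :=
  fun _ _ h _ hx j hj => hx j (hj.trans_le h)

end Malcev

/-! ### Filtrations and the algebraic lower central series. -/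

section LowerCentralSeries

variable (k : Type*) {L : Type*} [Field k] [LieRing L] [LieAlgebra k L]

/-- The `n + 1`-st term of the lower central series of a Lie algebra, spanned by the left normed
brackets of `n + 1` elements. -/
def lieGamma : ℕ → Submodule k L
  | 0 => ⊤
  | n + 1 => Submodule.span k {z | ∃ x ∈ lieGamma n, ∃ y, ⁅x, y⁆ = z}

/-- In a complete filtered Lie algebra whose associated graded Lie algebra is generated by finitely
many elements of degree one, the filtration is finer than the lower central series. -/
theorem filtration_le_lieGamma {ι : Type*} [Finite ι] (F : ℕ → Submodule k L) (x : ι → L)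
    (hF : SeriesConverge F) (hsep : ∀ y, (∀ n, y ∈ F n) → y = 0) (hanti : Antitone F)
    (hbr : ∀ n, ∀ y ∈ F n, ∀ i, ⁅y, x i⁆ ∈ F (n + 1))
    (hgen : ∀ n, ∀ y ∈ F (n + 2), ∃ z : ι → L, (∀ i, z i ∈ F (n + 1)) ∧
      y - ∑ᶠ i, ⁅z i, x i⁆ ∈ F (n + 3)) (n : ℕ) : F (n + 1) ≤ lieGamma k n := by
  have := Fintype.ofFinite ι
  let f : (ι → L) →ₗ[k] L :=
    { toFun := fun z => ∑ i, ⁅z i, x i⁆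
      map_add' := fun y z => by simp [Finset.sum_add_distrib]
      map_smul' := fun c y => by simp [Finset.smul_sum] }
  have hf : ∀ z, f z = ∑ i, ⁅z i, x i⁆ := fun _ => rfl
  induction n with
  | zero => exact le_top
  | succ n ih =>
    intro y hy
    have hF' : SeriesConverge fun n => F (n + 1) := by
      have := hF.shift 1
      simpa only [add_comm 1] using this
    -- The map z ↦ ∑ [zᵢ, xᵢ] raises degrees by one, which accounts for the shifts n + 1 and n + 2.
    -- It is onto in the graded sense, hence onto by completeness. So y is a finite sum of brackets,
    -- with no closure needed; this is where finiteness of the generating family enters.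
    obtain ⟨z, hz, rfl⟩ := exists_preimage_of_gr_surjective (F := fun n =>
        Submodule.pi Set.univ fun _ : ι => F (n + 1)) (G := fun n => F (n + 2)) hF'.pi
      (fun y hy => hsep y fun n => hanti (Nat.le_add_right n 2) (hy n)) f
      (fun n z hz => by
        rw [hf]
        exact sum_mem fun i _ => hbr _ _ (hz i trivial) i)
      (fun n y hy => by
        obtain ⟨z, hz, h⟩ := hgen n y hy
        rw [finsum_eq_sum_of_fintype] at h
        exact ⟨z, fun i _ => hz i, h⟩)
      (fun m n h => hanti (by omega)) (n := n) hy
    rw [hf]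
    exact sum_mem fun i _ => Submodule.subset_span ⟨z i, ih (hz i trivial), x i, rfl⟩

end LowerCentralSeries

/-! ### Binomial powers and logarithms of unipotent elements. -/

section BinomialSeries

open Polynomial

variable (k : Type*) [Field k]

/-- The polynomial `X (X - 1) ⋯ (X - r + 1) / r!`. -/
def binomPoly (r : ℕ) : k[X] := C ((r.factorial : k)⁻¹) * descPochhammer k r

variable {k} in
/-- Polynomial identities with vector coefficients hold if they hold at all natural numbers. -/
theorem sum_smul_eq_zero_of_nat [CharZero k] {M : Type*} [AddCommGroup M] [Module k M]
    {ι : Type*} (s : Finset ι) (p : ι → k[X]) (v : ι → M)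
    (h : ∀ m : ℕ, ∑ i ∈ s, (p i).eval (m : k) • v i = 0) (D : k[X] →ₗ[k] k) :
    ∑ i ∈ s, D (p i) • v i = 0 := by
  -- Linear forms reduce the claim to one scalar polynomial with infinitely many roots. Once this
  -- polynomial is zero, any functional D may be applied, in particular evaluation at a scalar or
  -- the derivative at 0.
  rw [← Module.forall_dual_apply_eq_zero_iff k]
  intro φ
  have hq : ∑ i ∈ s, φ (v i) • p i = 0 := by
    refine Polynomial.eq_of_infinite_eval_eq _ _
      ((Set.infinite_range_of_injective (Nat.cast_injective (R := k))).mono ?_)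
    rintro _ ⟨m, rfl⟩
    have := congrArg φ (h m)
    simpa [Polynomial.eval_finsetSum, mul_comm] using this
  have := congrArg D hq
  simpa [mul_comm] using this

variable [CharZero k]

theorem binomPoly_eval_nat (r m : ℕ) : (binomPoly k r).eval (m : k) = m.choose r := by
  rw [binomPoly, eval_mul, eval_C, descPochhammer_eval_eq_descFactorial,
    Nat.descFactorial_eq_factorial_mul_choose, Nat.cast_mul, inv_mul_cancel_left₀]
  exact Nat.cast_ne_zero.2 r.factorial_ne_zero

theorem binomPoly_zero : binomPoly k 0 = 1 := by
  simp [binomPoly]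

theorem binomPoly_one : binomPoly k 1 = X := by
  simp [binomPoly]

theorem binomPoly_eval_zero {r : ℕ} (h : 0 < r) : (binomPoly k r).eval 0 = 0 := by
  have := binomPoly_eval_nat k r 0
  rwa [Nat.cast_zero, Nat.choose_eq_zero_of_lt h, Nat.cast_zero] at this

variable {k} {R : Type*} [Ring R] [Algebra k R]

/-- The sum `∑_{r < N} (t choose r) y ^ r`, which is the power `(1 + y) ^ t` if `y ^ N = 0`. -/
def binomPow (N : ℕ) (t : k) (y : R) : R := ∑ r ∈ Finset.range N, (binomPoly k r).eval t • y ^ r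

theorem binomPow_nat {N : ℕ} {y : R} (hy : y ^ N = 0) (m : ℕ) :
    binomPow N (m : k) y = (1 + y) ^ m := by
  have h : ∀ M, N ≤ M → binomPow N (m : k) y = ∑ r ∈ Finset.range M, (m.choose r : k) • y ^ r := by
    intro M hM
    simp only [binomPow, binomPoly_eval_nat]
    refine Finset.sum_subset (Finset.range_mono hM) fun r _ hr => ?_
    rw [pow_eq_zero_of_le (by simpa using hr) hy, smul_zero]
  rw [h (max N (m + 1)) (le_max_left _ _), add_comm 1 y, (Commute.one_right y).add_pow]
  symm
  refine (Finset.sum_congr rfl fun r _ => ?_).trans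
    (Finset.sum_subset (Finset.range_mono (le_max_right N (m + 1))) fun r _ hr => ?_)
  · rw [one_pow, mul_one, Nat.cast_smul_eq_nsmul, nsmul_eq_mul, Nat.cast_comm]
  · rw [Nat.choose_eq_zero_of_lt (by simpa using hr), Nat.cast_zero, zero_smul]

theorem binomPow_zero {N : ℕ} {y : R} (hy : y ^ N = 0) : binomPow N (0 : k) y = 1 := by
  have := binomPow_nat (k := k) hy 0
  rwa [Nat.cast_zero, pow_zero] at this

theorem binomPow_one {N : ℕ} {y : R} (hy : y ^ N = 0) : binomPow N (1 : k) y = 1 + y := by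
  have := binomPow_nat (k := k) hy 1
  rwa [Nat.cast_one, pow_one] at this

/-- For fixed t both sides are polynomial in s, so agreement at natural numbers suffices. -/
theorem binomPow_add_of_nat {N : ℕ} {y : R} {t : k}
    (h : ∀ m : ℕ, binomPow N ((m : k) + t) y = binomPow N (m : k) y * binomPow N t y) (s : k) :
    binomPow N (s + t) y = binomPow N s y * binomPow N t y := by
  -- The Boolean separates the two sides of the identity: `true` marks the left side, with argument
  -- shifted by t, and `false` the right side, with a minus sign.
  have key := sum_smul_eq_zero_of_nat (Finset.range N ×ˢ (Finset.univ : Finset Bool))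
    (fun i => if i.2 then (binomPoly k i.1).comp (X + C t) else binomPoly k i.1)
    (fun i => if i.2 then y ^ i.1 else - (y ^ i.1 * binomPow N t y))
    (fun m => by
      rw [Finset.sum_product]
      simp only [Fintype.sum_bool, if_true, Bool.false_eq_true, if_false, eval_comp, eval_add,
        eval_X, eval_C, Finset.sum_add_distrib, smul_neg, Finset.sum_neg_distrib]
      have := h m
      rw [binomPow, binomPow, Finset.sum_mul] at this
      simp only [smul_mul_assoc] at this
      rw [this]
      exact add_neg_cancel _) (Polynomial.leval s)
  rw [Finset.sum_product] at key
  simp only [Fintype.sum_bool, if_true, Bool.false_eq_true, if_false, eval_comp, eval_add,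
    eval_X, eval_C, Finset.sum_add_distrib, smul_neg, Finset.sum_neg_distrib,
    Polynomial.leval_apply] at key
  rw [add_neg_eq_zero] at key
  rw [binomPow, key, binomPow.eq_1 N s, Finset.sum_mul]
  simp only [smul_mul_assoc]

theorem commute_binomPow {N : ℕ} {y z : R} (h : Commute z y) (t : k) :
    Commute z (binomPow N t y) :=
  Commute.sum_right _ _ _ fun r _ => (h.pow_right r).smul_right _

theorem binomPow_add {N : ℕ} {y : R} (hy : y ^ N = 0) (s t : k) :
    binomPow N (s + t) y = binomPow N s y * binomPow N t y := by
  -- One exponent is freed at a time: first next to a natural number m, then, as the powers commute,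
  -- next to an arbitrary scalar.
  have h1 : ∀ (m : ℕ) (t : k), binomPow N (t + m) y = binomPow N t y * binomPow N (m : k) y :=
    fun m => binomPow_add_of_nat fun l => by
      rw [← Nat.cast_add, binomPow_nat hy, binomPow_nat hy, binomPow_nat hy, pow_add]
  refine binomPow_add_of_nat (fun m => ?_) s
  rw [add_comm, h1 m]
  exact commute_binomPow ((commute_binomPow (Commute.refl y) t).symm) (m : k)

/-- Unipotent elements have p-th roots in characteristic 0; this later supplies the root needed to
adjoin t to K. -/
theorem binomPow_inv_pow {N : ℕ} {y : R} (hy : y ^ N = 0) {p : ℕ} (hp : p ≠ 0) :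
    binomPow N ((p : k)⁻¹) y ^ p = 1 + y := by
  have h : ∀ m : ℕ, binomPow N ((m : k) * (p : k)⁻¹) y = binomPow N ((p : k)⁻¹) y ^ m := by
    intro m
    induction m with
    | zero => rw [Nat.cast_zero, zero_mul, binomPow_zero hy, pow_zero]
    | succ m ih =>
      rw [Nat.cast_succ, add_mul, one_mul, binomPow_add hy, ih, pow_succ]
  rw [← h, mul_inv_cancel₀ (Nat.cast_ne_zero.2 hp), binomPow_one hy]

theorem map_binomPow {S F : Type*} [Ring S] [Algebra k S] [FunLike F R S] [AlgHomClass F k R S]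
    (f : F) (N : ℕ) (t : k) (y : R) : f (binomPow N t y) = binomPow N t (f y) := by
  simp only [binomPow, map_sum, map_smul, map_pow]

variable (k) in
/-- The coefficients of the logarithm series, as derivatives of binomial coefficients. -/
def logCoeff (r : ℕ) : k := (derivative (binomPoly k r)).eval 0

theorem logCoeff_zero : logCoeff k 0 = 0 := by simp [logCoeff, binomPoly_zero]

theorem logCoeff_one : logCoeff k 1 = 1 := by simp [logCoeff, binomPoly_one]

/-- The logarithm of a group-like element of an algebra with unipotent values is primitive. -/
theorem sum_logCoeff_tmul {N : ℕ} {y : R} (hy : y ^ N = 0)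
    (hN : 0 < N) {f : R ⊗[k] R} (hf : f ^ N = 0) (hfy : 1 + f = (1 + y) ⊗ₜ (1 + y)) :
    ∑ r ∈ Finset.range N, logCoeff k r • f ^ r =
      (∑ r ∈ Finset.range N, logCoeff k r • y ^ r) ⊗ₜ 1 +
        1 ⊗ₜ ∑ r ∈ Finset.range N, logCoeff k r • y ^ r := by
  -- For natural m this expands (1 + f)^m = (1 + y)^m ⊗ (1 + y)^m, which is multiplicativity of m-th
  -- powers.
  have h1 : ∀ m : ℕ, ∑ r ∈ Finset.range N, (binomPoly k r).eval (m : k) • f ^ r =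
      ∑ p ∈ Finset.range N ×ˢ Finset.range N,
        (binomPoly k p.1 * binomPoly k p.2).eval (m : k) • ((y ^ p.1) ⊗ₜ[k] (y ^ p.2)) := by
    intro m
    have e : binomPow N (m : k) f = binomPow N (m : k) y ⊗ₜ binomPow N (m : k) y := by
      rw [binomPow_nat hf, binomPow_nat hy, hfy, Algebra.TensorProduct.tmul_pow]
    rw [binomPow, binomPow, TensorProduct.sum_tmul] at e
    rw [e, Finset.sum_product]
    refine Finset.sum_congr rfl fun r _ => ?_
    rw [TensorProduct.tmul_sum]
    refine Finset.sum_congr rfl fun s _ => ?_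
    rw [TensorProduct.smul_tmul_smul, eval_mul]
  -- The logarithm is the derivative of (1 + y)^t at t = 0, so D is applied to the identity of m-th
  -- powers.
  let D : k[X] →ₗ[k] k := (Polynomial.leval 0) ∘ₗ derivative
  have hD : ∀ p : k[X], D p = (derivative p).eval 0 := fun _ => rfl
  have key := sum_smul_eq_zero_of_nat
    ((Finset.range N).disjSum (Finset.range N ×ˢ Finset.range N))
    (Sum.elim (fun r => binomPoly k r) fun p => binomPoly k p.1 * binomPoly k p.2)
    (Sum.elim (fun r => f ^ r) fun p => - ((y ^ p.1) ⊗ₜ[k] (y ^ p.2)))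
    (fun m => by
      rw [Finset.sum_disjSum]
      simp only [Sum.elim_inl, Sum.elim_inr, smul_neg, Finset.sum_neg_distrib]
      rw [h1, add_neg_cancel]) D
  rw [Finset.sum_disjSum] at key
  simp only [Sum.elim_inl, Sum.elim_inr, smul_neg, Finset.sum_neg_distrib] at key
  rw [add_neg_eq_zero] at key
  refine key.trans ?_
  have h0 : ∀ r, (binomPoly k r).eval 0 = if r = 0 then 1 else 0 := fun r => by
    rcases Nat.eq_zero_or_pos r with rfl | h
    · rw [binomPoly_zero, eval_one, if_pos rfl]
    · rw [binomPoly_eval_zero k h, if_neg h.ne']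
  -- By the Leibniz rule one of the two binomial polynomials is evaluated at 0, where it vanishes
  -- unless its index is 0.
  have h2 : ∀ p : ℕ × ℕ, D (binomPoly k p.1 * binomPoly k p.2) • ((y ^ p.1) ⊗ₜ[k] (y ^ p.2)) =
      (if p.2 = 0 then (logCoeff k p.1 • y ^ p.1) ⊗ₜ[k] (1 : R) else 0) +
      (if p.1 = 0 then (1 : R) ⊗ₜ[k] (logCoeff k p.2 • y ^ p.2) else 0) := fun p => by
    rw [hD, derivative_mul, eval_add, eval_mul, eval_mul, h0, h0, add_smul]
    congr 1
    · split_ifs with h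
      · rw [h, pow_zero, mul_one, TensorProduct.smul_tmul']; rfl
      · rw [mul_zero, zero_smul]
    · split_ifs with h
      · rw [h, pow_zero, one_mul, TensorProduct.tmul_smul]; rfl
      · rw [zero_mul, zero_smul]
  rw [Finset.sum_congr rfl fun p _ => h2 p, Finset.sum_add_distrib, Finset.sum_product,
    Finset.sum_product, TensorProduct.sum_tmul, TensorProduct.tmul_sum]
  congr 1
  · refine Finset.sum_congr rfl fun r _ => ?_
    rw [Finset.sum_ite_eq' (Finset.range N) 0, if_pos (Finset.mem_range.2 hN)]
  · rw [Finset.sum_comm]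
    refine Finset.sum_congr rfl fun r _ => ?_
    rw [Finset.sum_ite_eq' (Finset.range N) 0, if_pos (Finset.mem_range.2 hN)]

end BinomialSeries

/-! ### Logarithms of group elements in the Malcev Lie algebra. -/

section Logarithm

variable (k G : Type*) [Field k] [CharZero k] [Group G]

theorem Completion.pow_mem_filtration {A : Type*} [Ring A] [Algebra k A] (I : Ideal A)
    [I.IsTwoSided] {n : ℕ} {x : Completion k I} (hx : x ∈ Completion.filtration k I n) (r : ℕ) :
    x ^ r ∈ Completion.filtration k I (n * r) := by
  induction r with
  | zero => exact Completion.mem_filtration_zero k I _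
  | succ r ih => rw [pow_succ, mul_add, mul_one]; exact Completion.mul_mem_filtration k I ih hx

/-- The logarithm of a group element is primitive and has the same leading term as `g - 1`. -/
theorem exists_log (g : G) : ∃ x : malcev k G, ∀ n, 0 < n →
    MonoidAlgebra.of k G g - 1 ∈ pow k (augIdeal k G) n →
      (x : GroupAlgebraHat k G) - toCompletion k (augIdeal k G) (MonoidAlgebra.of k G g - 1) ∈
        Completion.filtration k (augIdeal k G) (n + 1) := by
  set a := MonoidAlgebra.of k G g - 1 with ha
  have ha1 : a ∈ pow k (augIdeal k G) 1 := (mem_pow_one k _).2 (of_sub_one_mem k g)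
  set y := toCompletion k (augIdeal k G) a with hy
  have hy1 : y ∈ Completion.filtration k (augIdeal k G) 1 :=
    (Completion.toCompletion_mem k _).2 ha1
  have hyr : ∀ r, y ^ r ∈ Completion.filtration k (augIdeal k G) r := fun r => by
    have := Completion.pow_mem_filtration k _ hy1 r
    rwa [one_mul] at this
  -- x is the logarithm series of 1 + y, where y is the image of g - 1.
  obtain ⟨x, hx⟩ := Completion.seriesConverge k (augIdeal k G)
    (fun r => logCoeff k r • y ^ r) fun r => Submodule.smul_mem _ _ (hyr r)
  have hxm : x ∈ malcev k G := by
    rw [mem_malcev_iff]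
    intro n
    rcases Nat.eq_zero_or_pos n with rfl | hn
    · have : Subsingleton (MonoidAlgebra k G ⧸ augIdeal k G ^ 0) := by
        rw [Submodule.pow_zero, Ideal.one_eq_top]
        exact Ideal.Quotient.subsingleton_iff.2 rfl
      have : Subsingleton ((MonoidAlgebra k G ⧸ augIdeal k G ^ 0) ⊗[k]
        (MonoidAlgebra k G ⧸ augIdeal k G ^ 0)) := inferInstance
      exact Subsingleton.elim _ _
    -- The series is cut at 2n because the comultiplication at level n starts from kG/I^(2n). The
    -- same cut is valid at level n, which makes the two sides comparable.
    · have e1 : ∀ m, m ≤ 2 * n → Completion.proj k _ m x =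
          ∑ r ∈ Finset.range (2 * n), logCoeff k r • Ideal.Quotient.mk (augIdeal k G ^ m) a ^ r := by
        intro m hm
        have h := Completion.filtration_antitone k (augIdeal k G) hm (hx (2 * n))
        rw [Completion.mem_filtration, map_sub, sub_eq_zero, map_sum] at h
        rw [h]
        refine Finset.sum_congr rfl fun r _ => ?_
        rw [map_smul, map_pow, hy, Completion.proj_toCompletion]
      rw [e1 _ le_rfl, e1 n (by omega), map_sum]
      have e2 : ∀ r, comulLevel k G n (logCoeff k r • Ideal.Quotient.mk _ a ^ r) =
          logCoeff k r • comulLevel k G n (Ideal.Quotient.mk _ a) ^ r := fun r => by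
        rw [map_smul, map_pow]
      rw [Finset.sum_congr rfl fun r _ => e2 r]
      have h0 : ∀ m, m ≤ 2 * n → Ideal.Quotient.mk (augIdeal k G ^ m) a ^ (2 * n) = 0 := by
        intro m hm
        have := Completion.filtration_antitone k (augIdeal k G) hm (hyr (2 * n))
        rwa [Completion.mem_filtration, map_pow, hy, Completion.proj_toCompletion] at this
      refine sum_logCoeff_tmul (h0 n (by omega)) (by omega) ?_ ?_
      · rw [← map_pow, h0 _ le_rfl, map_zero]
      · rw [comulLevel_mk, ← map_one (Ideal.Quotient.mk (augIdeal k G ^ n)), ← map_add, ha,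
          add_sub_cancel, map_sub (Bialgebra.comulAlgHom k (MonoidAlgebra k G)), map_one,
          map_sub, map_one, add_sub_cancel, comul_of]
        rfl
  refine ⟨⟨x, hxm⟩, fun n hn han => ?_⟩
  have hyn : y ∈ Completion.filtration k (augIdeal k G) n :=
    (Completion.toCompletion_mem k _).2 han
  have h := hx (n + 1)
  -- The linear term of the logarithm is y. The terms with r ≥ 2 lie in degree nr ≥ 2n ≥ n + 1, as n
  -- is positive.
  have e : x - y = (x - ∑ r ∈ Finset.range (n + 1), logCoeff k r • y ^ r) +
      ∑ r ∈ (Finset.range (n + 1)).erase 1, logCoeff k r • y ^ r := by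
    rw [← Finset.add_sum_erase (Finset.range (n + 1)) _ (Finset.mem_range.2 (by omega : 1 < n + 1)),
      logCoeff_one, one_smul, pow_one]
    abel
  change x - y ∈ _
  rw [e]
  refine add_mem h (sum_mem fun r hr => ?_)
  rcases Nat.eq_zero_or_pos r with rfl | hr0
  · rw [logCoeff_zero, zero_smul]; exact zero_mem _
  · have hr1 := (Finset.mem_erase.1 hr).1
    refine Submodule.smul_mem _ _ (Completion.filtration_antitone k _ ?_
      (Completion.pow_mem_filtration k _ hyn r))
    calc n + 1 ≤ n * 2 := by omega
      _ ≤ n * r := Nat.mul_le_mul_left n (by omega)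

end Logarithm

/-! ### Extending a homomorphism from a normal subgroup by one element. -/

section GroupExtension

variable {G M : Type*} [Group G] [Group M] (K : Subgroup G) [K.Normal] (t : G)

theorem mem_sup_zpowers_iff {g : G} :
    g ∈ K ⊔ Subgroup.zpowers t ↔ ∃ x ∈ K, ∃ m : ℤ, x * t ^ m = g := by
  rw [Subgroup.mem_sup_of_normal_left]
  constructor
  · rintro ⟨x, hx, _, ⟨m, rfl⟩, rfl⟩
    exact ⟨x, hx, m, rfl⟩
  · rintro ⟨x, hx, m, rfl⟩
    exact ⟨x, hx, _, ⟨m, rfl⟩, rfl⟩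

/-- Extension of a homomorphism from a normal subgroup `K` to the subgroup generated by `K` and one
more element. -/
theorem exists_hom_sup_zpowers (ρ : K →* M) (T : M)
    (hT : ∀ x : K, ρ (MulAut.conjNormal t x) = T * ρ x * T⁻¹)
    (hp : ∀ (m : ℤ) (hm : t ^ m ∈ K), ρ ⟨t ^ m, hm⟩ = T ^ m) :
    ∃ σ : (K ⊔ Subgroup.zpowers t : Subgroup G) →* M,
      ∀ (x : K) (m : ℤ) (h : (x : G) * t ^ m ∈ K ⊔ Subgroup.zpowers t),
        σ ⟨x * t ^ m, h⟩ = ρ x * T ^ m := by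
  -- Compatibility with conjugation by t passes to all integral powers of t.
  have hTm : ∀ (m : ℤ) (x : K), ρ (MulAut.conjNormal (t ^ m) x) = T ^ m * ρ x * (T ^ m)⁻¹ := by
    intro m
    induction m with
    | zero => intro x; simp
    | succ m ih =>
      intro x
      rw [zpow_add_one, map_mul, MulAut.mul_apply, ih, hT, zpow_add_one]
      group
    | pred m ih =>
      intro x
      have h := hT (MulAut.conjNormal t⁻¹ x)
      rw [← MulAut.mul_apply, ← map_mul, mul_inv_cancel, map_one, MulAut.one_apply] at h
      rw [zpow_sub_one, map_mul, MulAut.mul_apply, ih, h, zpow_sub_one]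
      group
  -- Two expressions of one element differ by a power of t which lies in K, where `hp` prescribes
  -- the value.
  have hwd : ∀ (x y : K) (m l : ℤ), (x : G) * t ^ m = y * t ^ l → ρ x * T ^ m = ρ y * T ^ l := by
    intro x y m l h
    have h1 : t ^ (l - m) = ((y⁻¹ * x : K) : G) := by
      rw [zpow_sub, Subgroup.coe_mul, Subgroup.coe_inv, eq_inv_mul_iff_mul_eq, ← mul_assoc, ← h]
      group
    have h2 := hp (l - m) (h1 ▸ (y⁻¹ * x).2)
    have h3 : (⟨t ^ (l - m), h1 ▸ (y⁻¹ * x).2⟩ : K) = y⁻¹ * x := Subtype.ext h1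
    rw [h3, map_mul, map_inv, inv_mul_eq_iff_eq_mul] at h2
    rw [h2, mul_assoc, ← zpow_add, sub_add_cancel]
  choose x hx m hm using fun g : (K ⊔ Subgroup.zpowers t : Subgroup G) =>
    (mem_sup_zpowers_iff K t).1 g.2
  refine ⟨MonoidHom.mk' (fun g => ρ ⟨x g, hx g⟩ * T ^ m g) fun g h => ?_, fun y l h => ?_⟩
  · have h1 : ρ ⟨x (g * h), hx (g * h)⟩ * T ^ m (g * h) =
        ρ (⟨x g, hx g⟩ * MulAut.conjNormal (t ^ m g) ⟨x h, hx h⟩) * T ^ (m g + m h) := by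
      refine hwd _ _ _ _ ?_
      rw [hm, Subgroup.coe_mul, Subgroup.coe_mul, MulAut.conjNormal_apply, ← hm g, ← hm h]
      group
    rw [h1, map_mul, hTm]
    group
  · exact hwd ⟨x _, hx _⟩ y _ _ (hm _)

end GroupExtension

theorem monoidAlgebra_hom_ext {k M B : Type*} [Field k] [Monoid M] [Ring B] [Algebra k B]
    {φ ψ : MonoidAlgebra k M →ₐ[k] B}
    (h : ∀ x, φ (MonoidAlgebra.of k M x) = ψ (MonoidAlgebra.of k M x)) : φ = ψ :=
  MonoidAlgebra.algHom_ext' (MonoidHom.ext h) (by ext)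

/-! ### Weights on the group algebra of a subgroup. -/

section Weights

variable (k : Type*) {G : Type*} [Field k] [Group G] (K : Subgroup G)

/-- The elements of the group algebra of a subgroup `K` of weight at least `i`, where `x - 1` has
weight at least `w` if `x` is in the `w`-th term of the lower central series of the whole group. -/
inductive HasWeight : ℕ → MonoidAlgebra k K → Prop
  | weight_zero (a : MonoidAlgebra k K) : HasWeight 0 a
  | zero (i : ℕ) : HasWeight i 0
  | sub_one (w : ℕ) (x : K) (hx : (x : G) ∈ lcs G w) : HasWeight w (MonoidAlgebra.of k K x - 1)
  | mul {i j : ℕ} {a b : MonoidAlgebra k K} :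
      HasWeight i a → HasWeight j b → HasWeight (i + j) (a * b)
  | add {i : ℕ} {a b : MonoidAlgebra k K} : HasWeight i a → HasWeight i b → HasWeight i (a + b)
  | of_succ {i : ℕ} {a : MonoidAlgebra k K} : HasWeight (i + 1) a → HasWeight i a

variable {k K}

theorem HasWeight.mono {i j : ℕ} (h : i ≤ j) {a : MonoidAlgebra k K} (ha : HasWeight k K j a) :
    HasWeight k K i a := by
  induction h with
  | refl => exact ha
  | step _ ih => exact ih ha.of_succ

theorem HasWeight.smul {i : ℕ} (c : k) {a : MonoidAlgebra k K} (ha : HasWeight k K i a) :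
    HasWeight k K i (c • a) := by
  have := (HasWeight.weight_zero (c • (1 : MonoidAlgebra k K))).mul ha
  rwa [zero_add, smul_one_mul] at this

/-- Weights are generated multiplicatively by the elements x - 1, so a multiplicative filtration of
the target has to be checked on these only. -/
theorem HasWeight.map {B : Type*} [Ring B] [Algebra k B] (φ : MonoidAlgebra k K →ₐ[k] B)
    (W : ℕ → Submodule k B) (h0 : ∀ a, φ a ∈ W 0)
    (hmul : ∀ {i j x y}, x ∈ W i → y ∈ W j → x * y ∈ W (i + j)) (hanti : Antitone W)
    (h : ∀ (w : ℕ) (x : K), (x : G) ∈ lcs G w → φ (MonoidAlgebra.of k K x - 1) ∈ W w) {i : ℕ}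
    {a : MonoidAlgebra k K} (ha : HasWeight k K i a) : φ a ∈ W i := by
  induction ha with
  | weight_zero a => exact h0 a
  | zero i => rw [map_zero]; exact zero_mem _
  | sub_one w x hx => exact h w x hx
  | mul _ _ iha ihb => rw [map_mul]; exact hmul iha ihb
  | add _ _ iha ihb => rw [map_add]; exact add_mem iha ihb
  | of_succ _ ih => exact hanti (Nat.le_succ _) ih

variable (k K)

/-- The ideal of elements of weight at least `i`. -/
def weightIdeal (i : ℕ) : Ideal (MonoidAlgebra k K) where
  carrier := {a | HasWeight k K i a}
  zero_mem' := .zero i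
  add_mem' := .add
  smul_mem' c a ha := by simpa using (HasWeight.weight_zero c).mul ha

instance weightIdeal_isTwoSided (i : ℕ) : (weightIdeal k K i).IsTwoSided :=
  ⟨fun c ha => show HasWeight k K i _ from ((show HasWeight k K i _ from ha).mul
    (HasWeight.weight_zero c))⟩

/-- Every character of `Γₙ / Γₙ₊₁` extends to a linear form on the group algebra of `K` which
vanishes on the elements of weight greater than `n`. -/
def CharactersExtend (n : ℕ) : Prop :=
  ∀ χ : G → k, (∀ x ∈ lcs G n, ∀ y ∈ lcs G n, χ (x * y) = χ x + χ y) →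
    (∀ x ∈ lcs G (n + 1), χ x = 0) →
    ∃ f : MonoidAlgebra k K →ₗ[k] k, (∀ a, HasWeight k K (n + 1) a → f a = 0) ∧
      ∀ x : K, (x : G) ∈ lcs G n → f (MonoidAlgebra.of k K x - 1) = χ x

/-- Start of the induction, K = Γₙ. The character becomes the representation x ↦ 1 + χ(x)ε over the
dual numbers, and the linear form is the coefficient of ε. -/
theorem charactersExtend_lcs (n : ℕ) : CharactersExtend k (lcs G n) n := by
  intro χ hχ hχ0
  have h1 : χ 1 = 0 := hχ0 1 (one_mem _)
  let ρ : lcs G n →* TrivSqZeroExt k k :=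
    { toFun := fun x => 1 + TrivSqZeroExt.inr (χ x)
      map_one' := by simp [h1]
      map_mul' := fun x y => by
        rw [Subgroup.coe_mul, hχ _ x.2 _ y.2, TrivSqZeroExt.inr_add, add_mul, mul_add, mul_add,
          TrivSqZeroExt.inr_mul_inr]
        simp only [one_mul, mul_one, add_zero]
        abel }
  let φ := MonoidAlgebra.lift k (TrivSqZeroExt k k) (lcs G n) ρ
  have hφ : ∀ x : lcs G n, φ (MonoidAlgebra.of k _ x - 1) = TrivSqZeroExt.inr (χ x) := fun x => by
    rw [map_sub, map_one, MonoidAlgebra.lift_of]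
    exact add_sub_cancel_left _ _
  -- Everything in degree 0, the ideal (ε) in degrees 1 to n, and zero beyond. It is multiplicative
  -- as ε² = 0, and it matches weights because χ vanishes on Γₙ₊₁.
  let W : ℕ → Submodule k (TrivSqZeroExt k k) := fun i =>
    if i = 0 then ⊤ else if i ≤ n then LinearMap.ker (TrivSqZeroExt.fstHom k k k).toLinearMap else ⊥
  have hW : ∀ i, 0 < i → W i ≤ LinearMap.ker (TrivSqZeroExt.fstHom k k k).toLinearMap := by
    intro i hi
    simp only [W, if_neg hi.ne']
    split_ifs
    · exact le_rfl
    · exact bot_le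
  have hanti : Antitone W := by
    refine antitone_nat_of_succ_le fun i => ?_
    simp only [W]
    split_ifs <;> first | exact le_top | exact bot_le | exact le_rfl | (exfalso; omega)
  refine ⟨TrivSqZeroExt.sndHom k k ∘ₗ φ.toLinearMap, fun a ha => ?_, fun x _ => ?_⟩
  · have : φ a ∈ W (n + 1) := by
      refine ha.map φ W (fun _ => trivial) ?_ hanti ?_
      · intro i j x y hx hy
        have hker : ∀ {z : TrivSqZeroExt k k}, TrivSqZeroExt.fst z = 0 →
            z ∈ LinearMap.ker (TrivSqZeroExt.fstHom k k k).toLinearMap := fun h => h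
        rcases Nat.eq_zero_or_pos i with rfl | hi
        · rw [zero_add]
          simp only [W] at hy ⊢
          split_ifs at hy ⊢
          · trivial
          · exact hker (by rw [TrivSqZeroExt.fst_mul, show y.fst = 0 from hy, mul_zero])
          · rw [(Submodule.mem_bot k).1 hy, mul_zero]; exact zero_mem _
        · rcases Nat.eq_zero_or_pos j with rfl | hj
          · rw [add_zero]
            simp only [W] at hx ⊢
            split_ifs at hx ⊢
            · trivial
            · exact hker (by rw [TrivSqZeroExt.fst_mul, show x.fst = 0 from hx, zero_mul])
            · rw [(Submodule.mem_bot k).1 hx, zero_mul]; exact zero_mem _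
          · have hx0 : x.fst = 0 := hW i hi hx
            have hy0 : y.fst = 0 := hW j hj hy
            have : x * y = 0 := by
              ext
              · rw [TrivSqZeroExt.fst_mul, hx0, zero_mul]; rfl
              · rw [TrivSqZeroExt.snd_mul, hx0, hy0]; simp
            rw [this]; exact zero_mem _
      · intro w x hx
        rw [hφ]
        simp only [W]
        split_ifs with h1 h2
        · trivial
        · exact TrivSqZeroExt.fst_inr k (χ x)
        · rw [hχ0 _ (lcs_antitone G (by omega) hx), TrivSqZeroExt.inr_zero]
          exact zero_mem _
    have h0 : φ a = 0 := by
      simpa [W] using this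
    change TrivSqZeroExt.snd (φ a) = 0
    rw [h0]; rfl
  · change TrivSqZeroExt.snd (φ (MonoidAlgebra.of k _ x - 1)) = _
    rw [hφ]; rfl

variable {k K}

/-- The conjugation of the group algebra of a normal subgroup by an element of the whole group. -/
def conjAlg [K.Normal] (t : G) : MonoidAlgebra k K →ₐ[k] MonoidAlgebra k K :=
  MonoidAlgebra.mapDomainAlgHom k k (MulAut.conjNormal (H := K) t).toMonoidHom

theorem conjAlg_of [K.Normal] (t : G) (x : K) :
    conjAlg (k := k) t (MonoidAlgebra.of k K x) = MonoidAlgebra.of k K (MulAut.conjNormal t x) := by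
  simp [conjAlg]

theorem conjAlg_mul [K.Normal] (s t : G) (a : MonoidAlgebra k K) :
    conjAlg s (conjAlg t a) = conjAlg (s * t) a := by
  have : (conjAlg s).comp (conjAlg t) = conjAlg (k := k) (K := K) (s * t) := by
    refine monoidAlgebra_hom_ext fun x => ?_
    rw [AlgHom.comp_apply]
    rw [conjAlg_of, conjAlg_of, conjAlg_of, map_mul, MulAut.mul_apply]
  exact DFunLike.congr_fun this a

theorem conjAlg_one [K.Normal] (a : MonoidAlgebra k K) : conjAlg 1 a = a := by
  have : conjAlg (k := k) (K := K) 1 = AlgHom.id k _ := by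
    refine monoidAlgebra_hom_ext fun x => ?_
    rw [conjAlg_of, map_one, MulAut.one_apply, AlgHom.id_apply]
  exact DFunLike.congr_fun this a

open scoped commutatorElement in
/-- Conjugation by an element of `Γⱼ` is the identity up to an increase of weights by `j`. -/
theorem HasWeight.conj_sub [K.Normal] {j : ℕ} {t : G}
    (ht : t ∈ lcs G j) {i : ℕ} {a : MonoidAlgebra k K} (ha : HasWeight k K i a) :
    HasWeight k K (i + j) (conjAlg t a - a) := by
  have key : ∀ (w : ℕ) (x : K), (x : G) ∈ lcs G w → HasWeight k K (w + j)
      (conjAlg t (MonoidAlgebra.of k K x) - MonoidAlgebra.of k K x) := by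
    intro w x hx
    -- Conjugation moves x by the factor [t, x], which lies in Γ_(w + j).
    let c : K := MulAut.conjNormal t x * x⁻¹
    have hc : (c : G) = ⁅t, (x : G)⁆ := by
      rw [Subgroup.coe_mul, MulAut.conjNormal_apply, Subgroup.coe_inv, commutatorElement_def]
    have e : conjAlg t (MonoidAlgebra.of k K x) - MonoidAlgebra.of k K x =
        (MonoidAlgebra.of k K c - 1) * MonoidAlgebra.of k K x := by
      rw [conjAlg_of, sub_mul, one_mul, ← map_mul, inv_mul_cancel_right]
    rw [e]
    refine (HasWeight.sub_one (w + j) c ?_).mul (.weight_zero _)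
    rw [hc]
    exact commutator_mem_lcs (add_comm j w) ht hx
  have hneg : ∀ {i : ℕ} {a : MonoidAlgebra k K}, HasWeight k K i a → HasWeight k K i (-a) :=
    fun h => by simpa using h.smul (-1)
  induction ha with
  | weight_zero a =>
    induction a using MonoidAlgebra.induction_on with
    | of x => exact key 0 x (Subgroup.mem_top _)
    | add a b ha hb =>
      rw [map_add, add_sub_add_comm]
      exact ha.add hb
    | smul r a ha =>
      rw [map_smul, ← smul_sub]
      exact ha.smul r
  | zero i => rw [map_zero, sub_zero]; exact .zero _
  | sub_one w x hx =>
    rw [map_sub, map_one, sub_sub_sub_cancel_right]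
    exact key w x hx
  | @mul i l a b ha hb iha ihb =>
    -- A twisted Leibniz rule; each of the three terms has weight at least i + l + j.
    have e : conjAlg t (a * b) - a * b =
        (conjAlg t a - a) * (conjAlg t b - b) + ((conjAlg t a - a) * b + a * (conjAlg t b - b)) := by
      rw [map_mul]; noncomm_ring
    rw [e]
    refine HasWeight.add ?_ (HasWeight.add ?_ ?_)
    · exact (iha.mul ihb).mono (by omega)
    · exact (iha.mul hb).mono (by omega)
    · exact (ha.mul ihb).mono (by omega)
  | add _ _ iha ihb =>
    rw [map_add, add_sub_add_comm]
    exact iha.add ihb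
  | of_succ _ ih => exact ih.mono (by omega)

end Weights

/-! ### The action of a larger group on a truncated group algebra. -/

section WeightQuotient

variable (k : Type*) {G : Type*} [Field k] [Group G] (K : Subgroup G) (n : ℕ)

/-- The quotient of the group algebra of `K` by the elements of weight greater than `n`. -/
abbrev WeightQuot : Type _ := MonoidAlgebra k K ⧸ weightIdeal k K (n + 1)

/-- The projection of the group algebra to its quotient. -/
abbrev WeightQuot.mk : MonoidAlgebra k K →ₐ[k] WeightQuot k K n :=
  Ideal.Quotient.mkₐ k (weightIdeal k K (n + 1))

theorem WeightQuot.mk_surjective : Function.Surjective (WeightQuot.mk k K n) :=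
  Ideal.Quotient.mk_surjective

theorem WeightQuot.mk_eq_zero {a : MonoidAlgebra k K} (h : HasWeight k K (n + 1) a) :
    WeightQuot.mk k K n a = 0 := Ideal.Quotient.eq_zero_iff_mem.2 h

/-- The weight filtration of the quotient. -/
def WeightQuot.fil (i : ℕ) : Submodule k (WeightQuot k K n) :=
  ((weightIdeal k K i).restrictScalars k).map (WeightQuot.mk k K n).toLinearMap

variable {k K n}

theorem WeightQuot.fil_antitone : Antitone (WeightQuot.fil k K n) := by
  rintro i j h b ⟨a, ha, rfl⟩
  exact ⟨a, HasWeight.mono h ha, rfl⟩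

theorem WeightQuot.mem_fil_zero (b : WeightQuot k K n) : b ∈ WeightQuot.fil k K n 0 := by
  obtain ⟨a, rfl⟩ := WeightQuot.mk_surjective k K n b
  exact ⟨a, .weight_zero a, rfl⟩

theorem WeightQuot.mul_mem_fil {i j : ℕ} {b c : WeightQuot k K n}
    (hb : b ∈ WeightQuot.fil k K n i) (hc : c ∈ WeightQuot.fil k K n j) :
    b * c ∈ WeightQuot.fil k K n (i + j) := by
  obtain ⟨a, ha, rfl⟩ := hb
  obtain ⟨a', ha', rfl⟩ := hc
  exact ⟨a * a', HasWeight.mul ha ha', map_mul (WeightQuot.mk k K n) a a'⟩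

theorem WeightQuot.eq_zero_of_mem_fil {b : WeightQuot k K n}
    (hb : b ∈ WeightQuot.fil k K n (n + 1)) : b = 0 := by
  obtain ⟨a, ha, rfl⟩ := hb
  exact WeightQuot.mk_eq_zero k K n ha

theorem WeightQuot.of_sub_one_mem {w : ℕ} {x : K} (hx : (x : G) ∈ lcs G w) :
    WeightQuot.mk k K n (MonoidAlgebra.of k K x) - 1 ∈ WeightQuot.fil k K n w :=
  ⟨_, .sub_one w x hx, (map_sub (WeightQuot.mk k K n) _ 1).trans (by rw [map_one])⟩

theorem WeightQuot.pow_mem_fil {i : ℕ} {b : WeightQuot k K n} (hb : b ∈ WeightQuot.fil k K n i)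
    (r : ℕ) : b ^ r ∈ WeightQuot.fil k K n (i * r) := by
  induction r with
  | zero => exact WeightQuot.mem_fil_zero _
  | succ r ih => rw [pow_succ, mul_add, mul_one]; exact WeightQuot.mul_mem_fil ih hb

theorem WeightQuot.binomPow_sub_one_mem [CharZero k] {i N : ℕ} {b : WeightQuot k K n}
    (hb : b ∈ WeightQuot.fil k K n i) (t : k) :
    binomPow (N + 1) t b - 1 ∈ WeightQuot.fil k K n i := by
  rw [binomPow, Finset.sum_range_succ', binomPoly_zero, Polynomial.eval_one, pow_zero, one_smul,
    add_sub_cancel_right]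
  refine sum_mem fun r _ => Submodule.smul_mem _ _ ?_
  refine WeightQuot.fil_antitone (Nat.le_mul_of_pos_right i r.succ_pos) ?_
  exact WeightQuot.pow_mem_fil hb (r + 1)

variable [K.Normal] {j : ℕ}

/-- Conjugation by an element of the group. -/
def WeightQuot.conj {t : G} (ht : t ∈ lcs G j) : WeightQuot k K n →ₐ[k] WeightQuot k K n :=
  Ideal.Quotient.liftₐ _ ((WeightQuot.mk k K n).comp (conjAlg t)) fun a ha => by
    refine WeightQuot.mk_eq_zero k K n ?_
    have ha' : HasWeight k K (n + 1) a := ha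
    have := ha'.add ((ha'.conj_sub ht).mono (Nat.le_add_right (n + 1) j))
    rwa [add_sub_cancel] at this

theorem WeightQuot.conj_mk {t : G} (ht : t ∈ lcs G j) (a : MonoidAlgebra k K) :
    WeightQuot.conj ht (WeightQuot.mk k K n a) = WeightQuot.mk k K n (conjAlg t a) := rfl

theorem WeightQuot.conj_conj {s t : G} (hs : s ∈ lcs G j) (ht : t ∈ lcs G j)
    (b : WeightQuot k K n) :
    WeightQuot.conj hs (WeightQuot.conj ht b) = WeightQuot.conj (mul_mem hs ht) b := by
  obtain ⟨a, rfl⟩ := WeightQuot.mk_surjective k K n b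
  rw [WeightQuot.conj_mk, WeightQuot.conj_mk, conjAlg_mul, WeightQuot.conj_mk]

theorem WeightQuot.conj_eq_self {t : G} (ht : t ∈ lcs G j) (h : t = 1) (b : WeightQuot k K n) :
    WeightQuot.conj ht b = b := by
  obtain ⟨a, rfl⟩ := WeightQuot.mk_surjective k K n b
  subst h
  rw [WeightQuot.conj_mk, conjAlg_one]

theorem WeightQuot.conj_sub_mem {t : G} (ht : t ∈ lcs G j) {i : ℕ} {b : WeightQuot k K n}
    (hb : b ∈ WeightQuot.fil k K n i) :
    WeightQuot.conj ht b - b ∈ WeightQuot.fil k K n (i + j) := by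
  obtain ⟨a, ha, rfl⟩ := hb
  exact ⟨_, HasWeight.conj_sub ht ha, map_sub (WeightQuot.mk k K n) _ _⟩

/-- For elements of K the conjugation is inner. This will identify the p-th power of the operator of
t with left multiplication by t^p. -/
theorem WeightQuot.conj_of_mem (s : K) (hs : (s : G) ∈ lcs G j) (b : WeightQuot k K n) :
    WeightQuot.conj hs b * WeightQuot.mk k K n (MonoidAlgebra.of k K s) =
      WeightQuot.mk k K n (MonoidAlgebra.of k K s) * b := by
  obtain ⟨a, rfl⟩ := WeightQuot.mk_surjective k K n b
  rw [WeightQuot.conj_mk, ← map_mul, ← map_mul]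
  refine congrArg _ ?_
  induction a using MonoidAlgebra.induction_on with
  | of x =>
    rw [conjAlg_of, ← map_mul, ← map_mul]
    refine congrArg _ (Subtype.ext ?_)
    rw [Subgroup.coe_mul, MulAut.conjNormal_apply, inv_mul_cancel_right, Subgroup.coe_mul]
  | add a b ha hb => rw [map_add, add_mul, mul_add, ha, hb]
  | smul r a ha => rw [map_smul, smul_mul_assoc, mul_smul_comm, ha]

/-- A root of a power of `t` which is in `K`. -/
theorem WeightQuot.exists_root [CharZero k] (hj : 0 < j) {t : G} (ht : t ∈ lcs G j) {p : ℕ}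
    (hp : t ^ p ∈ K) : ∃ u v : WeightQuot k K n, u * v = 1 ∧ v * u = 1 ∧
      WeightQuot.conj ht u = u ∧ u - 1 ∈ WeightQuot.fil k K n j ∧
      v - 1 ∈ WeightQuot.fil k K n j ∧
      u ^ p = WeightQuot.mk k K n (MonoidAlgebra.of k K ⟨t ^ p, hp⟩) := by
  -- The exponent p = 0 stands for the case where no nontrivial power of t is in K; then u = 1
  -- serves.
  rcases Nat.eq_zero_or_pos p with rfl | hp0
  · refine ⟨1, 1, one_mul 1, one_mul 1, map_one _, ?_, ?_, ?_⟩
    · rw [sub_self]; exact zero_mem _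
    · rw [sub_self]; exact zero_mem _
    · have : (⟨t ^ 0, hp⟩ : K) = 1 := Subtype.ext (pow_zero t)
      rw [this, map_one, map_one, pow_zero]
  · let s : K := ⟨t ^ p, hp⟩
    have hs : (s : G) ∈ lcs G j := pow_mem ht p
    let y := WeightQuot.mk k K n (MonoidAlgebra.of k K s) - 1
    have hyj : y ∈ WeightQuot.fil k K n j := WeightQuot.of_sub_one_mem hs
    -- As j is positive, this power has weight at least n + 1, so the binomial series is finite.
    have hy0 : y ^ (n + 1) = 0 := WeightQuot.eq_zero_of_mem_fil
      (WeightQuot.fil_antitone (Nat.le_mul_of_pos_left (n + 1) hj)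
        (WeightQuot.pow_mem_fil hyj (n + 1)))
    refine ⟨binomPow (n + 1) ((p : k)⁻¹) y, binomPow (n + 1) (-(p : k)⁻¹) y, ?_, ?_, ?_,
      WeightQuot.binomPow_sub_one_mem hyj _, WeightQuot.binomPow_sub_one_mem hyj _, ?_⟩
    · rw [← binomPow_add hy0, add_neg_cancel, binomPow_zero hy0]
    · rw [← binomPow_add hy0, neg_add_cancel, binomPow_zero hy0]
    -- t commutes with t^p, so conjugation by t fixes y and every polynomial in y.
    · rw [map_binomPow]
      congr 1
      rw [map_sub, map_one, WeightQuot.conj_mk, conjAlg_of]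
      have : MulAut.conjNormal t s = s := Subtype.ext (by
        rw [MulAut.conjNormal_apply]
        change t * t ^ p * t⁻¹ = t ^ p
        rw [← pow_succ', pow_succ, mul_inv_cancel_right])
      rw [this]
    · rw [binomPow_inv_pow hy0 hp0.ne']
      exact add_sub_cancel _ _

/-- Endomorphisms which increase weights by `w`. -/
def WeightQuot.endFil (w : ℕ) : Submodule k (Module.End k (WeightQuot k K n)) where
  carrier := {X | ∀ i, ∀ b ∈ WeightQuot.fil k K n i, X b ∈ WeightQuot.fil k K n (i + w)}
  zero_mem' _ _ _ := zero_mem _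
  add_mem' hX hY i b hb := add_mem (hX i b hb) (hY i b hb)
  smul_mem' c _ hX i b hb := Submodule.smul_mem _ c (hX i b hb)

theorem WeightQuot.endFil_antitone : Antitone (WeightQuot.endFil (k := k) (K := K) (n := n)) :=
  fun _ _ h _ hX i b hb => WeightQuot.fil_antitone (Nat.add_le_add_left h i) (hX i b hb)

theorem WeightQuot.mul_mem_endFil {v w : ℕ} {X Y : Module.End k (WeightQuot k K n)}
    (hX : X ∈ WeightQuot.endFil v) (hY : Y ∈ WeightQuot.endFil w) :
    X * Y ∈ WeightQuot.endFil (v + w) := fun i b hb => by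
  have := hX _ _ (hY i b hb)
  rwa [add_assoc, add_comm w v] at this

theorem WeightQuot.mul_sub_one_mem_endFil {w : ℕ} {X Y : Module.End k (WeightQuot k K n)}
    (hX : X - 1 ∈ WeightQuot.endFil w) (hY : Y - 1 ∈ WeightQuot.endFil w) :
    X * Y - 1 ∈ WeightQuot.endFil w := by
  have e : X * Y - 1 = (X - 1) * (Y - 1) + ((X - 1) + (Y - 1)) := by
    simp only [mul_sub, sub_mul, one_mul, mul_one]; abel
  rw [e]
  exact add_mem (WeightQuot.endFil_antitone (Nat.le_add_right w w)
    (WeightQuot.mul_mem_endFil hX hY)) (add_mem hX hY)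

/-- Induction step from K to K⟨t⟩. On the truncation of kK, elements of K act by left multiplication
and t acts by b ↦ (t b t⁻¹)u with u^p = t^p, as if t were replaced by its substitute u on the right.
An element of Γ_w acts as the identity up to an increase of weight by w, so elements of weight
greater than n annihilate 1. The extended form is therefore a ↦ f(a · 1). -/
theorem CharactersExtend.sup_zpowers [CharZero k] (hj : 0 < j) (hKn : lcs G n ≤ K)
    (hK1 : lcs G (j + 1) ≤ K) (hK2 : K ≤ lcs G j) {t : G} (ht : t ∈ lcs G j)
    (h : CharactersExtend k K n) : CharactersExtend k (K ⊔ Subgroup.zpowers t) n := by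
  intro χ hχ hχ0
  obtain ⟨f, hf0, hf⟩ := h χ hχ hχ0
  -- p generates the group of exponents m with t^m in K; it is 0 if this group is trivial.
  obtain ⟨p, hp⟩ : ∃ p : ℕ, ∀ m : ℤ, t ^ m ∈ K ↔ (p : ℤ) ∣ m := by
    obtain ⟨a, ha⟩ := Int.subgroup_cyclic (AddSubgroup.comap
      (zmultiplesHom (Additive G) (Additive.ofMul t)) (Subgroup.toAddSubgroup K))
    refine ⟨a.natAbs, fun m => ?_⟩
    rw [Int.natAbs_dvd, ← Int.mem_zmultiples_iff, AddSubgroup.zmultiples_eq_closure, ← ha]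
    exact Iff.rfl
  have htp : t ^ p ∈ K := by
    have := (hp p).2 dvd_rfl
    rwa [zpow_natCast] at this
  obtain ⟨u, v, huv, hvu, hu, hu1, hv1, hup⟩ := WeightQuot.exists_root (k := k) (n := n) hj ht htp
  have ht' : t⁻¹ ∈ lcs G j := inv_mem ht
  let φ := WeightQuot.conj (k := k) (K := K) (n := n) ht
  let ψ := WeightQuot.conj (k := k) (K := K) (n := n) ht'
  have hφψ : ∀ b, φ (ψ b) = b := fun b =>
    (WeightQuot.conj_conj ht ht' b).trans (WeightQuot.conj_eq_self _ (mul_inv_cancel t) b)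
  have hψφ : ∀ b, ψ (φ b) = b := fun b =>
    (WeightQuot.conj_conj ht' ht b).trans (WeightQuot.conj_eq_self _ (inv_mul_cancel t) b)
  -- X is the operator of t, and Y its inverse.
  let X : Module.End k (WeightQuot k K n) := LinearMap.mulRight k u ∘ₗ φ.toLinearMap
  let Y : Module.End k (WeightQuot k K n) := ψ.toLinearMap ∘ₗ LinearMap.mulRight k v
  have hX : ∀ b, X b = φ b * u := fun _ => rfl
  have hY : ∀ b, Y b = ψ (b * v) := fun _ => rfl
  let T : (Module.End k (WeightQuot k K n))ˣ :=
    { val := X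
      inv := Y
      val_inv := LinearMap.ext fun b => by
        rw [Module.End.mul_apply, hX, hY, hφψ, mul_assoc, hvu, mul_one]; rfl
      inv_val := LinearMap.ext fun b => by
        rw [Module.End.mul_apply, hX, hY, mul_assoc, huv, mul_one, hψφ]; rfl }
  let ρ : K →* (Module.End k (WeightQuot k K n))ˣ := MonoidHom.toHomUnits
    (((Algebra.lmul k (WeightQuot k K n)).comp (WeightQuot.mk k K n) :
      MonoidAlgebra k K →* _).comp (MonoidAlgebra.of k K))
  have hρ : ∀ (x : K) b, (ρ x : Module.End k (WeightQuot k K n)) b =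
    WeightQuot.mk k K n (MonoidAlgebra.of k K x) * b := fun _ _ => rfl
  have hT : ∀ x : K, ρ (MulAut.conjNormal t x) = T * ρ x * T⁻¹ := by
    intro x
    rw [eq_mul_inv_iff_mul_eq]
    refine Units.ext (LinearMap.ext fun b => ?_)
    change WeightQuot.mk k K n (MonoidAlgebra.of k K (MulAut.conjNormal t x)) * (φ b * u) =
      φ (WeightQuot.mk k K n (MonoidAlgebra.of k K x) * b) * u
    rw [map_mul, ← mul_assoc, WeightQuot.conj_mk, conjAlg_of]
  have hTi : ∀ (i : ℕ) (b : WeightQuot k K n), (X ^ i) b = WeightQuot.conj (pow_mem ht i) b * u ^ i := by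
    intro i
    induction i with
    | zero =>
      intro b
      rw [WeightQuot.conj_eq_self _ (pow_zero t), pow_zero, pow_zero, mul_one]; rfl
    | succ i ih =>
      intro b
      rw [pow_succ', Module.End.mul_apply, ih, hX, map_mul, map_pow]
      change WeightQuot.conj ht (WeightQuot.conj _ b) * WeightQuot.conj ht u ^ i * u = _
      rw [hu, WeightQuot.conj_conj, mul_assoc, ← pow_succ]
      exact congrArg (· * u ^ (i + 1)) (congrArg (fun g : lcs G j => WeightQuot.conj g.2 b)
        (a₁ := ⟨t * t ^ i, mul_mem ht (pow_mem ht i)⟩) (a₂ := ⟨t ^ (i + 1), pow_mem ht _⟩)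
        (Subtype.ext (pow_succ' t i).symm))
  -- T^p sends b to (t^p b t^(-p))u^p, and u^p = t^p gives t^p b.
  have hTp : T ^ p = ρ ⟨t ^ p, htp⟩ := by
    refine Units.ext (LinearMap.ext fun b => ?_)
    rw [hρ, Units.val_pow_eq_pow_val]
    refine (hTi p b).trans ?_
    rw [hup]
    exact WeightQuot.conj_of_mem ⟨t ^ p, htp⟩ _ b
  have hpow : ∀ (m : ℤ) (hm : t ^ m ∈ K), ρ ⟨t ^ m, hm⟩ = T ^ m := by
    intro m hm
    obtain ⟨l, rfl⟩ := (hp m).1 hm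
    have e : (⟨t ^ ((p : ℤ) * l), hm⟩ : K) = ⟨t ^ p, htp⟩ ^ l := Subtype.ext (by
      rw [Subgroup.coe_zpow]
      change t ^ ((p : ℤ) * l) = (t ^ p) ^ l
      rw [zpow_mul, zpow_natCast])
    rw [e, map_zpow, ← hTp, ← zpow_natCast, zpow_mul]
  obtain ⟨σ, hσ⟩ := exists_hom_sup_zpowers K t ρ T hT hpow
  have hσK : ∀ (x : G) (hx : x ∈ K) (h' : x ∈ K ⊔ Subgroup.zpowers t), σ ⟨x, h'⟩ = ρ ⟨x, hx⟩ := by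
    intro x hx h'
    have e : x * t ^ (0 : ℤ) = x := by rw [zpow_zero, mul_one]
    have h0 : σ ⟨x, h'⟩ = σ ⟨x * t ^ (0 : ℤ), by rwa [e]⟩ := congrArg σ (Subtype.ext e.symm)
    rw [h0, hσ ⟨x, hx⟩ 0, zpow_zero, mul_one]
  let Φ : MonoidAlgebra k (K ⊔ Subgroup.zpowers t : Subgroup G) →ₐ[k]
    Module.End k (WeightQuot k K n) := MonoidAlgebra.lift k _ _ ((Units.coeHom _).comp σ)
  have hΦ : ∀ x, Φ (MonoidAlgebra.of k _ x) = σ x := fun x => MonoidAlgebra.lift_of _ x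
  have hρm : ∀ (w : ℕ) (x : K), (x : G) ∈ lcs G w →
      (ρ x : Module.End k (WeightQuot k K n)) - 1 ∈ WeightQuot.endFil w := by
    intro w x hx i b hb
    have := WeightQuot.mul_mem_fil (WeightQuot.of_sub_one_mem (k := k) (n := n) hx) hb
    rwa [add_comm w i, sub_one_mul] at this
  have hXm : X - 1 ∈ WeightQuot.endFil j := by
    intro i b hb
    have e : (X - 1) b = (φ b - b) * (u - 1) + ((φ b - b) + b * (u - 1)) := by
      rw [LinearMap.sub_apply, hX, Module.End.one_apply]; noncomm_ring
    rw [e]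
    have h1 := WeightQuot.conj_sub_mem ht hb
    refine add_mem ?_ (add_mem h1 (WeightQuot.mul_mem_fil hb hu1))
    exact WeightQuot.fil_antitone (by omega) (WeightQuot.mul_mem_fil h1 hu1)
  have hYm : Y - 1 ∈ WeightQuot.endFil j := by
    intro i b hb
    have hbv := WeightQuot.mul_mem_fil hb hv1
    have hbv' : b * v ∈ WeightQuot.fil k K n i := by
      have := add_mem (WeightQuot.fil_antitone (Nat.le_add_right i j) hbv) hb
      rwa [mul_sub_one, sub_add_cancel] at this
    have e : (Y - 1) b = (ψ (b * v) - b * v) + b * (v - 1) := by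
      rw [LinearMap.sub_apply, hY, Module.End.one_apply]; noncomm_ring
    rw [e]
    exact add_mem (WeightQuot.conj_sub_mem ht' hbv') hbv
  have hTm : ∀ m : ℤ, ((T ^ m : (Module.End k (WeightQuot k K n))ˣ) :
      Module.End k (WeightQuot k K n)) - 1 ∈ WeightQuot.endFil j := by
    intro m
    induction m with
    | zero => rw [zpow_zero, Units.val_one, sub_self]; exact zero_mem _
    | succ m ih =>
      rw [zpow_add_one, Units.val_mul]
      exact WeightQuot.mul_sub_one_mem_endFil ih hXm
    | pred m ih =>
      rw [zpow_sub_one, Units.val_mul]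
      exact WeightQuot.mul_sub_one_mem_endFil ih hYm
  -- If w ≤ j, both factors of x = y t^m raise weights by j. If w > j, then x lies in Γ_(j+1), hence
  -- in K, where the weight w is visible directly.
  have hgen : ∀ (w : ℕ) (x : (K ⊔ Subgroup.zpowers t : Subgroup G)), (x : G) ∈ lcs G w →
      Φ (MonoidAlgebra.of k _ x - 1) ∈ WeightQuot.endFil w := by
    rintro w ⟨x, hx'⟩ hx
    rw [map_sub, map_one, hΦ]
    obtain ⟨y, hy, m, rfl⟩ := (mem_sup_zpowers_iff K t).1 hx'
    rcases le_or_gt w j with hw | hw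
    · rw [hσ ⟨y, hy⟩ m hx', Units.val_mul]
      exact WeightQuot.endFil_antitone hw (WeightQuot.mul_sub_one_mem_endFil
        (hρm j ⟨y, hy⟩ (hK2 hy)) (hTm m))
    · have hxK : y * t ^ m ∈ K := hK1 (lcs_antitone G hw hx)
      rw [hσK _ hxK hx']
      exact hρm w ⟨y * t ^ m, hxK⟩ hx
  have hΦ0 : ∀ a, Φ a ∈ WeightQuot.endFil 0 := by
    intro a
    induction a using MonoidAlgebra.induction_on with
    | of x =>
      have h1 : (1 : Module.End k (WeightQuot k K n)) ∈ WeightQuot.endFil 0 := fun _ _ hb => hb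
      have := add_mem (hgen 0 x (Subgroup.mem_top _)) h1
      rwa [map_sub, map_one, sub_add_cancel] at this
    | add a b ha hb => rw [map_add]; exact add_mem ha hb
    | smul r a ha => rw [map_smul]; exact Submodule.smul_mem _ r ha
  let fb : WeightQuot k K n →ₗ[k] k :=
    (Submodule.liftQ ((weightIdeal k K (n + 1)).restrictScalars k) f hf0) ∘ₗ
      (Submodule.Quotient.restrictScalarsEquiv k (weightIdeal k K (n + 1))).symm.toLinearMap
  have hfb : ∀ a, fb (WeightQuot.mk k K n a) = f a := fun _ => rfl
  have hf' : ∃ f' : MonoidAlgebra k (K ⊔ Subgroup.zpowers t : Subgroup G) →ₗ[k] k,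
      ∀ a, f' a = fb (Φ a 1) :=
    ⟨fb ∘ₗ LinearMap.applyₗ (1 : WeightQuot k K n) ∘ₗ Φ.toLinearMap, fun _ => rfl⟩
  obtain ⟨f', hf'⟩ := hf'
  refine ⟨f', fun a ha => ?_, fun x hx => ?_⟩
  -- The operator of an element of weight n + 1 is applied to 1, which has weight 0.
  · have h1 := ha.map Φ WeightQuot.endFil hΦ0 WeightQuot.mul_mem_endFil
      WeightQuot.endFil_antitone hgen 0 1 (WeightQuot.mem_fil_zero 1)
    have h2 : Φ a 1 = 0 := WeightQuot.eq_zero_of_mem_fil (by rwa [zero_add] at h1)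
    rw [hf', h2, map_zero]
  · obtain ⟨x, hx'⟩ := x
    have hxK : x ∈ K := hKn hx
    have h1 : Φ (MonoidAlgebra.of k _ ⟨x, hx'⟩ - 1) = ρ ⟨x, hxK⟩ - 1 := by
      rw [map_sub, map_one Φ, hΦ, hσK x hxK]
    rw [hf', h1, LinearMap.sub_apply, hρ, mul_one,
      Module.End.one_apply, ← map_one (WeightQuot.mk k K n), ← map_sub, hfb]
    exact hf ⟨x, hxK⟩ hx

end WeightQuotient

/-! ### Finite generation of the graded pieces of G. -/

section FiniteGeneration

variable (G : Type*) [Group G]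

open scoped commutatorElement in
-- Γ_(n+2) is generated by commutators of Γ_(n+1) with G, and products become sums in the quotient.
theorem mk_mem_of_mem_commutator {n : ℕ} (P : AddSubgroup (GrGroup G (n + 2)))
    (h : ∀ a b, GrGroup.bracket G (rfl : n + 1 + 1 = n + 2) a b ∈ P) (c : GrGroup G (n + 2)) :
    c ∈ P := by
  obtain ⟨x, hx, rfl⟩ := GrGroup.mk_surjective c
  have h' : x ∈ Subgroup.closure {g | ∃ g₁ ∈ lcs G (n + 1), ∃ g₂ ∈ (⊤ : Subgroup G),
      ⁅g₁, g₂⁆ = g} := by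
    have := hx
    rwa [lcs_succ, Subgroup.commutator_def] at this
  -- Membership is carried along existentially because the class depends on a proof of it; the same
  -- device recurs in later span and power inductions.
  suffices H : ∃ hx, GrGroup.mk (n := n + 2) x hx ∈ P from H.2
  induction h' using Subgroup.closure_induction with
  | mem x hx' =>
    obtain ⟨g, hg, t, -, rfl⟩ := hx'
    exact ⟨hx, h (GrGroup.mk g hg) (GrGroup.mk t (Subgroup.mem_top t))⟩
  | one => exact ⟨one_mem _, zero_mem P⟩
  | mul x y hx' hy' ihx ihy =>
    have aux : ∀ z, z ∈ Subgroup.closure {g | ∃ g₁ ∈ lcs G (n + 1), ∃ g₂ ∈ (⊤ : Subgroup G),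
        ⁅g₁, g₂⁆ = g} → z ∈ lcs G (n + 2) := fun z hz => by
      rwa [lcs_succ, Subgroup.commutator_def]
    obtain ⟨h1, h2⟩ := ihx (aux x hx')
    obtain ⟨h3, h4⟩ := ihy (aux y hy')
    exact ⟨hx, add_mem h2 h4⟩
  | inv x hx' ihx =>
    obtain ⟨h1, h2⟩ := ihx (inv_mem_iff.1 hx)
    exact ⟨hx, neg_mem h2⟩

/-- The bracket gr_(n+1) ⊗ gr₁ → gr_(n+2) is onto, so finite generation propagates from the
abelianization. -/
theorem grGroup_finite [Group.FG G] (n : ℕ) : Module.Finite ℤ (GrGroup G (n + 1)) := by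
  induction n with
  | zero =>
    have : Group.FG (lcs G 1) := (Group.fg_iff_subgroup_fg _).2 (Group.fg_def.1 ‹_›)
    have : Group.FG (LcsQuotient G 1) := QuotientGroup.fg _
    have : AddGroup.FG (GrGroup G 1) := GroupFG.iff_add_fg.1 this
    exact Module.Finite.iff_addGroup_fg.2 this
  | succ n ih =>
    have h1 : Module.Finite ℤ (GrGroup G 1) := by
      have : Group.FG (lcs G 1) := (Group.fg_iff_subgroup_fg _).2 (Group.fg_def.1 ‹_›)
      have : Group.FG (LcsQuotient G 1) := QuotientGroup.fg _
      exact Module.Finite.iff_addGroup_fg.2 (GroupFG.iff_add_fg.1 this)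
    let β : GrGroup G (n + 1) →ₗ[ℤ] GrGroup G 1 →ₗ[ℤ] GrGroup G (n + 2) :=
      AddMonoidHom.toIntLinearMap (AddMonoidHom.mk' (fun a =>
        AddMonoidHom.toIntLinearMap (GrGroup.bracket G rfl a)) fun a b => by
          rw [map_add]; rfl)
    have hβ : Function.Surjective (TensorProduct.lift β) := fun c =>
      mk_mem_of_mem_commutator G (LinearMap.range (TensorProduct.lift β)).toAddSubgroup
        (fun a b => ⟨a ⊗ₜ b, rfl⟩) c
    exact Module.Finite.of_surjective _ hβ

/-- S consists of representatives of generators of the abelian group Γ_(n+1)/Γ_(n+2). -/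
theorem exists_finset_lcs [Group.FG G] (n : ℕ) : ∃ S : Finset G, (∀ s ∈ S, s ∈ lcs G (n + 1)) ∧
    lcs G (n + 1) ≤ lcs G (n + 2) ⊔ Subgroup.closure S := by
  classical
  obtain ⟨T, hT⟩ := (Module.finite_def.1 (grGroup_finite G n))
  choose f hf hfT using GrGroup.mk_surjective (G := G) (n := n + 1)
  refine ⟨T.image f, fun s hs => ?_, fun g hg => ?_⟩
  · obtain ⟨t, -, rfl⟩ := Finset.mem_image.1 hs
    exact hf t
  · have key : ∀ c ∈ Submodule.span ℤ (T : Set (GrGroup G (n + 1))),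
        ∃ z ∈ Subgroup.closure ((T.image f : Finset G) : Set G), ∃ hz, GrGroup.mk z hz = c := by
      intro c hc
      induction hc using Submodule.span_induction with
      | mem t ht =>
        exact ⟨f t, Subgroup.subset_closure (Finset.mem_coe.2 (Finset.mem_image_of_mem f ht)),
          hf t, hfT t⟩
      | zero => exact ⟨1, one_mem _, one_mem _, rfl⟩
      | add c d _ _ hc hd =>
        obtain ⟨z, h1, h2, rfl⟩ := hc
        obtain ⟨w, h3, h4, rfl⟩ := hd
        exact ⟨z * w, mul_mem h1 h3, mul_mem h2 h4, rfl⟩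
      | smul m c _ hc =>
        obtain ⟨z, h1, h2, rfl⟩ := hc
        exact ⟨z ^ m, zpow_mem h1 m, zpow_mem h2 m, rfl⟩
    obtain ⟨z, h1, h2, h3⟩ := key (GrGroup.mk g hg) (hT ▸ Submodule.mem_top)
    have h4 := GrGroup.mk_eq_iff.1 h3
    have h5 := GrGroup.mk_eq_iff.1 h3.symm
    have : g = (z * (z⁻¹ * g) * z⁻¹) * z := by group
    rw [this]
    exact mul_mem (Subgroup.mem_sup_left (conj_mem_lcs z h4)) (Subgroup.mem_sup_right h1)

end FiniteGeneration

/-! ### Injectivity of Quillen's map. -/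

section Quillen

variable (k G : Type*) [Field k] [CharZero k] [Group G] [Group.FG G]

open scoped commutatorElement in
-- Descending induction from Γₙ: the step from Γ_(j+1) to Γ_j adjoins finitely many representatives
-- of generators, one at a time.
theorem charactersExtend {n j : ℕ} (hj : 0 < j) (hjn : j ≤ n) : CharactersExtend k (lcs G j) n := by
  classical
  obtain ⟨d, rfl⟩ := Nat.exists_eq_add_of_le hjn
  induction d generalizing j with
  | zero => exact charactersExtend_lcs k j
  | succ d ih =>
    have h0 : CharactersExtend k (lcs G (j + 1)) (j + (d + 1)) := by
      have := ih (j := j + 1) (by omega) (by omega)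
      rwa [show j + 1 + d = j + (d + 1) by omega] at this
    obtain ⟨S, hS, hle⟩ : ∃ S : Finset G, (∀ s ∈ S, s ∈ lcs G j) ∧
        lcs G j ≤ lcs G (j + 1) ⊔ Subgroup.closure S := by
      obtain ⟨i, rfl⟩ : ∃ i, j = i + 1 := ⟨j - 1, by omega⟩
      exact exists_finset_lcs G i
    have key : ∀ T : Finset G, (∀ s ∈ T, s ∈ lcs G j) →
        CharactersExtend k (lcs G (j + 1) ⊔ Subgroup.closure T) (j + (d + 1)) := by
      intro T
      induction T using Finset.induction_on with
      | empty =>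
        intro _
        rwa [Finset.coe_empty, Subgroup.closure_empty, sup_bot_eq]
      | insert t T _ ihT =>
        intro hT
        have hT' := ihT fun s hs => hT s (Finset.mem_insert_of_mem hs)
        have h2 : lcs G (j + 1) ⊔ Subgroup.closure T ≤ lcs G j :=
          sup_le (lcs_antitone G (Nat.le_succ j)) ((Subgroup.closure_le _).2 fun s hs =>
            hT s (Finset.mem_insert_of_mem hs))
        -- Any subgroup between Γ_(j+1) and Γ_j is normal, since [g, x] lies in Γ_(j+1) for x in
        -- Γ_j.
        have hN : (lcs G (j + 1) ⊔ Subgroup.closure T).Normal := ⟨fun x hx g => by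
          have e : g * x * g⁻¹ = ⁅g, x⁆ * x := by rw [commutatorElement_def]; group
          rw [e]
          refine mul_mem (Subgroup.mem_sup_left ?_) hx
          exact commutator_mem_lcs (i := 1) (add_comm 1 j) (Subgroup.mem_top g) (h2 hx)⟩
        have := hT'.sup_zpowers hj
          ((lcs_antitone G (by omega : j + 1 ≤ j + (d + 1))).trans le_sup_left)
          le_sup_left h2 (hT t (Finset.mem_insert_self t T))
        rwa [sup_assoc, Subgroup.zpowers_eq_closure, ← Subgroup.closure_union, Set.union_singleton,
          ← Finset.coe_insert] at this
    have := key S hS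
    rwa [le_antisymm (sup_le (lcs_antitone G (Nat.le_succ j)) ((Subgroup.closure_le _).2 hS)) hle]
      at this

/-- The case Γ₁ = G of the extension of characters: I^m consists of elements of weight at least m,
so the form vanishes on I^(n+2) and descends to the graded piece of degree n + 1. -/
theorem exists_linear_of_character {n : ℕ} (χ : GrGroup G (n + 1) →+ k) :
    ∃ f : Gr k (augIdeal k G) (n + 1) →ₗ[k] k,
      ∀ a, f (quillenGroup k G (n + 1) a) = χ a := by
  classical
  obtain ⟨f, hf0, hf⟩ := charactersExtend k G (n := n + 1) (j := 1) one_pos (by omega)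
    -- `CharactersExtend` takes functions on all of G; the values outside Γ_(n+1) play no role and
    -- are set to 0.
    (fun x => if hx : x ∈ lcs G (n + 1) then χ (GrGroup.mk x hx) else 0)
    (fun x hx y hy => by
      rw [dif_pos hx, dif_pos hy, dif_pos (mul_mem hx hy), GrGroup.mk_mul hx hy, map_add])
    (fun x hx => by
      have hx' := lcs_antitone G (Nat.le_succ (n + 1)) hx
      rw [dif_pos hx']
      have : GrGroup.mk x hx' = 0 := by
        rw [← GrGroup.mk_one, GrGroup.mk_eq_iff, mul_one]
        exact inv_mem hx
      rw [this, map_zero])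
  let ι : MonoidAlgebra k G →ₐ[k] MonoidAlgebra k (lcs G 1) :=
    MonoidAlgebra.lift k _ G
      ((MonoidAlgebra.of k (lcs G 1)).comp (Subgroup.topEquiv (G := G)).symm.toMonoidHom)
  have hι : ∀ g, ι (MonoidAlgebra.of k G g) =
      MonoidAlgebra.of k (lcs G 1) ⟨g, Subgroup.mem_top g⟩ := fun g =>
    MonoidAlgebra.lift_of _ g
  have hw : ∀ m, ∀ a ∈ pow k (augIdeal k G) m, HasWeight k (lcs G 1) m (ι a) := by
    intro m a ha
    refine pow_induction k (augIdeal k G) (P := fun m a => HasWeight k (lcs G 1) m (ι a))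
      (fun a => .weight_zero _) (fun n a _ b _ h1 h2 => by rw [map_add]; exact h1.add h2)
      (fun n a _ b hb h1 => ?_) ha
    rw [map_mul]
    refine h1.mul ?_
    have hle : Submodule.span k (Set.range fun g : G => MonoidAlgebra.of k G g - 1) ≤
        ((weightIdeal k (lcs G 1) 1).restrictScalars k).comap ι.toLinearMap := by
      refine Submodule.span_le.2 ?_
      rintro _ ⟨g, rfl⟩
      change HasWeight k _ 1 (ι (MonoidAlgebra.of k G g - 1))
      rw [map_sub, map_one, hι]
      exact .sub_one 1 _ (Subgroup.mem_top g)
    exact hle (augIdeal_eq_span k G hb)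
  refine ⟨Submodule.liftQ _ (f ∘ₗ ι.toLinearMap ∘ₗ (pow k (augIdeal k G) (n + 1)).subtype)
    fun a ha => hf0 _ (hw _ _ ha), fun a => ?_⟩
  obtain ⟨g, hg, rfl⟩ := GrGroup.mk_surjective a
  rw [quillenGroup_mk]
  change f (ι (MonoidAlgebra.of k G g - 1)) = _
  rw [map_sub, map_one, hι, hf _ hg, dif_pos hg]

/-- Every linear form on grₙ(G) ⊗ k factors through Quillen's map, so an element of the kernel is
killed by all linear forms. In degree 0 the source is zero, as Γ₀ = Γ₁. -/
theorem quillenPiece_injective (n : ℕ) : Function.Injective (quillenPiece k G n) := by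
  rcases n with _ | n
  · intro x y _
    have h0 : ∀ x : GrLiePiece k G 0, x = 0 := fun x => by
      induction x using TensorProduct.induction_on with
      | zero => rfl
      | add x y hx hy => rw [hx, hy, add_zero]
      | tmul c a =>
        obtain ⟨g, hg, rfl⟩ := GrGroup.mk_surjective a
        have : GrGroup.mk g hg = 0 := by
          rw [← GrGroup.mk_one, GrGroup.mk_eq_iff]
          exact Subgroup.mem_top _
        rw [this, TensorProduct.tmul_zero]
    rw [h0 x, h0 y]
  · refine (injective_iff_map_eq_zero _).2 fun x hx => ?_
    rw [← Module.forall_dual_apply_eq_zero_iff k]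
    intro φ
    let χ : GrGroup G (n + 1) →+ k := AddMonoidHom.mk' (fun a => φ (1 ⊗ₜ a)) fun a b => by
      rw [TensorProduct.tmul_add, map_add]
    obtain ⟨f, hf⟩ := exists_linear_of_character k G χ
    have : φ = f ∘ₗ quillenPiece k G (n + 1) := by
      refine LinearMap.ext fun x => ?_
      induction x using TensorProduct.induction_on with
      | zero => rw [map_zero, map_zero]
      | add x y hx hy => rw [map_add, map_add, hx, hy]
      | tmul c a =>
        rw [LinearMap.comp_apply, quillenPiece_tmul, map_smul, hf]
        change φ (c ⊗ₜ a) = c • φ (1 ⊗ₜ a)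
        rw [← map_smul, TensorProduct.smul_tmul', smul_eq_mul, mul_one]
    rw [this, LinearMap.comp_apply, hx, map_zero]


end Quillen

/-! ### Leading terms of elements of the completion. -/

section Symbols

variable (k : Type*) {A : Type*} [Field k] [Ring A] [Algebra k A] (I : Ideal A) [I.IsTwoSided]

theorem GrHat.one_zero : (1 : GrHat k I) 0 = Gr.mk k I 0 ⟨1, one_mem_pow_zero k I⟩ :=
  Pi.single_eq_same (M := fun n => Gr k I n) 0 _

theorem GrHat.one_of_pos {n : ℕ} (h : 0 < n) : (1 : GrHat k I) n = 0 :=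
  Pi.single_eq_of_ne (M := fun n => Gr k I n) h.ne' _

/-- The element `x` of the completion is in the `n`-th term of the filtration, and its class in the
`n`-th graded piece is `s`. -/
def HasSymbol (n : ℕ) (x : Completion k I) (s : Gr k I n) : Prop :=
  Completion.proj k I (n + 1) x = Gr.incl k I n s

variable {k I} {n : ℕ} {x y : Completion k I} {s t : Gr k I n}

theorem HasSymbol.add (hx : HasSymbol k I n x s) (hy : HasSymbol k I n y t) :
    HasSymbol k I n (x + y) (s + t) := by
  rw [HasSymbol, map_add, map_add, show Completion.proj k I (n + 1) x = _ from hx,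
    show Completion.proj k I (n + 1) y = _ from hy]

theorem HasSymbol.sub (hx : HasSymbol k I n x s) (hy : HasSymbol k I n y t) :
    HasSymbol k I n (x - y) (s - t) := by
  rw [HasSymbol, map_sub, map_sub, show Completion.proj k I (n + 1) x = _ from hx,
    show Completion.proj k I (n + 1) y = _ from hy]

theorem HasSymbol.smul (c : k) (hx : HasSymbol k I n x s) : HasSymbol k I n (c • x) (c • s) := by
  rw [HasSymbol, map_smul, map_smul, show Completion.proj k I (n + 1) x = _ from hx]

theorem HasSymbol.zero : HasSymbol k I n 0 0 := by
  rw [HasSymbol, map_zero, map_zero]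

theorem HasSymbol.sum {ι : Type*} (S : Finset ι) {f : ι → Completion k I} {g : ι → Gr k I n}
    (h : ∀ i ∈ S, HasSymbol k I n (f i) (g i)) :
    HasSymbol k I n (∑ i ∈ S, f i) (∑ i ∈ S, g i) := by
  rw [HasSymbol, map_sum, map_sum]
  exact Finset.sum_congr rfl h

theorem hasSymbol_mk {a : A} (ha : a ∈ pow k I n)
    (h : x - toCompletion k I a ∈ Completion.filtration k I (n + 1)) :
    HasSymbol k I n x (Gr.mk k I n ⟨a, ha⟩) := by
  rw [Completion.mem_filtration, map_sub, sub_eq_zero] at h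
  exact h

theorem HasSymbol.sub_mem {a : A} {ha : a ∈ pow k I n}
    (h : HasSymbol k I n x (Gr.mk k I n ⟨a, ha⟩)) :
    x - toCompletion k I a ∈ Completion.filtration k I (n + 1) := by
  rw [Completion.mem_filtration, map_sub, sub_eq_zero]
  exact h

theorem HasSymbol.mem (h : HasSymbol k I n x s) : x ∈ Completion.filtration k I n := by
  obtain ⟨⟨a, ha⟩, rfl⟩ := Submodule.mkQ_surjective _ s
  have := add_mem (Completion.filtration_antitone k I (Nat.le_succ n) h.sub_mem)
    ((Completion.toCompletion_mem k I).2 ha)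
  rwa [sub_add_cancel] at this

theorem exists_hasSymbol (hx : x ∈ Completion.filtration k I n) : ∃ s, HasSymbol k I n x s := by
  obtain ⟨a, ha⟩ := Completion.exists_toCompletion k I (n + 1) x
  have h := sub_mem hx (Completion.filtration_antitone k I (Nat.le_succ n) ha)
  rw [sub_sub_cancel] at h
  exact ⟨_, hasSymbol_mk ((Completion.toCompletion_mem k I).1 h) ha⟩

theorem hasSymbol_zero_iff : HasSymbol k I n x 0 ↔ x ∈ Completion.filtration k I (n + 1) := by
  rw [HasSymbol, map_zero]; rfl

theorem HasSymbol.mul {i j n : ℕ} (h : i + j = n) {s : Gr k I i} {t : Gr k I j}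
    (hx : HasSymbol k I i x s) (hy : HasSymbol k I j y t) :
    HasSymbol k I n (x * y) (Gr.mul k I h s t) := by
  obtain ⟨⟨a, ha⟩, rfl⟩ := Submodule.mkQ_surjective _ s
  obtain ⟨⟨b, hb⟩, rfl⟩ := Submodule.mkQ_surjective _ t
  have e : x * y - toCompletion k I (a * b) =
      (x - toCompletion k I a) * y + toCompletion k I a * (y - toCompletion k I b) := by
    rw [map_mul]; noncomm_ring
  have h1 := Completion.mul_mem_filtration k I hx.sub_mem hy.mem
  have h2 := Completion.mul_mem_filtration k I ((Completion.toCompletion_mem k I).2 ha) hy.sub_mem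
  refine hasSymbol_mk _ ?_
  change x * y - toCompletion k I (a * b) ∈ _
  rw [e]
  refine add_mem ?_ ?_
  · rwa [show i + 1 + j = n + 1 by omega] at h1
  · rwa [show i + (j + 1) = n + 1 by omega] at h2

end Symbols

/-! ### Homogeneous elements of the completed graded Lie algebra. -/

section SingleDegree

variable (k G : Type*) [Field k] [Group G]

variable {k G} in
theorem grComul_apply (x : GrGroupAlgebraHat k G) {i j n : ℕ} (h : i + j = n) :
    grComul k G x i j = grComulComponent k G h (x n) := by
  subst h; rfl

theorem GrLieHat.bracket_mem {m n : ℕ} {x y : GrLieHat k G}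
    (hx : x ∈ GrLieHat.filtration k G m) (hy : y ∈ GrLieHat.filtration k G n) :
    ⁅x, y⁆ ∈ GrLieHat.filtration k G (m + n) := fun l hl =>
  Finset.sum_eq_zero fun p _ => by
    have hp := Finset.HasAntidiagonal.mem_antidiagonal.1 p.2
    rcases lt_or_ge p.1.1 m with h | h
    · rw [hx _ h, map_zero, LinearMap.zero_apply]
    · rw [hy _ (by omega), map_zero]

/-- The element of the completed Lie algebra which is concentrated in degree `n`. -/
def GrLieHat.single (n : ℕ) (z : GrLiePiece k G n) : GrLieHat k G :=
  Pi.single (M := fun n => GrLiePiece k G n) n z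

theorem GrLieHat.single_same (n : ℕ) (z : GrLiePiece k G n) : GrLieHat.single k G n z n = z :=
  Pi.single_eq_same (M := fun n => GrLiePiece k G n) n z

theorem GrLieHat.single_of_ne {n m : ℕ} (h : m ≠ n) (z : GrLiePiece k G n) :
    GrLieHat.single k G n z m = 0 := Pi.single_eq_of_ne (M := fun n => GrLiePiece k G n) h z

theorem GrLieHat.single_mem (n : ℕ) (z : GrLiePiece k G n) :
    GrLieHat.single k G n z ∈ GrLieHat.filtration k G n := fun _ hj =>
  GrLieHat.single_of_ne k G hj.ne z

theorem GrLieHat.bracket_single {i j n : ℕ} (h : i + j = n) (u : GrLiePiece k G i)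
    (v : GrLiePiece k G j) :
    ⁅GrLieHat.single k G i u, GrLieHat.single k G j v⁆ n = GrLiePiece.bracket k G h u v := by
  rw [GrLieHat.bracket_apply k G _ _ le_rfl, Finset.sum_eq_single i, Finset.sum_eq_single j,
    GrLieHat.single_same, GrLieHat.single_same, GrLiePiece.br_of_eq k G h]
  · intro l _ hl
    rw [GrLieHat.single_of_ne k G hl, map_zero]
  · intro hl; exact absurd (Finset.mem_range.2 (by omega)) hl
  · intro l _ hl
    refine Finset.sum_eq_zero fun m _ => ?_
    rw [GrLieHat.single_of_ne k G hl, map_zero, LinearMap.zero_apply]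
  · intro hl; exact absurd (Finset.mem_range.2 (by omega)) hl

end SingleDegree

/-! ### Primitive elements in the graded and in the completed group algebra. -/

section Primitives

variable (k G : Type*) [Field k] [CharZero k] [Group G]

theorem mk_mem_range_quillenPiece_one {x : MonoidAlgebra k G} (hx : x ∈ pow k (augIdeal k G) 1) :
    Gr.mk k _ 1 ⟨x, hx⟩ ∈ LinearMap.range (quillenPiece k G 1) := by
  have h1 := augIdeal_eq_span k G ((mem_pow_one k _).1 hx)
  suffices H : ∃ hx, Gr.mk k (augIdeal k G) 1 ⟨x, hx⟩ ∈ LinearMap.range (quillenPiece k G 1) from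
    H.2
  clear hx
  induction h1 using Submodule.span_induction with
  | mem x hx =>
    obtain ⟨g, rfl⟩ := hx
    refine ⟨sub_one_mem_pow k (n := 1) (Subgroup.mem_top g),
      1 ⊗ₜ GrGroup.mk g (Subgroup.mem_top g), ?_⟩
    rw [quillenPiece_tmul, one_smul]
    rfl
  | zero => exact ⟨zero_mem _, zero_mem _⟩
  | add x y _ _ hx hy =>
    obtain ⟨h1, h2⟩ := hx
    obtain ⟨h3, h4⟩ := hy
    exact ⟨add_mem h1 h3, add_mem h2 h4⟩
  | smul c x _ hx =>
    obtain ⟨h1, h2⟩ := hx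
    exact ⟨Submodule.smul_mem _ c h1, Submodule.smul_mem _ c h2⟩

/-- The range of Quillen's map contains all classes of degree one and is closed under brackets with
them, so the Dynkin argument applies. -/
theorem mk_mem_range_quillenPiece {n : ℕ} (hn : 0 < n) {a : MonoidAlgebra k G}
    (ha : a ∈ pow k (augIdeal k G) n)
    (hprim : ∀ i j (h : i + j = n), 0 < i → 0 < j →
      grComulComponent k G h (Gr.mk k _ n ⟨a, ha⟩) = 0) :
    Gr.mk k _ n ⟨a, ha⟩ ∈ LinearMap.range (quillenPiece k G n) := by
  refine (groupHopf k G).mk_mem_of_primitive (fun n => LinearMap.range (quillenPiece k G n))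
    (fun x hx => mk_mem_range_quillenPiece_one k G hx) ?_ hn ha hprim
  rintro n - _ ⟨w, rfl⟩ x hx
  obtain ⟨v, hv⟩ := mk_mem_range_quillenPiece_one k G hx
  rw [← hv]
  exact ⟨GrLiePiece.bracket k G rfl w v, quillenPiece_bracket k G _ _ _ _⟩

theorem grTensorProj_comul_of_sub_one {i j n : ℕ} (hn : 0 < n) (h : i + j = n) {g : G}
    (hg : g ∈ lcs G n) :
    grComulComponent k G h (quillenGroup k G n (GrGroup.mk g hg)) =
      grTensorProj k _ h ⟨_, tmul_mem_tensorPow k _ (add_zero n) (sub_one_mem_pow k hg)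
        (one_mem_pow_zero k _)⟩ +
      grTensorProj k _ h ⟨_, tmul_mem_tensorPow k _ (zero_add n) (one_mem_pow_zero k _)
        (sub_one_mem_pow k hg)⟩ := by
  have hg' := sub_one_mem_pow k hg
  rw [quillenGroup_mk, ← map_add, ← sub_eq_zero]
  change grTensorProj k _ h ⟨_, comul_mem k G hg'⟩ - _ = 0
  rw [← map_sub]
  refine grTensorProj_eq_zero k _ h _ ?_
  have := tmul_mem_tensorPow k (augIdeal k G) rfl hg' hg'
  change Bialgebra.comulAlgHom k (MonoidAlgebra k G) (MonoidAlgebra.of k G g - 1) -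
    ((MonoidAlgebra.of k G g - 1) ⊗ₜ[k] 1 + 1 ⊗ₜ[k] (MonoidAlgebra.of k G g - 1)) ∈ _
  rw [comul_of_sub_one, add_sub_cancel_left]
  exact tensorPow_antitone k _ (by omega) this

theorem grComulComponent_quillenPiece {i j n : ℕ} (h : i + j = n) (hi : 0 < i) (hj : 0 < j)
    (z : GrLiePiece k G n) : grComulComponent k G h (quillenPiece k G n z) = 0 := by
  induction z using TensorProduct.induction_on with
  | zero => rw [map_zero, map_zero]
  | add x y hx hy => rw [map_add, map_add, hx, hy, add_zero]
  | tmul c a =>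
    obtain ⟨g, hg, rfl⟩ := GrGroup.mk_surjective a
    rw [quillenPiece_tmul, map_smul, grTensorProj_comul_of_sub_one k G (by omega) h hg,
      grTensorProj_tmul_of_ne k _ h (add_zero n) (by omega) ⟨_, sub_one_mem_pow k hg⟩
        ⟨1, one_mem_pow_zero k _⟩,
      grTensorProj_tmul_of_ne k _ h (zero_add n) (by omega) ⟨1, one_mem_pow_zero k _⟩
        ⟨_, sub_one_mem_pow k hg⟩, add_zero, smul_zero]

theorem grComulComponent_quillenPiece_left {n : ℕ} (hn : 0 < n) (z : GrLiePiece k G n) :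
    grComulComponent k G (add_zero n) (quillenPiece k G n z) =
      quillenPiece k G n z ⊗ₜ Gr.mk k _ 0 ⟨1, one_mem_pow_zero k _⟩ := by
  induction z using TensorProduct.induction_on with
  | zero => rw [map_zero, map_zero, TensorProduct.zero_tmul]
  | add x y hx hy => rw [map_add, map_add, hx, hy, TensorProduct.add_tmul]
  | tmul c a =>
    obtain ⟨g, hg, rfl⟩ := GrGroup.mk_surjective a
    rw [quillenPiece_tmul, map_smul, grTensorProj_comul_of_sub_one k G hn (add_zero n) hg,
      grTensorProj_tmul k _ (add_zero n) ⟨_, sub_one_mem_pow k hg⟩ ⟨1, one_mem_pow_zero k _⟩,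
      grTensorProj_tmul_of_ne k _ (add_zero n) (zero_add n) hn.ne' ⟨1, one_mem_pow_zero k _⟩
        ⟨_, sub_one_mem_pow k hg⟩, add_zero, TensorProduct.smul_tmul']
    rfl

theorem grComulComponent_quillenPiece_right {n : ℕ} (hn : 0 < n) (z : GrLiePiece k G n) :
    grComulComponent k G (zero_add n) (quillenPiece k G n z) =
      Gr.mk k _ 0 ⟨1, one_mem_pow_zero k _⟩ ⊗ₜ quillenPiece k G n z := by
  induction z using TensorProduct.induction_on with
  | zero => rw [map_zero, map_zero, TensorProduct.tmul_zero]
  | add x y hx hy => rw [map_add, map_add, hx, hy, TensorProduct.tmul_add]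
  | tmul c a =>
    obtain ⟨g, hg, rfl⟩ := GrGroup.mk_surjective a
    rw [quillenPiece_tmul, map_smul, grTensorProj_comul_of_sub_one k G hn (zero_add n) hg,
      grTensorProj_tmul k _ (zero_add n) ⟨1, one_mem_pow_zero k _⟩ ⟨_, sub_one_mem_pow k hg⟩,
      grTensorProj_tmul_of_ne k _ (zero_add n) (add_zero n) hn.ne ⟨_, sub_one_mem_pow k hg⟩
        ⟨1, one_mem_pow_zero k _⟩]
    refine (congrArg (c • ·) (zero_add _)).trans ?_
    rw [TensorProduct.tmul_smul]
    rfl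

theorem quillenHat_mem_grPrimitives (x : GrLieHat k G) : quillenHat k G x ∈ grPrimitives k G := by
  funext i j
  change grComul k G (quillenHat k G x) i j = quillenPiece k G i (x i) ⊗ₜ (1 : GrHat k _) j +
    (1 : GrHat k _) i ⊗ₜ quillenPiece k G j (x j)
  rcases Nat.eq_zero_or_pos i with rfl | hi
  · rcases Nat.eq_zero_or_pos j with rfl | hj
    · rw [grComul_apply _ (add_zero 0), show quillenHat k G x 0 = quillenPiece k G 0 (x 0) from rfl,
        quillenPiece_zero, map_zero, TensorProduct.zero_tmul, TensorProduct.tmul_zero, add_zero]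
    · rw [grComul_apply _ (zero_add j), show quillenHat k G x j = quillenPiece k G j (x j) from rfl,
        quillenPiece_zero, grComulComponent_quillenPiece_right k G hj, GrHat.one_zero,
        TensorProduct.zero_tmul]
      exact (zero_add _).symm
  · rcases Nat.eq_zero_or_pos j with rfl | hj
    · rw [grComul_apply _ (add_zero i), show quillenHat k G x i = quillenPiece k G i (x i) from rfl,
        quillenPiece_zero, grComulComponent_quillenPiece_left k G hi, GrHat.one_zero,
        TensorProduct.tmul_zero, add_zero]
    · rw [grComul_apply _ rfl, show quillenHat k G x (i + j) = quillenPiece k G (i + j) (x (i + j))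
        from rfl, grComulComponent_quillenPiece k G rfl hi hj, GrHat.one_of_pos k _ hi,
        GrHat.one_of_pos k _ hj, TensorProduct.tmul_zero, TensorProduct.zero_tmul, add_zero]

/-- In degree 0, x is a scalar c, and applying ε ⊗ ε to the primitivity relation gives c = 2c. -/
theorem grPrimitives_zero {x : GrGroupAlgebraHat k G} (hx : x ∈ grPrimitives k G) : x 0 = 0 := by
  obtain ⟨⟨a, ha⟩, hxa⟩ := Submodule.mkQ_surjective _ (x 0)
  let c : k := (groupHopf k G).counit a
  let e : Gr k (augIdeal k G) 0 := Gr.mk k _ 0 ⟨1, one_mem_pow_zero k _⟩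
  have hc : x 0 = c • e := by
    rw [← hxa, ← map_smul]
    refine Gr.mk_eq_mk k _ ?_
    have := (mem_pow_one k _).2 ((groupHopf k G).sub_counit_mem a)
    rwa [Algebra.algebraMap_eq_smul_one] at this
  have h1 : grComulComponent k G (add_zero 0) (x 0) = x 0 ⊗ₜ e + e ⊗ₜ x 0 := by
    have := congrFun (congrFun hx 0) 0
    rw [grComul_apply x (add_zero 0)] at this
    refine this.trans ?_
    change x 0 ⊗ₜ (1 : GrHat k _) 0 + (1 : GrHat k _) 0 ⊗ₜ x 0 = _
    rw [GrHat.one_zero]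
  have h2 : grComulComponent k G (add_zero 0) e = e ⊗ₜ e := by
    refine Eq.trans ?_ (grTensorProj_tmul k _ (add_zero 0) ⟨1, one_mem_pow_zero k _⟩
      ⟨1, one_mem_pow_zero k _⟩)
    exact congrArg (grTensorProj k _ (add_zero 0)) (Subtype.ext
      (map_one (Bialgebra.comulAlgHom k (MonoidAlgebra k G))))
  let ε : Gr k (augIdeal k G) 0 →ₗ[k] k := Submodule.liftQ _
    ((groupHopf k G).counit.toLinearMap ∘ₗ (pow k (augIdeal k G) 0).subtype) fun a ha =>
      (groupHopf k G).counit_eq_zero one_pos ha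
  have hε : ε e = 1 := map_one (groupHopf k G).counit
  have h3 := congrArg (TensorProduct.lift (LinearMap.mul k k) ∘ₗ TensorProduct.map ε ε) h1
  rw [hc, map_smul, h2] at h3
  simp only [LinearMap.comp_apply, map_smul, map_add, TensorProduct.map_tmul, TensorProduct.lift.tmul,
    hε, LinearMap.mul_apply', smul_eq_mul, mul_one, one_mul] at h3
  have hc0 : c = 0 := by linear_combination -h3
  rw [hc, hc0, zero_smul]

theorem range_quillenHat : Set.range (quillenHat k G) = grPrimitives k G := by
  refine Set.Subset.antisymm ?_ fun x hx => ?_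
  · rintro _ ⟨x, rfl⟩
    exact quillenHat_mem_grPrimitives k G x
  · have h : ∀ n, ∃ z, quillenPiece k G n z = x n := by
      intro n
      rcases Nat.eq_zero_or_pos n with rfl | hn
      · exact ⟨0, by rw [map_zero, grPrimitives_zero k G hx]⟩
      · obtain ⟨⟨a, ha⟩, hxa⟩ := Submodule.mkQ_surjective _ (x n)
        rw [← hxa]
        -- Only bidegrees with both entries positive are needed, and there x ⊗ 1 + 1 ⊗ x has no
        -- component.
        refine mk_mem_range_quillenPiece k G hn ha fun i j h hi hj => ?_
        have := congrFun (congrFun hx i) j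
        rw [grComul_apply x h, ← hxa] at this
        refine this.trans ?_
        change x i ⊗ₜ (1 : GrHat k _) j + (1 : GrHat k _) i ⊗ₜ x j = _
        rw [GrHat.one_of_pos k _ hi, GrHat.one_of_pos k _ hj, TensorProduct.tmul_zero,
          TensorProduct.zero_tmul, add_zero]
    choose z hz using h
    exact ⟨z, funext hz⟩

theorem quillenHat_injective [Group.FG G] : Function.Injective (quillenHat k G) := fun _ _ h =>
  funext fun n => quillenPiece_injective k G n (congrFun h n)

/-- The symbol of an element of the Malcev Lie algebra. -/
theorem exists_symbol_malcev {n : ℕ} (hn : 0 < n) {y : malcev k G}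
    (hy : (y : GroupAlgebraHat k G) ∈ Completion.filtration k (augIdeal k G) n) :
    ∃ z, HasSymbol k (augIdeal k G) n (y : GroupAlgebraHat k G) (quillenPiece k G n z) := by
  obtain ⟨s, hs⟩ := exists_hasSymbol hy
  obtain ⟨⟨a, ha⟩, rfl⟩ := Submodule.mkQ_surjective _ s
  obtain ⟨z, hz⟩ : Gr.mk k _ n ⟨a, ha⟩ ∈ LinearMap.range (quillenPiece k G n) := by
    refine mk_mem_range_quillenPiece k G hn ha fun i j h hi hj => ?_
    refine Gr.incl_tensor_injective k _ i j ((incl_grTensorProj k _ h _).trans ?_)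
    rw [map_zero]
    change Algebra.TensorProduct.map _ _ (Bialgebra.comulAlgHom k (MonoidAlgebra k G) a) = 0
    -- Precision 2n is what the comultiplication at level n requires; b still has the leading term
    -- of a.
    obtain ⟨b, hb⟩ := Completion.exists_toCompletion k (augIdeal k G) (2 * n)
      (y : GroupAlgebraHat k G)
    have hba : b - a ∈ pow k (augIdeal k G) (n + 1) := by
      rw [← Completion.toCompletion_mem k, map_sub]
      have := sub_mem hs.sub_mem (Completion.filtration_antitone k (augIdeal k G)
        (by omega : n + 1 ≤ 2 * n) hb)
      rwa [sub_sub_sub_cancel_left] at this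
    have h1 := (mem_malcev_iff k G).1 y.2 n
    rw [(Completion.mem_filtration k _).1 hy, TensorProduct.zero_tmul, TensorProduct.tmul_zero,
      add_zero] at h1
    rw [Completion.mem_filtration, map_sub, sub_eq_zero] at hb
    rw [hb, Completion.proj_toCompletion, comulLevel_mk] at h1
    -- As y is in the n-th term, its comultiplication vanishes at level n. Both i and j are
    -- positive, so i + 1 and j + 1 are at most n and level n determines the component (i, j).
    have h2 := congrArg (Algebra.TensorProduct.map
      (transition k (augIdeal k G) (by omega : i + 1 ≤ n))
      (transition k (augIdeal k G) (by omega : j + 1 ≤ n))) h1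
    rw [map_zero, ← AlgHom.comp_apply, ← Algebra.TensorProduct.map_comp] at h2
    have h3 := mk_tensor_eq_zero k (augIdeal k G) (i := i + 1) (j := j + 1) (n := n + 1) (by omega)
      (comul_mem k G hba)
    rw [map_sub, map_sub, sub_eq_zero] at h3
    exact h3.symm.trans h2
  exact ⟨z, by rwa [hz]⟩

/-- The logarithm of g has the symbol of g - 1; linear combinations give the rest. -/
theorem exists_malcev_symbol {n : ℕ} (hn : 0 < n) (z : GrLiePiece k G n) :
    ∃ y : malcev k G,
      HasSymbol k (augIdeal k G) n (y : GroupAlgebraHat k G) (quillenPiece k G n z) := by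
  induction z using TensorProduct.induction_on with
  | zero => exact ⟨0, by rw [map_zero]; exact HasSymbol.zero⟩
  | add z w hz hw =>
    obtain ⟨x, hx⟩ := hz
    obtain ⟨y, hy⟩ := hw
    exact ⟨x + y, by rw [map_add]; exact hx.add hy⟩
  | tmul c a =>
    obtain ⟨g, hg, rfl⟩ := GrGroup.mk_surjective a
    obtain ⟨x, hx⟩ := exists_log k G g
    refine ⟨c • x, ?_⟩
    rw [quillenPiece_tmul, quillenGroup_mk]
    exact (hasSymbol_mk _ (hx n hn (sub_one_mem_pow k hg))).smul c

end Primitives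

/-! ### Generation in degree one. -/

section Generation

variable (k G : Type*) [Field k] [CharZero k] [Group G]

/-- gr_(n+2) is spanned by brackets [a, g] with g in G, and these are additive in g, so g may be
restricted to generators of G. -/
theorem exists_eq_sum_bracket {S : Finset G} (hS : Subgroup.closure (S : Set G) = ⊤) {n : ℕ}
    (z : GrLiePiece k G (n + 2)) : ∃ w : S → GrLiePiece k G (n + 1),
      z = ∑ s, GrLiePiece.bracket k G (i := n + 1) (j := 1) rfl (w s)
        (1 ⊗ₜ GrGroup.mk (n := 1) s.1 (Subgroup.mem_top _)) := by
  classical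
  let f : (S → GrLiePiece k G (n + 1)) →ₗ[k] GrLiePiece k G (n + 2) :=
    ∑ s : S, (LinearMap.flip (GrLiePiece.bracket k G (i := n + 1) (j := 1) rfl)
      (1 ⊗ₜ GrGroup.mk (n := 1) s.1 (Subgroup.mem_top _))) ∘ₗ LinearMap.proj s
  have hf : ∀ w, f w = ∑ s, GrLiePiece.bracket k G (i := n + 1) (j := 1) rfl (w s)
      (1 ⊗ₜ GrGroup.mk (n := 1) s.1 (Subgroup.mem_top _)) := fun w => by
    simp only [f, LinearMap.sum_apply]; rfl
  suffices H : ∀ z, z ∈ LinearMap.range f by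
    obtain ⟨w, hw⟩ := H z
    exact ⟨w, hw.symm.trans (hf w)⟩
  clear z
  have key : ∀ g : G, ∀ (c : k) (a : GrGroup G (n + 1)),
      c ⊗ₜ[ℤ] GrGroup.bracket G (rfl : n + 1 + 1 = n + 2) a (GrGroup.mk g (Subgroup.mem_top g)) ∈
        LinearMap.range f := by
    intro g
    have hg : g ∈ Subgroup.closure (S : Set G) := hS ▸ Subgroup.mem_top g
    induction hg using Subgroup.closure_induction with
    | mem s hs =>
      intro c a
      refine ⟨Pi.single ⟨s, hs⟩ (c ⊗ₜ a), ?_⟩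
      rw [hf, Finset.sum_eq_single ⟨s, hs⟩, Pi.single_eq_same, GrLiePiece.bracket_tmul, mul_one]
      · intro t _ ht
        rw [Pi.single_eq_of_ne ht, map_zero, LinearMap.zero_apply]
      · exact fun h => absurd (Finset.mem_univ _) h
    | one =>
      intro c a
      rw [GrGroup.mk_one, map_zero, TensorProduct.tmul_zero]
      exact zero_mem _
    | mul x y _ _ hx hy =>
      intro c a
      rw [GrGroup.mk_mul (n := 1) (Subgroup.mem_top x) (Subgroup.mem_top y), map_add,
        TensorProduct.tmul_add]
      exact add_mem (hx c a) (hy c a)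
    | inv x _ hx =>
      intro c a
      rw [GrGroup.mk_inv (n := 1) (Subgroup.mem_top x), map_neg, TensorProduct.tmul_neg]
      exact neg_mem (hx c a)
  intro z
  induction z using TensorProduct.induction_on with
  | zero => exact zero_mem _
  | add x y hx hy => exact add_mem hx hy
  | tmul c a =>
    let P : AddSubgroup (GrGroup G (n + 2)) :=
      { carrier := {a | ∀ c : k, c ⊗ₜ a ∈ LinearMap.range f}
        zero_mem' := fun c => by rw [TensorProduct.tmul_zero]; exact zero_mem _
        add_mem' := fun ha hb c => by rw [TensorProduct.tmul_add]; exact add_mem (ha c) (hb c)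
        neg_mem' := fun ha c => by rw [TensorProduct.tmul_neg]; exact neg_mem (ha c) }
    refine mk_mem_of_mem_commutator G P (fun a b c => ?_) a c
    obtain ⟨g, hg, rfl⟩ := GrGroup.mk_surjective b
    exact key g c a

variable [Group.FG G]

/-- The generators are Malcev elements with the symbols of s - 1 for s in S. That they generate in
the graded sense is read off from `exists_eq_sum_bracket` through symbols. -/
theorem malcevFiltration_le_lieGamma (n : ℕ) :
    malcevFiltration k G (n + 1) ≤ lieGamma k (L := malcev k G) n := by
  obtain ⟨S, hS⟩ := Group.fg_def.1 ‹Group.FG G›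
  have hx : ∀ s : S, ∃ x : malcev k G, HasSymbol k (augIdeal k G) 1 (x : GroupAlgebraHat k G)
      (quillenPiece k G 1 (1 ⊗ₜ GrGroup.mk (n := 1) s.1 (Subgroup.mem_top _))) := fun s =>
    exists_malcev_symbol k G one_pos _
  choose x hx using hx
  refine filtration_le_lieGamma k (malcevFiltration k G) x (malcev_seriesConverge k G)
    (malcev_separated k G) (malcevFiltration_antitone k G) (fun n y hy i => ?_)
    (fun n y hy => ?_) n
  · have h1 := Completion.mul_mem_filtration k _ hy (hx i).mem
    have h2 := Completion.mul_mem_filtration k _ (hx i).mem hy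
    rw [add_comm 1 n] at h2
    exact sub_mem h1 h2
  · obtain ⟨z, hz⟩ := exists_symbol_malcev k G (by omega) hy
    obtain ⟨w, hw⟩ := exists_eq_sum_bracket k G hS z
    choose v hv using fun s => exists_malcev_symbol k G (Nat.succ_pos n) (w s)
    refine ⟨v, fun s => (hv s).mem, ?_⟩
    rw [finsum_eq_sum_of_fintype, mem_malcevFiltration, ← hasSymbol_zero_iff]
    -- The sum of brackets has the same symbol as y, so the difference drops to degree n + 3.
    have hsum : HasSymbol k (augIdeal k G) (n + 2)
        ((∑ s, ⁅v s, x s⁆ : malcev k G) : GroupAlgebraHat k G) (quillenPiece k G (n + 2) z) := by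
      rw [hw, map_sum, show ((∑ s, ⁅v s, x s⁆ : malcev k G) : GroupAlgebraHat k G) =
        ∑ s, ((⁅v s, x s⁆ : malcev k G) : GroupAlgebraHat k G) from
          map_sum (malcev k G).toSubmodule.subtype _ _]
      refine HasSymbol.sum _ fun s _ => ?_
      rw [quillenPiece_bracket k G (i := n + 1) (j := 1) rfl (by omega)]
      exact ((hv s).mul rfl (hx s)).sub ((hx s).mul (by omega) (hv s))
    have := hz.sub hsum
    rwa [sub_self] at this

theorem grLieHat_filtration_le_lieGamma (n : ℕ) :
    GrLieHat.filtration k G (n + 1) ≤ lieGamma k (L := GrLieHat k G) n := by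
  obtain ⟨S, hS⟩ := Group.fg_def.1 ‹Group.FG G›
  refine filtration_le_lieGamma k (GrLieHat.filtration k G) (fun s : S => GrLieHat.single k G 1
      (1 ⊗ₜ GrGroup.mk (n := 1) s.1 (Subgroup.mem_top _))) (grLieHat_seriesConverge k G)
    (grLieHat_separated k G) (GrLieHat.filtration_antitone k G)
    (fun n y hy i => GrLieHat.bracket_mem k G hy (GrLieHat.single_mem k G 1 _))
    (fun n y hy => ?_) n
  obtain ⟨w, hw⟩ := exists_eq_sum_bracket k G hS (y (n + 2))
  refine ⟨fun s => GrLieHat.single k G (n + 1) (w s), fun s => GrLieHat.single_mem k G _ _, ?_⟩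
  rw [finsum_eq_sum_of_fintype]
  intro j hj
  rcases Nat.lt_succ_iff_lt_or_eq.1 hj with hj | rfl
  · exact (sub_mem hy (sum_mem fun s _ => GrLieHat.bracket_mem k G (m := n + 1) (n := 1)
      (GrLieHat.single_mem k G (n + 1) (w s)) (GrLieHat.single_mem k G 1 _))) j hj
  · let ev : GrLieHat k G →ₗ[k] GrLiePiece k G (n + 2) :=
      LinearMap.proj (φ := fun n => GrLiePiece k G n) (n + 2)
    change ev (y - _) = 0
    rw [map_sub, map_sum, sub_eq_zero]
    refine hw.trans (Finset.sum_congr rfl fun s _ => ?_)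
    exact (GrLieHat.bracket_single k G rfl _ _).symm

end Generation

/-! ### Extending filtered maps to completions. -/

section Extension

variable (k : Type*) {A : Type*} [Field k] [Ring A] [Algebra k A] (I : Ideal A) [I.IsTwoSided]
  {B : Type*} [Ring B] [Algebra k B] (J : Ideal B) [J.IsTwoSided]

theorem GrHat.extendLevel_proj (φ : B →ₗ[k] GrHat k I)
    (hφ : ∀ n, ∀ b ∈ J ^ n, φ b ∈ GrHat.filtration k I n) {n N : ℕ} (h : n < N)
    (x : Completion k J) :
    GrHat.extendLevel k I J φ hφ h (Completion.proj k J N x) = GrHat.extend k I J φ hφ x n := by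
  obtain ⟨b, hb⟩ := Completion.exists_toCompletion k J N x
  have h1 : Completion.proj k J N x = Ideal.Quotient.mk _ b := sub_eq_zero.1 hb
  have h2 : Completion.proj k J (n + 1) x = Ideal.Quotient.mk _ b :=
    sub_eq_zero.1 (Completion.filtration_antitone k J h hb)
  change _ = GrHat.extendLevel k I J φ hφ n.lt_succ_self (Completion.proj k J (n + 1) x)
  rw [h1, h2]
  rfl

theorem GrHat.extend_mem (φ : B →ₗ[k] GrHat k I)
    (hφ : ∀ n, ∀ b ∈ J ^ n, φ b ∈ GrHat.filtration k I n) {n : ℕ} {x : Completion k J}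
    (hx : x ∈ Completion.filtration k J n) :
    GrHat.extend k I J φ hφ x ∈ GrHat.filtration k I n := fun j hj => by
  change GrHat.extendLevel k I J φ hφ j.lt_succ_self (Completion.proj k J (j + 1) x) = 0
  rw [(Completion.mem_filtration k J).1 (Completion.filtration_antitone k J hj hx), map_zero]

theorem Completion.extend_toCompletion (φ : B →ₐ[k] Completion k I)
    (hφ : ∀ n, ∀ b ∈ J ^ n, φ b ∈ Completion.filtration k I n) (b : B) :
    Completion.extend k I J φ hφ (toCompletion k J b) = φ b :=
  Completion.ext k I fun _ => rfl

theorem Completion.extend_mem (φ : B →ₐ[k] Completion k I)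
    (hφ : ∀ n, ∀ b ∈ J ^ n, φ b ∈ Completion.filtration k I n) {n : ℕ} {x : Completion k J}
    (hx : x ∈ Completion.filtration k J n) :
    Completion.extend k I J φ hφ x ∈ Completion.filtration k I n := by
  change Ideal.Quotient.liftₐ (J ^ n) ((Completion.proj k I n).comp φ) (hφ n)
    (Completion.proj k J n x) = 0
  rw [(Completion.mem_filtration k J).1 hx, map_zero]

/-- Filtered maps are continuous and the target is separated, so it suffices to approximate x by
points where f and g agree. -/
theorem eq_of_filtered {f g : Completion k J →ₗ[k] GrHat k I}
    (hf : ∀ n, ∀ x ∈ Completion.filtration k J n, f x ∈ GrHat.filtration k I n)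
    (hg : ∀ n, ∀ x ∈ Completion.filtration k J n, g x ∈ GrHat.filtration k I n)
    {x : Completion k J}
    (h : ∀ n, ∃ y, x - y ∈ Completion.filtration k J n ∧ f y = g y) : f x = g x := by
  rw [← sub_eq_zero]
  refine GrHat.separated k I _ fun n => ?_
  obtain ⟨y, hxy, hy⟩ := h n
  have := sub_mem (hf n _ hxy) (hg n _ hxy)
  rwa [map_sub, map_sub, hy, sub_sub_sub_cancel_right] at this

/-- Density of B in its completion, with xy - ab = (x - a)y + a(y - b) in source and target. -/
theorem map_mul_of_filtered (f : Completion k J →ₗ[k] GrHat k I)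
    (hf : ∀ n, ∀ x ∈ Completion.filtration k J n, f x ∈ GrHat.filtration k I n)
    (h : ∀ a b, f (toCompletion k J (a * b)) = f (toCompletion k J a) * f (toCompletion k J b))
    (x y : Completion k J) : f (x * y) = f x * f y := by
  rw [← sub_eq_zero]
  refine GrHat.separated k I _ fun n => ?_
  obtain ⟨a, ha⟩ := Completion.exists_toCompletion k J n x
  obtain ⟨b, hb⟩ := Completion.exists_toCompletion k J n y
  have hab := h a b
  rw [map_mul] at hab
  have h0 : ∀ u v : Completion k J, u ∈ Completion.filtration k J n →
      u * v ∈ Completion.filtration k J n ∧ v * u ∈ Completion.filtration k J n := fun u v hu => by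
    have h1 := Completion.mul_mem_filtration k J hu (Completion.mem_filtration_zero k J v)
    have h2 := Completion.mul_mem_filtration k J (Completion.mem_filtration_zero k J v) hu
    rw [zero_add] at h2
    exact ⟨h1, h2⟩
  have h0' : ∀ u v : GrHat k I, u ∈ GrHat.filtration k I n →
      u * v ∈ GrHat.filtration k I n ∧ v * u ∈ GrHat.filtration k I n := fun u v hu => by
    have h1 := GrHat.mul_mem_filtration k I hu (GrHat.mem_filtration_zero k I v)
    have h2 := GrHat.mul_mem_filtration k I (GrHat.mem_filtration_zero k I v) hu
    rw [zero_add] at h2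
    exact ⟨h1, h2⟩
  have h1 := hf n _ (add_mem (h0 _ y ha).1 (h0 _ (toCompletion k J a) hb).2)
  rw [sub_mul, mul_sub, sub_add_sub_cancel, map_sub, hab] at h1
  have h2 := add_mem (h0' _ (f y) (hf n _ ha)).1 (h0' _ (f (toCompletion k J a)) (hf n _ hb)).2
  rw [map_sub, map_sub, sub_mul, mul_sub, sub_add_sub_cancel] at h2
  have h3 := sub_mem h1 h2
  rwa [sub_sub_sub_cancel_right] at h3

/-- The extension of a filtered algebra map to the completion is an algebra map. -/
def GrHat.extendAlg (φ : B →ₐ[k] GrHat k I)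
    (hφ : ∀ n, ∀ b ∈ J ^ n, φ b ∈ GrHat.filtration k I n) : Completion k J →ₐ[k] GrHat k I :=
  AlgHom.ofLinearMap (GrHat.extend k I J φ.toLinearMap hφ)
    ((congrArg (GrHat.extend k I J φ.toLinearMap hφ) (map_one (toCompletion k J)).symm).trans
      (map_one φ))
    (map_mul_of_filtered k I J _ (fun _ _ => GrHat.extend_mem k I J _ hφ) (map_mul φ))

theorem GrHat.mul_apply (x y : GrHat k I) (n : ℕ) :
    (x * y) n = ∑ p : Finset.HasAntidiagonal.antidiagonal n,
      Gr.mul k I (Finset.HasAntidiagonal.mem_antidiagonal.1 p.2) (x p.1.1) (y p.1.2) := rfl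

theorem GrHat.mul_apply_of_mem {i j n : ℕ} (h : i + j = n) {x y : GrHat k I}
    (hx : x ∈ GrHat.filtration k I i) (hy : y ∈ GrHat.filtration k I j) :
    (x * y) n = Gr.mul k I h (x i) (y j) := by
  rw [GrHat.mul_apply, Finset.sum_eq_single
    ⟨(i, j), Finset.HasAntidiagonal.mem_antidiagonal.2 h⟩]
  · rintro ⟨⟨a, b⟩, hab⟩ _ hne
    have hab' : a + b = n := Finset.HasAntidiagonal.mem_antidiagonal.1 hab
    change Gr.mul k I _ (x a) (y b) = 0
    rcases lt_trichotomy a i with ha | rfl | ha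
    · rw [hx a ha, map_zero, LinearMap.zero_apply]
    · obtain rfl : b = j := by omega
      exact absurd rfl hne
    · rw [hy b (by omega), map_zero]
  · exact fun h => absurd (Finset.mem_univ _) h

variable {J} in
/-- The map of graded pieces induced by a filtered algebra map. -/
def Gr.map (ψ : A →ₐ[k] B) (hψ : ∀ n, ∀ a ∈ pow k I n, ψ a ∈ pow k J n) (n : ℕ) :
    Gr k I n →ₗ[k] Gr k J n :=
  Submodule.liftQ _ ((Gr.mk k J n) ∘ₗ (ψ.toLinearMap.restrict (hψ n))) fun a ha =>
    (Gr.mk_eq_zero_iff k J).2 (hψ (n + 1) a ha)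

variable {J} in
theorem Gr.map_mul (ψ : A →ₐ[k] B) (hψ : ∀ n, ∀ a ∈ pow k I n, ψ a ∈ pow k J n) {i j n : ℕ}
    (h : i + j = n) (x : Gr k I i) (y : Gr k I j) :
    Gr.map k I ψ hψ n (Gr.mul k I h x y) =
      Gr.mul k J h (Gr.map k I ψ hψ i x) (Gr.map k I ψ hψ j y) := by
  obtain ⟨⟨a, ha⟩, rfl⟩ := Submodule.mkQ_surjective _ x
  obtain ⟨⟨b, hb⟩, rfl⟩ := Submodule.mkQ_surjective _ y
  exact congrArg (Gr.mk k J n) (Subtype.ext (_root_.map_mul ψ a b))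

variable {J} in
/-- The map of completed associated graded algebras induced by a filtered algebra map. -/
def GrHat.map (ψ : A →ₐ[k] B) (hψ : ∀ n, ∀ a ∈ pow k I n, ψ a ∈ pow k J n) :
    GrHat k I →ₐ[k] GrHat k J :=
  AlgHom.ofLinearMap
    { toFun := fun x n => Gr.map k I ψ hψ n (x n)
      map_add' := fun x y => funext fun n => map_add (Gr.map k I ψ hψ n) (x n) (y n)
      map_smul' := fun c x => funext fun n => map_smul (Gr.map k I ψ hψ n) c (x n) }
    (funext fun n => by
      change Gr.map k I ψ hψ n ((1 : GrHat k I) n) = (1 : GrHat k J) n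
      rcases Nat.eq_zero_or_pos n with rfl | hn
      · rw [GrHat.one_zero, GrHat.one_zero]
        exact congrArg (Gr.mk k J 0) (Subtype.ext (map_one ψ))
      · rw [GrHat.one_of_pos k _ hn, GrHat.one_of_pos k _ hn, map_zero])
    fun x y => funext fun n => by
      change Gr.map k I ψ hψ n (∑ p : Finset.HasAntidiagonal.antidiagonal n, _) =
        ∑ p : Finset.HasAntidiagonal.antidiagonal n, _
      rw [map_sum]
      exact Finset.sum_congr rfl fun p _ => Gr.map_mul k I ψ hψ _ _ _

end Extension

/-! ### The graded algebra of A ⊗ A. -/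

section TensorIdeal

variable (k : Type*) {A : Type*} [Field k] [Ring A] [Algebra k A] (I : Ideal A) [I.IsTwoSided]

/-- The ideal `I ⊗ A + A ⊗ I` of `A ⊗ A`. -/
def tensorIdeal : Ideal (A ⊗[k] A) where
  carrier := tensorPow k I 1
  zero_mem' := zero_mem _
  add_mem' hx hy := add_mem hx hy
  smul_mem' c x hx := by
    have := mul_mem_tensorPow k I (mem_tensorPow_zero k I c) hx
    rwa [zero_add] at this

instance : (tensorIdeal k I).IsTwoSided :=
  ⟨fun {a} c hx => by
    have hx' : a ∈ tensorPow k I 1 := hx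
    have := mul_mem_tensorPow k I hx' (mem_tensorPow_zero k I c)
    rwa [add_zero] at this⟩

/-- One inclusion is multiplicativity of the tensor filtration, the other is a ⊗ b = (a ⊗ 1)(1 ⊗ b).
This makes the graded algebra of A ⊗ A an instance of `GrHat`, so that graded comultiplications can
be treated as algebra maps. -/
theorem pow_tensorIdeal (n : ℕ) : pow k (tensorIdeal k I) n = tensorPow k I n := by
  refine le_antisymm (fun t ht => ?_) (Submodule.span_le.2 ?_)
  · exact pow_induction k (tensorIdeal k I) (P := fun n t => t ∈ tensorPow k I n)
      (mem_tensorPow_zero k I) (fun n a _ b _ h1 h2 => add_mem h1 h2)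
      (fun n a _ b hb h1 => mul_mem_tensorPow k I h1 hb) ht
  · rintro _ ⟨i, j, rfl, a, ha, b, hb, rfl⟩
    have h1 : a ⊗ₜ[k] (1 : A) ∈ pow k (tensorIdeal k I) i :=
      pow_induction k I (P := fun n a => a ⊗ₜ[k] (1 : A) ∈ pow k (tensorIdeal k I) n)
        (fun a => mem_pow_zero k _ _)
        (fun n a _ b _ h1 h2 => by rw [TensorProduct.add_tmul]; exact add_mem h1 h2)
        (fun n a _ b hb h1 => by
          have hb' : b ⊗ₜ[k] (1 : A) ∈ pow k (tensorIdeal k I) 1 := (mem_pow_one k _).2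
            (tmul_mem_tensorPow k I (add_zero 1) ((mem_pow_one k I).2 hb) (one_mem_pow_zero k I))
          have := mul_mem_pow k _ h1 hb'
          rwa [Algebra.TensorProduct.tmul_mul_tmul, one_mul] at this) ha
    have h2 : (1 : A) ⊗ₜ[k] b ∈ pow k (tensorIdeal k I) j :=
      pow_induction k I (P := fun n a => (1 : A) ⊗ₜ[k] a ∈ pow k (tensorIdeal k I) n)
        (fun a => mem_pow_zero k _ _)
        (fun n a _ b _ h1 h2 => by rw [TensorProduct.tmul_add]; exact add_mem h1 h2)
        (fun n a _ b hb h1 => by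
          have hb' : (1 : A) ⊗ₜ[k] b ∈ pow k (tensorIdeal k I) 1 := (mem_pow_one k _).2
            (tmul_mem_tensorPow k I (zero_add 1) (one_mem_pow_zero k I) ((mem_pow_one k I).2 hb))
          have := mul_mem_pow k _ h1 hb'
          rwa [Algebra.TensorProduct.tmul_mul_tmul, one_mul] at this) hb
    have := mul_mem_pow k _ h1 h2
    rwa [Algebra.TensorProduct.tmul_mul_tmul, one_mul, mul_one] at this

theorem tmul_one_mem (n : ℕ) (a : A) (ha : a ∈ pow k I n) :
    Algebra.TensorProduct.includeLeft (R := k) (S := k) (B := A) a ∈ pow k (tensorIdeal k I) n := by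
  rw [pow_tensorIdeal]
  exact tmul_mem_tensorPow k I (add_zero n) ha (one_mem_pow_zero k I)

theorem one_tmul_mem (n : ℕ) (a : A) (ha : a ∈ pow k I n) :
    Algebra.TensorProduct.includeRight (R := k) (A := A) a ∈ pow k (tensorIdeal k I) n := by
  rw [pow_tensorIdeal]
  exact tmul_mem_tensorPow k I (zero_add n) (one_mem_pow_zero k I) ha

/-- The map `x ↦ x ⊗ 1` of completed associated graded algebras. -/
def GrHat.inl : GrHat k I →ₐ[k] GrHat k (tensorIdeal k I) :=
  GrHat.map k I _ (tmul_one_mem k I)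

/-- The map `x ↦ 1 ⊗ x` of completed associated graded algebras. -/
def GrHat.inr : GrHat k I →ₐ[k] GrHat k (tensorIdeal k I) :=
  GrHat.map k I _ (one_tmul_mem k I)

theorem Gr.map_inl_mul_inr {i j n : ℕ} (h : i + j = n) (a : pow k I i) (b : pow k I j) :
    Gr.mul k _ h (Gr.map k I _ (tmul_one_mem k I) i (Gr.mk k I i a))
      (Gr.map k I _ (one_tmul_mem k I) j (Gr.mk k I j b)) =
    Gr.mk k (tensorIdeal k I) n ⟨a.1 ⊗ₜ b.1, by
      rw [pow_tensorIdeal]; exact tmul_mem_tensorPow k I h a.2 b.2⟩ := by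
  refine congrArg (Gr.mk k _ n) (Subtype.ext ?_)
  change (a.1 ⊗ₜ[k] (1 : A)) * ((1 : A) ⊗ₜ[k] b.1) = _
  rw [Algebra.TensorProduct.tmul_mul_tmul, one_mul, mul_one]

theorem GrHat.commute_inl_inr (x y : GrHat k I) :
    Commute (GrHat.inl k I x) (GrHat.inr k I y) := by
  funext n
  rw [GrHat.mul_apply, GrHat.mul_apply]
  let e : Finset.HasAntidiagonal.antidiagonal n ≃ Finset.HasAntidiagonal.antidiagonal n :=
    { toFun := fun p => ⟨p.1.swap, Finset.HasAntidiagonal.mem_antidiagonal.2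
        ((add_comm _ _).trans (Finset.HasAntidiagonal.mem_antidiagonal.1 p.2))⟩
      invFun := fun p => ⟨p.1.swap, Finset.HasAntidiagonal.mem_antidiagonal.2
        ((add_comm _ _).trans (Finset.HasAntidiagonal.mem_antidiagonal.1 p.2))⟩
      left_inv := fun p => rfl
      right_inv := fun p => rfl }
  refine Fintype.sum_equiv e _ _ fun p => ?_
  obtain ⟨⟨i, j⟩, h⟩ := p
  obtain ⟨a, ha⟩ := Submodule.mkQ_surjective _ (x i)
  obtain ⟨b, hb⟩ := Submodule.mkQ_surjective _ (y j)
  change Gr.mul k _ _ (Gr.map k I _ (tmul_one_mem k I) i (x i))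
    (Gr.map k I _ (one_tmul_mem k I) j (y j)) = Gr.mul k _ _
    (Gr.map k I _ (one_tmul_mem k I) j (y j)) (Gr.map k I _ (tmul_one_mem k I) i (x i))
  rw [← ha, ← hb]
  refine congrArg (Gr.mk k _ n) (Subtype.ext ?_)
  change (a.1 ⊗ₜ[k] (1 : A)) * ((1 : A) ⊗ₜ[k] b.1) = ((1 : A) ⊗ₜ[k] b.1) * (a.1 ⊗ₜ[k] (1 : A))
  rw [Algebra.TensorProduct.tmul_mul_tmul, Algebra.TensorProduct.tmul_mul_tmul, one_mul, mul_one,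
    one_mul, mul_one]

/-- The projection of the graded piece of `A ⊗ A` of degree `i + j` to `Gr i ⊗ Gr j`. -/
def Gr.tensorComponent {i j n : ℕ} (h : i + j = n) :
    Gr k (tensorIdeal k I) n →ₗ[k] Gr k I i ⊗[k] Gr k I j :=
  Submodule.liftQ _ (grTensorProj k I h ∘ₗ Submodule.inclusion (pow_tensorIdeal k I n).le)
    fun _ ha => grTensorProj_eq_zero k I h _ ((pow_tensorIdeal k I (n + 1)).le ha)

theorem Gr.tensorComponent_inl_mul_inr (i j : ℕ) (x y : GrHat k I) :
    Gr.tensorComponent k I rfl ((GrHat.inl k I x * GrHat.inr k I y) (i + j)) = x i ⊗ₜ y j := by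
  rw [GrHat.mul_apply, map_sum, Finset.sum_eq_single
    ⟨(i, j), Finset.HasAntidiagonal.mem_antidiagonal.2 rfl⟩]
  · obtain ⟨a, ha⟩ := Submodule.mkQ_surjective _ (x i)
    obtain ⟨b, hb⟩ := Submodule.mkQ_surjective _ (y j)
    change Gr.tensorComponent k I rfl (Gr.mul k _ _ (Gr.map k I _ (tmul_one_mem k I) i (x i))
      (Gr.map k I _ (one_tmul_mem k I) j (y j))) = _
    rw [← ha, ← hb, Gr.map_inl_mul_inr]
    exact grTensorProj_tmul k I rfl a b
  · rintro ⟨⟨a, b⟩, hab⟩ _ hne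
    have hab' := Finset.HasAntidiagonal.mem_antidiagonal.1 hab
    obtain ⟨u, hu⟩ := Submodule.mkQ_surjective _ (x a)
    obtain ⟨v, hv⟩ := Submodule.mkQ_surjective _ (y b)
    change Gr.tensorComponent k I rfl (Gr.mul k _ _ (Gr.map k I _ (tmul_one_mem k I) a (x a))
      (Gr.map k I _ (one_tmul_mem k I) b (y b))) = _
    rw [← hu, ← hv, Gr.map_inl_mul_inr]
    refine grTensorProj_tmul_of_ne k I rfl hab' ?_ u v
    rintro rfl
    exact hne (Subtype.ext (Prod.ext rfl (by simp only at hab' ⊢; omega)))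
  · exact fun h => absurd (Finset.mem_univ _) h

end TensorIdeal

/-! ### The graded comultiplication as an algebra map. -/

section GroupAlgebraGr

variable (k G : Type*) [Field k] [Group G]

theorem comul_mem_tensorIdeal (n : ℕ) (a : MonoidAlgebra k G) (ha : a ∈ pow k (augIdeal k G) n) :
    Bialgebra.comulAlgHom k (MonoidAlgebra k G) a ∈ pow k (tensorIdeal k (augIdeal k G)) n := by
  rw [pow_tensorIdeal]
  exact comul_mem k G ha

/-- The comultiplication of the completed associated graded algebra, as an algebra map. -/
def grComulAlg : GrGroupAlgebraHat k G →ₐ[k] GrHat k (tensorIdeal k (augIdeal k G)) :=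
  GrHat.map k _ _ (comul_mem_tensorIdeal k G)

theorem tensorComponent_grComulAlg (x : GrGroupAlgebraHat k G) (i j : ℕ) :
    Gr.tensorComponent k _ rfl (grComulAlg k G x (i + j)) = grComul k G x i j := by
  obtain ⟨a, ha⟩ := Submodule.mkQ_surjective _ (x (i + j))
  change Gr.tensorComponent k _ rfl (Gr.map k _ _ (comul_mem_tensorIdeal k G) (i + j) (x (i + j))) =
    grComulComponent k G rfl (x (i + j))
  rw [← ha]
  rfl

variable [CharZero k]

theorem grComulAlg_quillenHat (y : GrLieHat k G) : grComulAlg k G (quillenHat k G y) =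
    GrHat.inl k _ (quillenHat k G y) + GrHat.inr k _ (quillenHat k G y) := by
  funext n
  change Gr.map k _ _ (comul_mem_tensorIdeal k G) n (quillenPiece k G n (y n)) =
    Gr.map k _ _ (tmul_one_mem k _) n (quillenPiece k G n (y n)) +
      Gr.map k _ _ (one_tmul_mem k _) n (quillenPiece k G n (y n))
  rcases Nat.eq_zero_or_pos n with rfl | hn
  · rw [quillenPiece_zero, map_zero, map_zero, map_zero, add_zero]
  · generalize y n = z
    induction z using TensorProduct.induction_on with
    | zero => simp only [map_zero, add_zero]
    | add z w hz hw => rw [map_add, map_add, map_add, map_add, hz, hw]; abel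
    | tmul c a =>
      obtain ⟨g, hg, rfl⟩ := GrGroup.mk_surjective a
      rw [quillenPiece_tmul, map_smul, map_smul, map_smul, ← smul_add, quillenGroup_mk]
      refine congrArg (c • ·) ?_
      refine (Gr.mk_eq_mk k _ (ha := comul_mem_tensorIdeal k G n _ (sub_one_mem_pow k hg))
        (hb := add_mem (tmul_one_mem k _ n _ (sub_one_mem_pow k hg))
          (one_tmul_mem k _ n _ (sub_one_mem_pow k hg))) ?_)
      change Bialgebra.comulAlgHom k (MonoidAlgebra k G) (MonoidAlgebra.of k G g - 1) -
        ((MonoidAlgebra.of k G g - 1) ⊗ₜ[k] 1 + 1 ⊗ₜ[k] (MonoidAlgebra.of k G g - 1)) ∈ _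
      rw [comul_of_sub_one, add_sub_cancel_left, pow_tensorIdeal]
      exact tensorPow_antitone k _ (by omega)
        (tmul_mem_tensorPow k _ rfl (sub_one_mem_pow k hg) (sub_one_mem_pow k hg))

/-- A map to primitive elements induces a map of coalgebras on the enveloping algebra. -/
theorem map_envComul_eq_grComul {L : Type*} [LieRing L] [LieAlgebra k L]
    (f : L →ₗ⁅k⁆ GrLieHat k G) (u : UniversalEnvelopingAlgebra k L) (i j : ℕ) :
    TensorProduct.map
      (GrHat.component k _ i ∘ₗ
        (UniversalEnvelopingAlgebra.lift k ((quillenHat k G).comp f)).toLinearMap)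
      (GrHat.component k _ j ∘ₗ
        (UniversalEnvelopingAlgebra.lift k ((quillenHat k G).comp f)).toLinearMap)
      (envComul k L u) =
    grComul k G (UniversalEnvelopingAlgebra.lift k ((quillenHat k G).comp f) u) i j := by
  let φ := UniversalEnvelopingAlgebra.lift k ((quillenHat k G).comp f)
  let Ψ := Algebra.TensorProduct.lift ((GrHat.inl k (augIdeal k G)).comp φ)
    ((GrHat.inr k (augIdeal k G)).comp φ) fun x y => GrHat.commute_inl_inr k _ (φ x) (φ y)
  have hΨ : ∀ a b, Ψ (a ⊗ₜ b) = GrHat.inl k _ (φ a) * GrHat.inr k _ (φ b) := fun a b =>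
    Algebra.TensorProduct.lift_tmul _ _ _ a b
  -- Both sides are algebra maps on U(L), and they agree on L because Quillen's map takes primitive
  -- values.
  have h1 : Ψ.comp (envComul k L) = (grComulAlg k G).comp φ := by
    refine UniversalEnvelopingAlgebra.hom_ext _ (LieHom.ext fun x => ?_)
    change Ψ (envComul k L (UniversalEnvelopingAlgebra.ι k x)) =
      grComulAlg k G (φ (UniversalEnvelopingAlgebra.ι k x))
    have hx : φ (UniversalEnvelopingAlgebra.ι k x) = quillenHat k G (f x) :=
      UniversalEnvelopingAlgebra.lift_ι_apply k _ x
    rw [envComul_ι, hx, grComulAlg_quillenHat, map_add, hΨ, hΨ, map_one, map_one, map_one, one_mul,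
      mul_one, hx]
  have h2 := DFunLike.congr_fun h1 u
  rw [AlgHom.comp_apply, AlgHom.comp_apply] at h2
  rw [← tensorComponent_grComulAlg, ← h2]
  generalize envComul k L u = t
  induction t using TensorProduct.induction_on with
  | zero =>
    rw [map_zero, map_zero]
    exact (map_zero _).symm
  | add s t hs ht =>
    rw [map_add, map_add, hs, ht]
    exact (map_add _ _ _).symm
  | tmul a b =>
    rw [hΨ]
    exact (Gr.tensorComponent_inl_mul_inr k _ i j (φ a) (φ b)).symm

end GroupAlgebraGr

/-! ### Strictness for maps out of enveloping algebras. -/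

section EnvelopingFiltration

open UniversalEnvelopingAlgebra

variable (k : Type*) {L : Type*} [Field k] [LieRing L] [LieAlgebra k L]

theorem ι_mem_pow {n : ℕ} {y : L} (hy : y ∈ lieGamma k (L := L) n) :
    ι k y ∈ pow k (envAug k L) (n + 1) := by
  induction n generalizing y with
  | zero => exact (mem_pow_one k _).2 (ι_mem_envAug k y)
  | succ n ih =>
    rw [lieGamma] at hy
    induction hy using Submodule.span_induction with
    | mem z hz =>
      obtain ⟨x, hx, w, rfl⟩ := hz
      have h1 := mul_mem_pow k _ (ih hx) ((mem_pow_one k _).2 (ι_mem_envAug k w))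
      have h2 := mul_mem_pow k _ ((mem_pow_one k _).2 (ι_mem_envAug k w)) (ih hx)
      rw [add_comm 1] at h2
      rw [LieHom.map_lie]
      exact sub_mem h1 h2
    | zero => rw [map_zero]; exact zero_mem _
    | add x y _ _ hx hy => rw [map_add]; exact add_mem hx hy
    | smul c x _ hx => rw [map_smul]; exact Submodule.smul_mem _ c hx

/-- The classes of elements of the lower central series of the Lie algebra. -/
def envPrimitives (n : ℕ) : Submodule k (Gr k (envAug k L) n) :=
  (((lieGamma k (L := L) (n - 1)).map (ι k : L →ₗ⁅k⁆ UniversalEnvelopingAlgebra k L).toLinearMap).comap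
    (pow k (envAug k L) n).subtype).map (Gr.mk k (envAug k L) n)

variable {k} in
theorem mem_envPrimitives {n : ℕ} {s : Gr k (envAug k L) n} : s ∈ envPrimitives k n ↔
    ∃ y ∈ lieGamma k (L := L) (n - 1), ∃ h, Gr.mk k (envAug k L) n ⟨ι k y, h⟩ = s := by
  constructor
  · rintro ⟨⟨_, h⟩, ⟨y, hy, rfl⟩, rfl⟩
    exact ⟨y, hy, h, rfl⟩
  · rintro ⟨y, hy, h, rfl⟩
    exact ⟨⟨_, h⟩, ⟨y, hy, rfl⟩, rfl⟩

variable [CharZero k]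

/-- The Dynkin argument for U(L): classes of lower central elements contain degree one, because the
augmentation ideal is L plus its square, and they are closed under brackets. Note that `lieGamma` n
consists of brackets of n + 1 elements. -/
theorem exists_mk_ι_eq {n : ℕ} {u : UniversalEnvelopingAlgebra k L}
    (hu : u ∈ pow k (envAug k L) (n + 1))
    (hprim : ∀ i j (h : i + j = n + 1), 0 < i → 0 < j →
      grTensorProj k _ h ⟨envComul k L u, (envHopf k L).comul_mem hu⟩ = 0) :
    ∃ y ∈ lieGamma k (L := L) n, u - ι k y ∈ pow k (envAug k L) (n + 2) := by
  have h1 : ∀ x (hx : x ∈ pow k (envAug k L) 1),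
      Gr.mk k (envAug k L) 1 ⟨x, hx⟩ ∈ envPrimitives k 1 := fun x hx => by
    obtain ⟨y, hy⟩ := envAug_sub_mem k L ((mem_pow_one k _).1 hx)
    exact mem_envPrimitives.2 ⟨y, trivial, (mem_pow_one k _).2 (ι_mem_envAug k y),
      ((Gr.mk_eq_iff k _).2 hy).symm⟩
  have h2 : ∀ n, 0 < n → ∀ z ∈ envPrimitives k n, ∀ x (hx : x ∈ pow k (envAug k L) 1),
      Gr.mul k (envAug k L) rfl z (Gr.mk k _ 1 ⟨x, hx⟩) -
        Gr.mul k (envAug k L) (add_comm 1 n) (Gr.mk k _ 1 ⟨x, hx⟩) z ∈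
          envPrimitives k (n + 1) := by
    intro m hm s hs x hx
    obtain ⟨y, hy, h, rfl⟩ := mem_envPrimitives.1 hs
    obtain ⟨z, hz⟩ := envAug_sub_mem k L ((mem_pow_one k _).1 hx)
    obtain ⟨m, rfl⟩ : ∃ l, m = l + 1 := ⟨m - 1, by omega⟩
    have e : Gr.mk k (envAug k L) 1 ⟨x, hx⟩ =
        Gr.mk k (envAug k L) 1 ⟨ι k z, (mem_pow_one k _).2 (ι_mem_envAug k z)⟩ :=
      (Gr.mk_eq_iff k _).2 hz
    have hyz : ⁅y, z⁆ ∈ lieGamma k (L := L) (m + 1) := by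
      rw [lieGamma]; exact Submodule.subset_span ⟨y, hy, z, rfl⟩
    rw [e]
    refine mem_envPrimitives.2 ⟨⁅y, z⁆, hyz, ι_mem_pow k hyz, ?_⟩
    refine congrArg (Gr.mk k _ (m + 1 + 1)) (Subtype.ext ?_)
    exact LieHom.map_lie (ι k) y z
  obtain ⟨y, hy, h, e⟩ := mem_envPrimitives.1
    ((envHopf k L).mk_mem_of_primitive (envPrimitives k) h1 h2 n.succ_pos hu hprim)
  exact ⟨y, hy, (Gr.mk_eq_iff k _).1 e.symm⟩

/-- A criterion for the map of the enveloping algebra to a filtered algebra to be strictly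
compatible with filtrations. -/
theorem env_mem_pow_of_map_mem {H : Type*} [Ring H] [Algebra k H] (F : ℕ → Submodule k H)
    (hanti : Antitone F) (f : L →ₗ⁅k⁆ H) (hF : ∀ n, ∀ u ∈ pow k (envAug k L) n, lift k f u ∈ F n)
    {V : ℕ → Type*} [∀ i, AddCommGroup (V i)] [∀ i, Module k (V i)] (p : ∀ i, H →ₗ[k] V i)
    (hp : ∀ i, ∀ x ∈ F (i + 1), p i x = 0) (hp' : ∀ i, ∀ x ∈ F i, p i x = 0 → x ∈ F (i + 1))
    (h1 : (1 : H) ∉ F 1) (hf : ∀ n y, f y ∈ F (n + 1) → y ∈ lieGamma k (L := L) n)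
    (hc : ∀ i j u, lift k f u ∈ F (i + j + 1) →
      TensorProduct.map (p i ∘ₗ (lift k f).toLinearMap) (p j ∘ₗ (lift k f).toLinearMap)
        (envComul k L u) = 0)
    {n : ℕ} {u : UniversalEnvelopingAlgebra k L} (hu : lift k f u ∈ F n) :
    u ∈ pow k (envAug k L) n := by
  induction n using Nat.strong_induction_on generalizing u with
  | _ n ih =>
  -- Degree 1 is separate: u is a scalar modulo the augmentation ideal, and the scalar is zero
  -- because 1 is not in F 1.
  rcases n with _ | _ | n
  · exact mem_pow_zero k _ u
  · rw [mem_pow_one]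
    let c := (envHopf k L).counit u
    have hcu := (envHopf k L).sub_counit_mem u
    have h2 := sub_mem hu (hF 1 _ ((mem_pow_one k _).2 hcu))
    rw [map_sub, sub_sub_cancel, AlgHom.commutes, Algebra.algebraMap_eq_smul_one] at h2
    have hc0 : c = 0 := by
      by_contra hne
      have := Submodule.smul_mem _ c⁻¹ h2
      rw [smul_smul, inv_mul_cancel₀ hne, one_smul] at this
      exact h1 this
    rwa [show (envHopf k L).counit u = 0 from hc0, map_zero, sub_zero] at hcu
  · have hu' := ih (n + 1) (by omega) (hanti (Nat.le_succ _) hu)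
    let μ : ∀ i, Gr k (envAug k L) i →ₗ[k] V i := fun i => Submodule.liftQ _
      (p i ∘ₗ (lift k f).toLinearMap ∘ₗ (pow k (envAug k L) i).subtype)
      fun a ha => hp i _ (hF (i + 1) _ ha)
    -- Injectivity on the graded piece of degree i is the induction hypothesis in degree i + 1 ≤ n +
    -- 1.
    have hμ : ∀ i, i < n + 1 → Function.Injective (μ i) := fun i hi => by
      refine (injective_iff_map_eq_zero _).2 fun s hs => ?_
      obtain ⟨⟨a, ha⟩, rfl⟩ := Submodule.mkQ_surjective _ s
      exact (Gr.mk_eq_zero_iff k _).2 (ih (i + 1) (by omega) (hp' i _ (hF i a ha) hs))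
    -- The class of u in degree n + 1 is primitive: over a field μ i ⊗ μ j is injective, and it
    -- sends the component (i, j) of Δ(u) to the expression that vanishes by `hc`.
    obtain ⟨y, hy, hyu⟩ := exists_mk_ι_eq k hu' fun i j h hi hj => by
      refine TensorProduct.map_injective_of_flat_flat (μ i) (μ j) (hμ i (by omega))
        (hμ j (by omega)) ?_
      have key : TensorProduct.map (μ i) (μ j) ∘ₗ grTensorProj k (envAug k L) h =
          TensorProduct.map (p i ∘ₗ (lift k f).toLinearMap) (p j ∘ₗ (lift k f).toLinearMap) ∘ₗ
            (tensorPow k (envAug k L) (n + 1)).subtype := by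
        refine tensorPow_hom_ext k _ fun i' j' h' a b => ?_
        rw [LinearMap.comp_apply, LinearMap.comp_apply, Submodule.subtype_apply,
          TensorProduct.map_tmul]
        rcases lt_trichotomy i i' with hii | rfl | hii
        · rw [grTensorProj_tmul_of_ne k _ h h' hii.ne, map_zero, LinearMap.comp_apply,
            AlgHom.toLinearMap_apply, hp i _ (hanti hii (hF i' _ a.2)), TensorProduct.zero_tmul]
        · obtain rfl : j = j' := by omega
          rw [grTensorProj_tmul]
          rfl
        · rw [grTensorProj_tmul_of_ne k _ h h' hii.ne', map_zero,
            LinearMap.comp_apply (p j), AlgHom.toLinearMap_apply,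
            hp j _ (hanti (by omega : j + 1 ≤ j') (hF j' _ b.2)), TensorProduct.tmul_zero]
      rw [map_zero]
      refine (DFunLike.congr_fun key _).trans (hc i j u ?_)
      rwa [h]
    -- The correction y also maps one step deeper, so by `hf` it lies in the next term of the lower
    -- central series, and ι y in the next power.
    have h2 : f y ∈ F (n + 2) := by
      have := sub_mem hu (hF _ _ hyu)
      rwa [map_sub, sub_sub_cancel, lift_ι_apply] at this
    have := add_mem hyu (ι_mem_pow k (hf (n + 1) y h2))
    rwa [sub_add_cancel] at this

end EnvelopingFiltration

/-! ### Bijectivity of θ₁. -/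

section MalcevEnveloping

open UniversalEnvelopingAlgebra

variable (k G : Type*) [Field k] [CharZero k] [Group G]

/-- The map of the enveloping algebra of the Malcev Lie algebra to the completed group algebra. -/
abbrev malcevLift : UniversalEnvelopingAlgebra k (malcev k G) →ₐ[k] GroupAlgebraHat k G :=
  lift k (malcev k G).incl

theorem malcevLift_ι (x : malcev k G) : malcevLift k G (ι k x) = x := lift_ι_apply k _ x

theorem malcevLift_mem {n : ℕ} {u : UniversalEnvelopingAlgebra k (malcev k G)}
    (hu : u ∈ pow k (envAug k (malcev k G)) n) :
    malcevLift k G u ∈ Completion.filtration k (augIdeal k G) n :=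
  env_pow_mem k (Completion.filtration k (augIdeal k G)) (Completion.mem_filtration_zero k _)
    (Completion.mul_mem_filtration k _) _ (fun x => by
      rw [malcevLift_ι]
      exact malcev_mem_filtration_one k G x) n hu

/-- gr(kG) is generated in degree one, and degree one classes are symbols of Malcev elements. -/
theorem exists_malcevLift {n : ℕ} {a : MonoidAlgebra k G} (ha : a ∈ pow k (augIdeal k G) n) :
    ∃ u ∈ pow k (envAug k (malcev k G)) n,
      malcevLift k G u - toCompletion k _ a ∈ Completion.filtration k (augIdeal k G) (n + 1) := by
  refine pow_induction k (augIdeal k G) (P := fun n a =>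
    ∃ u ∈ pow k (envAug k (malcev k G)) n, malcevLift k G u - toCompletion k _ a ∈
      Completion.filtration k (augIdeal k G) (n + 1)) (fun a => ?_) ?_ ?_ ha
  · refine ⟨algebraMap k _ ((groupHopf k G).counit a), mem_pow_zero k _ _, ?_⟩
    rw [AlgHom.commutes, ← AlgHom.commutes (toCompletion k (augIdeal k G)), ← map_sub,
      Completion.toCompletion_mem, ← neg_mem_iff, neg_sub]
    exact (mem_pow_one k _).2 ((groupHopf k G).sub_counit_mem a)
  · rintro n a - b - ⟨u, hu, hua⟩ ⟨v, hv, hvb⟩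
    refine ⟨u + v, add_mem hu hv, ?_⟩
    rw [map_add, map_add, add_sub_add_comm]
    exact add_mem hua hvb
  · rintro n a ha b hb ⟨u, hu, hua⟩
    obtain ⟨z, hz⟩ := mk_mem_range_quillenPiece_one k G ((mem_pow_one k _).2 hb)
    obtain ⟨x, hx⟩ := exists_malcev_symbol k G one_pos z
    rw [hz] at hx
    refine ⟨u * ι k x, mul_mem_pow k _ hu ((mem_pow_one k _).2 (ι_mem_envAug k x)), ?_⟩
    rw [map_mul, malcevLift_ι]
    exact ((hasSymbol_mk ha hua).mul rfl hx).sub_mem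

theorem exists_malcevLift_sub_mem (x : GroupAlgebraHat k G) (n : ℕ) :
    ∃ u, x - malcevLift k G u ∈ Completion.filtration k (augIdeal k G) n := by
  induction n with
  | zero => exact ⟨0, Completion.mem_filtration_zero k _ _⟩
  | succ n ih =>
    obtain ⟨u, hu⟩ := ih
    obtain ⟨s, hs⟩ := exists_hasSymbol hu
    obtain ⟨⟨a, ha⟩, rfl⟩ := Submodule.mkQ_surjective _ s
    obtain ⟨v, -, hva⟩ := exists_malcevLift k G ha
    refine ⟨u + v, ?_⟩
    have := sub_mem hs.sub_mem hva
    rwa [sub_sub_sub_cancel_right, sub_sub, ← map_add] at this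

/-- Two algebra maps on U(m) which agree on m, by primitivity of its elements. -/
theorem proj_completedComul_malcevLift (u : UniversalEnvelopingAlgebra k (malcev k G)) (n : ℕ) :
    CompletedTensor.proj k _ n (completedComul k G (malcevLift k G u)) =
      TensorProduct.map ((Completion.proj k _ n).comp (malcevLift k G)).toLinearMap
        ((Completion.proj k _ n).comp (malcevLift k G)).toLinearMap
        (envComul k (malcev k G) u) := by
  have : ((CompletedTensor.proj k _ n).comp (completedComul k G)).comp (malcevLift k G) =
      (Algebra.TensorProduct.map ((Completion.proj k _ n).comp (malcevLift k G))
        ((Completion.proj k _ n).comp (malcevLift k G))).comp (envComul k (malcev k G)) := by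
    refine hom_ext k (LieHom.ext fun x => ?_)
    change CompletedTensor.proj k _ n (completedComul k G (malcevLift k G (ι k x))) =
      Algebra.TensorProduct.map _ _ (envComul k (malcev k G) (ι k x))
    rw [malcevLift_ι, (mem_malcev k G).1 x.2, envComul_ι, map_add, map_add,
      CompletedTensor.proj_inl, CompletedTensor.proj_inr, Algebra.TensorProduct.map_tmul,
      Algebra.TensorProduct.map_tmul, map_one, AlgHom.comp_apply, malcevLift_ι]
  exact DFunLike.congr_fun this u

theorem one_notMem_filtration : (1 : GroupAlgebraHat k G) ∉
    Completion.filtration k (augIdeal k G) 1 := fun h => by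
  rw [← map_one (toCompletion k (augIdeal k G)), Completion.toCompletion_mem, mem_pow_one] at h
  have : Bialgebra.counitAlgHom k (MonoidAlgebra k G) 1 = 0 := h
  rw [map_one] at this
  exact one_ne_zero this

variable [Group.FG G]

theorem mem_pow_of_malcevLift_mem {n : ℕ} {u : UniversalEnvelopingAlgebra k (malcev k G)}
    (hu : malcevLift k G u ∈ Completion.filtration k (augIdeal k G) n) :
    u ∈ pow k (envAug k (malcev k G)) n := by
  refine env_mem_pow_of_map_mem k (Completion.filtration k (augIdeal k G))
    (Completion.filtration_antitone k _) (malcev k G).incl (fun _ _ => malcevLift_mem k G)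
    (V := fun i => MonoidAlgebra k G ⧸ augIdeal k G ^ (i + 1))
    (fun i => (Completion.proj k _ (i + 1)).toLinearMap) (fun _ _ h => h) (fun _ _ _ h => h)
    (one_notMem_filtration k G) (fun n y hy => malcevFiltration_le_lieGamma k G n hy)
    (fun i j u hu => ?_) hu
  -- An approximation b to precision 2N lies in I^N. Its comultiplication dies modulo I^(i+1) and
  -- I^(j+1), since (i + 1) + (j + 1) = N + 1.
  let N := i + j + 1
  have h0 := proj_completedComul_malcevLift k G u N
  obtain ⟨b, hb⟩ := Completion.exists_toCompletion k (augIdeal k G) (2 * N) (malcevLift k G u)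
  have hbm : b ∈ pow k (augIdeal k G) N := by
    rw [← Completion.toCompletion_mem k]
    have := sub_mem hu (Completion.filtration_antitone k _ (by omega : N ≤ 2 * N) hb)
    rwa [sub_sub_cancel] at this
  rw [Completion.mem_filtration, map_sub, sub_eq_zero] at hb
  rw [proj_completedComul, hb, Completion.proj_toCompletion, comulLevel_mk] at h0
  have h1 := congrArg (Algebra.TensorProduct.map
    (transition k (augIdeal k G) (by omega : i + 1 ≤ N))
    (transition k (augIdeal k G) (by omega : j + 1 ≤ N))) h0
  have h2 := mk_tensor_eq_zero k (augIdeal k G) (i := i + 1) (j := j + 1) (n := N) (by omega)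
    (comul_mem k G hbm)
  rw [← AlgHom.comp_apply, ← Algebra.TensorProduct.map_comp] at h1
  refine Eq.trans ?_ (h1.symm.trans h2)
  generalize envComul k (malcev k G) u = t
  induction t using TensorProduct.induction_on with
  | zero => simp only [map_zero]
  | add s t hs ht => simp only [map_add, hs, ht]
  | tmul a b =>
    rw [TensorProduct.map_tmul, TensorProduct.map_tmul, Algebra.TensorProduct.map_tmul]
    exact congrArg₂ (· ⊗ₜ ·) (Completion.transition_proj k _ _ _).symm
      (Completion.transition_proj k _ _ _).symm

theorem malcevEnv_toCompletion (u : UniversalEnvelopingAlgebra k (malcev k G)) :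
    malcevEnv k G (toCompletion k _ u) = malcevLift k G u :=
  Completion.extend_toCompletion k _ _ _ _ u

theorem malcevEnv_mem_iff {n : ℕ} {x : EnvHat k (malcev k G)} :
    malcevEnv k G x ∈ Completion.filtration k (augIdeal k G) n ↔
      x ∈ Completion.filtration k (envAug k (malcev k G)) n := by
  obtain ⟨u, hu⟩ := Completion.exists_toCompletion k (envAug k (malcev k G)) n x
  have h0 : ∀ x ∈ Completion.filtration k (envAug k (malcev k G)) n,
      malcevEnv k G x ∈ Completion.filtration k (augIdeal k G) n := fun x hx =>
    Completion.extend_mem k _ _ _ _ hx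
  refine ⟨fun h => ?_, h0 x⟩
  have h1 := sub_mem h (h0 _ hu)
  rw [map_sub, sub_sub_cancel, malcevEnv_toCompletion] at h1
  have h2 := (Completion.toCompletion_mem k _).2 (mem_pow_of_malcevLift_mem k G h1)
  have := add_mem hu h2
  rwa [sub_add_cancel] at this

/-- Strictness and separation give injectivity; surjectivity on graded pieces and completeness give
surjectivity. -/
theorem malcevEnv_bijective : Function.Bijective (malcevEnv k G) := by
  refine ⟨(injective_iff_map_eq_zero _).2 fun x hx => ?_, fun y => ?_⟩
  · refine Completion.separated k _ x fun n => (malcevEnv_mem_iff k G).1 ?_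
    rw [hx]
    exact zero_mem _
  · obtain ⟨x, -, hx⟩ := exists_preimage_of_gr_surjective
      (Completion.seriesConverge k (envAug k (malcev k G))) (Completion.separated k (augIdeal k G))
      (malcevEnv k G).toLinearMap (fun n x hx => (malcevEnv_mem_iff k G).2 hx)
      (fun n y hy => by
        obtain ⟨s, hs⟩ := exists_hasSymbol hy
        obtain ⟨⟨a, ha⟩, rfl⟩ := Submodule.mkQ_surjective _ s
        obtain ⟨u, hu, hua⟩ := exists_malcevLift k G ha
        refine ⟨toCompletion k _ u, (Completion.toCompletion_mem k _).2 hu, ?_⟩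
        rw [AlgHom.toLinearMap_apply, malcevEnv_toCompletion]
        have := sub_mem hs.sub_mem hua
        rwa [sub_sub_sub_cancel_right] at this)
      (Completion.filtration_antitone k _) (Completion.mem_filtration_zero k _ y)
    exact ⟨x, hx⟩

end MalcevEnveloping

/-! ### Bijectivity of θ₂. -/

section GradedEnveloping

open UniversalEnvelopingAlgebra

variable (k G : Type*) [Field k] [CharZero k] [Group G]

/-- The map of the enveloping algebra of the completed Lie algebra `gr(G)` to the completed
associated graded algebra of the group algebra. -/
abbrev grLift : UniversalEnvelopingAlgebra k (GrLieHat k G) →ₐ[k] GrGroupAlgebraHat k G :=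
  lift k (quillenHat k G)

theorem grLift_ι (x : GrLieHat k G) : grLift k G (ι k x) = quillenHat k G x :=
  lift_ι_apply k _ x

theorem quillenHat_mem_one (x : GrLieHat k G) :
    quillenHat k G x ∈ GrHat.filtration k (augIdeal k G) 1 := fun j hj => by
  obtain rfl : j = 0 := by omega
  exact quillenPiece_zero k G (x 0)

theorem grLift_mem {n : ℕ} {u : UniversalEnvelopingAlgebra k (GrLieHat k G)}
    (hu : u ∈ pow k (envAug k (GrLieHat k G)) n) :
    grLift k G u ∈ GrHat.filtration k (augIdeal k G) n :=
  env_pow_mem k (GrHat.filtration k (augIdeal k G)) (GrHat.mem_filtration_zero k _)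
    (GrHat.mul_mem_filtration k _) _ (fun x => by
      rw [grLift_ι]
      exact quillenHat_mem_one k G x) n hu

theorem algebraMap_apply_zero (c : k) :
    (algebraMap k (GrGroupAlgebraHat k G) c) 0 =
      Gr.mk k _ 0 ⟨algebraMap k (MonoidAlgebra k G) c, mem_pow_zero k _ _⟩ := by
  rw [Algebra.algebraMap_eq_smul_one]
  change c • (1 : GrGroupAlgebraHat k G) 0 = _
  rw [GrHat.one_zero, ← map_smul]
  exact congrArg (Gr.mk k _ 0) (Subtype.ext (Algebra.algebraMap_eq_smul_one c).symm)

theorem exists_grLift {n : ℕ} {a : MonoidAlgebra k G} (ha : a ∈ pow k (augIdeal k G) n) :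
    ∃ u ∈ pow k (envAug k (GrLieHat k G)) n, grLift k G u n = Gr.mk k _ n ⟨a, ha⟩ := by
  suffices H : ∃ ha, ∃ u ∈ pow k (envAug k (GrLieHat k G)) n,
      grLift k G u n = Gr.mk k _ n ⟨a, ha⟩ from H.2
  refine pow_induction k (augIdeal k G) (P := fun n a => ∃ ha,
    ∃ u ∈ pow k (envAug k (GrLieHat k G)) n, grLift k G u n = Gr.mk k (augIdeal k G) n ⟨a, ha⟩)
    (fun a => ?_) ?_ ?_ ha
  · refine ⟨mem_pow_zero k _ _, algebraMap k _ ((groupHopf k G).counit a), mem_pow_zero k _ _, ?_⟩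
    rw [AlgHom.commutes, algebraMap_apply_zero]
    refine Gr.mk_eq_mk k _ ?_
    rw [← neg_mem_iff, neg_sub]
    exact (mem_pow_one k _).2 ((groupHopf k G).sub_counit_mem a)
  · rintro n a - b - ⟨ha, u, hu, hua⟩ ⟨hb, v, hv, hvb⟩
    refine ⟨add_mem ha hb, u + v, add_mem hu hv, ?_⟩
    rw [map_add]
    change grLift k G u n + grLift k G v n = _
    rw [hua, hvb, ← map_add]
    rfl
  · rintro n a - b hb ⟨ha, u, hu, hua⟩
    have hb' := (mem_pow_one k (augIdeal k G)).2 hb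
    obtain ⟨z, hz⟩ := mk_mem_range_quillenPiece_one k G hb'
    refine ⟨mul_mem_pow k _ ha hb', u * ι k (GrLieHat.single k G 1 z),
      mul_mem_pow k _ hu ((mem_pow_one k _).2 (ι_mem_envAug k _)), ?_⟩
    rw [map_mul, grLift_ι, GrHat.mul_apply_of_mem k _ rfl (grLift_mem k G hu)
      (quillenHat_mem_one k G _), hua]
    change Gr.mul k _ _ _ (quillenPiece k G 1 (GrLieHat.single k G 1 z 1)) = _
    rw [GrLieHat.single_same, hz]
    rfl

theorem one_notMem_grFiltration : (1 : GrGroupAlgebraHat k G) ∉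
    GrHat.filtration k (augIdeal k G) 1 := fun h => by
  have h1 := h 0 one_pos
  rw [GrHat.one_zero, Gr.mk_eq_zero_iff, mem_pow_one] at h1
  have : Bialgebra.counitAlgHom k (MonoidAlgebra k G) 1 = 0 := h1
  rw [map_one] at this
  exact one_ne_zero this

variable [Group.FG G]

/-- The strictness criterion with homogeneous components as test maps. Injectivity of Quillen's map
pulls the filtration back to the graded Lie algebra, where it lies in the lower central series. -/
theorem mem_pow_of_grLift_mem {n : ℕ} {u : UniversalEnvelopingAlgebra k (GrLieHat k G)}
    (hu : grLift k G u ∈ GrHat.filtration k (augIdeal k G) n) :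
    u ∈ pow k (envAug k (GrLieHat k G)) n := by
  refine env_mem_pow_of_map_mem k (GrHat.filtration k (augIdeal k G))
    (GrHat.filtration_antitone k _) (quillenHat k G) (fun _ _ => grLift_mem k G)
    (V := Gr k (augIdeal k G)) (GrHat.component k _) (fun i x hx => hx i i.lt_succ_self)
    (fun i x hx h j hj => ?_) (one_notMem_grFiltration k G)
    (fun n y hy => grLieHat_filtration_le_lieGamma k G n fun j hj => ?_) (fun i j u hu => ?_) hu
  · rcases Nat.lt_succ_iff_lt_or_eq.1 hj with hj | rfl
    · exact hx j hj
    · exact h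
  · refine quillenPiece_injective k G j ?_
    rw [map_zero]
    exact hy j hj
  · refine (map_envComul_eq_grComul k G LieHom.id u i j).trans ?_
    rw [grComul_apply _ rfl]
    refine (congrArg _ (hu (i + j) (Nat.lt_succ_self _))).trans (map_zero _)

/-- The map `grEnv`, as a map of algebras. -/
def grEnvAlg : EnvHat k (GrLieHat k G) →ₐ[k] GrGroupAlgebraHat k G :=
  GrHat.extendAlg k _ _ (grLift k G) fun _ _ => grLift_mem k G

theorem grEnv_toCompletion (u : UniversalEnvelopingAlgebra k (GrLieHat k G)) :
    grEnv k G (toCompletion k _ u) = grLift k G u := rfl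

theorem grEnv_mem {n : ℕ} {x : EnvHat k (GrLieHat k G)}
    (hx : x ∈ Completion.filtration k (envAug k (GrLieHat k G)) n) :
    grEnv k G x ∈ GrHat.filtration k (augIdeal k G) n := GrHat.extend_mem k _ _ _ _ hx

theorem grEnv_mem_iff {n : ℕ} {x : EnvHat k (GrLieHat k G)} :
    grEnv k G x ∈ GrHat.filtration k (augIdeal k G) n ↔
      x ∈ Completion.filtration k (envAug k (GrLieHat k G)) n := by
  obtain ⟨u, hu⟩ := Completion.exists_toCompletion k (envAug k (GrLieHat k G)) n x
  refine ⟨fun h => ?_, grEnv_mem k G⟩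
  have h1 := sub_mem h (grEnv_mem k G hu)
  rw [map_sub, sub_sub_cancel, grEnv_toCompletion] at h1
  have h2 := (Completion.toCompletion_mem k _).2 (mem_pow_of_grLift_mem k G h1)
  have := add_mem hu h2
  rwa [sub_add_cancel] at this

theorem grEnv_bijective : Function.Bijective (grEnv k G) := by
  refine ⟨(injective_iff_map_eq_zero _).2 fun x hx => ?_, fun y => ?_⟩
  · refine Completion.separated k _ x fun n => (grEnv_mem_iff k G).1 ?_
    rw [hx]
    exact zero_mem _
  · obtain ⟨x, -, hx⟩ := exists_preimage_of_gr_surjective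
      (Completion.seriesConverge k (envAug k (GrLieHat k G))) (GrHat.separated k (augIdeal k G))
      (grEnv k G) (fun n x hx => (grEnv_mem_iff k G).2 hx)
      (fun n y hy => by
        obtain ⟨⟨a, ha⟩, hya⟩ := Submodule.mkQ_surjective _ (y n)
        obtain ⟨u, hu, hua⟩ := exists_grLift k G ha
        refine ⟨toCompletion k _ u, (Completion.toCompletion_mem k _).2 hu, fun j hj => ?_⟩
        rw [grEnv_toCompletion]
        rcases Nat.lt_succ_iff_lt_or_eq.1 hj with hj | rfl
        · exact sub_mem hy (grLift_mem k G hu) j hj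
        · change y j - grLift k G u j = 0
          rw [hua, ← hya, sub_self])
      (GrHat.filtration_antitone k _) (GrHat.mem_filtration_zero k _ y)
    exact ⟨x, hx⟩

end GradedEnveloping

/-! ### A Taylor expansion induces an isomorphism of complete Hopf algebras. -/

section Expansions

open UniversalEnvelopingAlgebra

variable {k G : Type*} [Field k] [Group G]

namespace TaylorExpansion

variable (E : TaylorExpansion k G)

/-- The map `Ê`, as a map of algebras. -/
def hatAlg : GroupAlgebraHat k G →ₐ[k] GrGroupAlgebraHat k G :=
  GrHat.extendAlg k _ _ E.linearExtension E.filtered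

theorem hat_toCompletion (a : MonoidAlgebra k G) :
    E.hat (toCompletion k _ a) = E.linearExtension a := rfl

theorem linearExtension_of (g : G) : E.linearExtension (MonoidAlgebra.of k G g) = E.toHom g :=
  MonoidAlgebra.lift_of _ g

theorem hat_mem {n : ℕ} {x : GroupAlgebraHat k G}
    (hx : x ∈ Completion.filtration k (augIdeal k G) n) :
    E.hat x ∈ GrHat.filtration k (augIdeal k G) n := GrHat.extend_mem k _ _ _ _ hx

theorem hat_apply_of_hasSymbol {n : ℕ} {x : GroupAlgebraHat k G} {s : Gr k (augIdeal k G) n}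
    (hx : HasSymbol k _ n x s) : E.hat x n = s := by
  obtain ⟨⟨a, ha⟩, rfl⟩ := Submodule.mkQ_surjective _ s
  change GrHat.extendLevel k _ _ _ E.filtered n.lt_succ_self (Completion.proj k _ (n + 1) x) = _
  rw [show Completion.proj k _ (n + 1) x = _ from hx]
  exact E.gr_eq_id n ⟨a, ha⟩

/-- Since gr(Ê) = id, the symbol of x is the degree n component of Ê(x), so Ê cannot lower the order
of x any further. -/
theorem hat_mem_iff {n : ℕ} {x : GroupAlgebraHat k G} :
    E.hat x ∈ GrHat.filtration k (augIdeal k G) n ↔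
      x ∈ Completion.filtration k (augIdeal k G) n := by
  refine ⟨fun h => ?_, E.hat_mem⟩
  induction n with
  | zero => exact Completion.mem_filtration_zero k _ x
  | succ n ih =>
    obtain ⟨s, hs⟩ := exists_hasSymbol (ih (GrHat.filtration_antitone k _ (Nat.le_succ n) h))
    rw [← hasSymbol_zero_iff]
    have : s = 0 := (E.hat_apply_of_hasSymbol hs).symm.trans (h n n.lt_succ_self)
    rwa [this] at hs

theorem hat_bijective : Function.Bijective E.hat := by
  refine ⟨(injective_iff_map_eq_zero _).2 fun x hx => ?_, fun y => ?_⟩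
  · refine Completion.separated k _ x fun n => E.hat_mem_iff.1 ?_
    rw [hx]
    exact zero_mem _
  · obtain ⟨x, -, hx⟩ := exists_preimage_of_gr_surjective
      (Completion.seriesConverge k (augIdeal k G)) (GrHat.separated k (augIdeal k G))
      E.hat (fun n x => E.hat_mem)
      (fun n y hy => by
        obtain ⟨⟨a, ha⟩, hya⟩ := Submodule.mkQ_surjective _ (y n)
        have hmem := (Completion.toCompletion_mem k _).2 ha
        refine ⟨toCompletion k _ a, hmem, fun j hj => ?_⟩
        rcases Nat.lt_succ_iff_lt_or_eq.1 hj with hj | rfl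
        · exact sub_mem hy (E.hat_mem hmem) j hj
        · change y j - E.hat (toCompletion k _ a) j = 0
          rw [← hya, sub_eq_zero]
          exact (E.gr_eq_id j ⟨a, ha⟩).symm)
      (GrHat.filtration_antitone k _) (GrHat.mem_filtration_zero k _ y)
    exact ⟨x, hx⟩

/-- The component (i, j) only sees x modulo the 2N-th term, so x may be taken in kG. There both
sides are linear and agree on group elements, which are group-like on both sides. -/
theorem grComul_hat (x : GroupAlgebraHat k G) :
    grComul k G (E.hat x) = E.hatTensor (completedComul k G x) := by
  funext i j
  let N := i + j + 1
  obtain ⟨a, ha⟩ := Completion.exists_toCompletion k (augIdeal k G) (2 * N) x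
  have h1 : grComul k G (E.hat x) i j = grComul k G (E.linearExtension a) i j := by
    rw [grComul_apply _ rfl, grComul_apply _ rfl, ← hat_toCompletion]
    refine congrArg _ (sub_eq_zero.1 ?_)
    have := E.hat_mem ha (i + j) (by omega)
    rw [map_sub] at this
    exact this
  rw [Completion.mem_filtration, map_sub, sub_eq_zero] at ha
  have h2 : CompletedTensor.proj k _ N (completedComul k G x) =
      Algebra.TensorProduct.map (Ideal.Quotient.mkₐ k (augIdeal k G ^ N))
        (Ideal.Quotient.mkₐ k (augIdeal k G ^ N))
        (Bialgebra.comulAlgHom k (MonoidAlgebra k G) a) := by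
    rw [proj_completedComul, ha, Completion.proj_toCompletion, comulLevel_mk]
  rw [h1]
  change _ = TensorProduct.map _ _ (CompletedTensor.proj k _ N (completedComul k G x))
  rw [h2]
  clear h1 h2 ha
  induction a using MonoidAlgebra.induction_on with
  | of g =>
    rw [linearExtension_of, E.groupLike, comul_of, Algebra.TensorProduct.map_tmul,
      TensorProduct.map_tmul, ← linearExtension_of]
    rfl
  | add a b ha hb =>
    rw [map_add, map_add, map_add, map_add, map_add]
    exact congrArg₂ (· + ·) ha hb
  | smul c a ha =>
    rw [map_smul, map_smul, map_smul, map_smul, map_smul]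
    exact congrArg (c • ·) ha

theorem isHopfIso : E.IsHopfIso where
  bijective := E.hat_bijective
  map_one := map_one E.hatAlg
  map_mul := map_mul E.hatAlg
  map_comul := E.grComul_hat
  mem_filtration_iff _ _ := E.hat_mem_iff
  gr_eq_id _ _ _ hx := E.hat_apply_of_hasSymbol hx

theorem hatTensor_apply (t : CompletedTensor k (augIdeal k G)) (i j : ℕ) :
    E.hatTensor t i j = TensorProduct.map
      (GrHat.extendLevel k _ _ E.linearExtension.toLinearMap E.filtered
        (n := i) (N := i + j + 1) (by omega))
      (GrHat.extendLevel k _ _ E.linearExtension.toLinearMap E.filtered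
        (n := j) (N := i + j + 1) (by omega)) (CompletedTensor.proj k _ (i + j + 1) t) := rfl

theorem extendLevel_one {n N : ℕ} (h : n < N) :
    GrHat.extendLevel k _ _ E.linearExtension.toLinearMap E.filtered h 1 =
      (1 : GrGroupAlgebraHat k G) n := by
  have h1 := GrHat.extendLevel_proj k _ _ E.linearExtension.toLinearMap E.filtered h 1
  rw [map_one] at h1
  exact h1.trans (congrFun (map_one E.hatAlg) n)

theorem hatTensor_inl (x : GroupAlgebraHat k G) :
    E.hatTensor (CompletedTensor.inl k _ x) = GrTensor.tmul k _ (E.hat x) 1 := by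
  funext i j
  rw [hatTensor_apply, CompletedTensor.proj_inl, TensorProduct.map_tmul]
  exact congrArg₂ (· ⊗ₜ[k] ·) (GrHat.extendLevel_proj k _ _ _ E.filtered _ x) (E.extendLevel_one _)

theorem hatTensor_inr (x : GroupAlgebraHat k G) :
    E.hatTensor (CompletedTensor.inr k _ x) = GrTensor.tmul k _ 1 (E.hat x) := by
  funext i j
  rw [hatTensor_apply, CompletedTensor.proj_inr, TensorProduct.map_tmul]
  exact congrArg₂ (· ⊗ₜ[k] ·) (E.extendLevel_one _) (GrHat.extendLevel_proj k _ _ _ E.filtered _ x)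

theorem hat_mem_grPrimitives (x : malcev k G) :
    E.hat (x : GroupAlgebraHat k G) ∈ grPrimitives k G := by
  change grComul k G (E.hat (x : GroupAlgebraHat k G)) = _
  rw [grComul_hat, (mem_malcev k G).1 x.2, map_add, hatTensor_inl, hatTensor_inr]

end TaylorExpansion

end Expansions

/-! ### Taylor expansions and filtered Lie algebra isomorphisms. -/

section Correspondence

open UniversalEnvelopingAlgebra

variable {k G : Type*} [Field k] [CharZero k] [Group G] [Group.FG G]

namespace TaylorExpansion

variable (E : TaylorExpansion k G)

theorem exists_quillenHat_eq (x : malcev k G) :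
    ∃ y, quillenHat k G y = E.hat (x : GroupAlgebraHat k G) := by
  have := E.hat_mem_grPrimitives x
  rwa [← range_quillenHat] at this

/-- The restriction of `Ê` to primitive elements. -/
def lieHom : malcev k G →ₗ⁅k⁆ GrLieHat k G where
  toFun x := (E.exists_quillenHat_eq x).choose
  map_add' x y := quillenHat_injective k G (by
    rw [map_add, (E.exists_quillenHat_eq x).choose_spec, (E.exists_quillenHat_eq y).choose_spec,
      (E.exists_quillenHat_eq (x + y)).choose_spec]
    exact map_add E.hat (x : GroupAlgebraHat k G) y)
  map_smul' c x := quillenHat_injective k G (by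
    rw [RingHom.id_apply, map_smul, (E.exists_quillenHat_eq x).choose_spec,
      (E.exists_quillenHat_eq (c • x)).choose_spec]
    exact map_smul E.hat c (x : GroupAlgebraHat k G))
  map_lie' {x y} := quillenHat_injective k G (by
    rw [LieHom.map_lie, (E.exists_quillenHat_eq x).choose_spec,
      (E.exists_quillenHat_eq y).choose_spec, (E.exists_quillenHat_eq ⁅x, y⁆).choose_spec]
    change E.hatAlg ((x : GroupAlgebraHat k G) * y - y * x) =
      E.hatAlg (x : GroupAlgebraHat k G) * E.hatAlg (y : GroupAlgebraHat k G) -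
        E.hatAlg (y : GroupAlgebraHat k G) * E.hatAlg (x : GroupAlgebraHat k G)
    rw [map_sub, map_mul, map_mul])

theorem quillenHat_lieHom (x : malcev k G) :
    quillenHat k G (E.lieHom x) = E.hat (x : GroupAlgebraHat k G) :=
  (E.exists_quillenHat_eq x).choose_spec

theorem lieHom_mem {n : ℕ} {x : malcev k G} (hx : x ∈ malcevFiltration k G n) :
    E.lieHom x ∈ GrLieHat.filtration k G n := fun j hj => by
  refine quillenPiece_injective k G j ?_
  rw [map_zero]
  exact (congrFun (E.quillenHat_lieHom x) j).trans (E.hat_mem hx j hj)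

theorem lieHom_apply_of_hasSymbol {n : ℕ} {x : malcev k G} {s : Gr k (augIdeal k G) n}
    (hx : HasSymbol k _ n (x : GroupAlgebraHat k G) s) : quillenPiece k G n (E.lieHom x n) = s :=
  (congrFun (E.quillenHat_lieHom x) n).trans (E.hat_apply_of_hasSymbol hx)

/-- Injectivity is inherited from Ê. For surjectivity, each homogeneous class of positive degree is
the symbol of a Malcev element, and completeness of m sums the corrections. -/
theorem lieHom_bijective : Function.Bijective E.lieHom := by
  refine ⟨fun x y h => ?_, fun y => ?_⟩
  · refine Subtype.ext (E.hat_bijective.1 ?_)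
    rw [← quillenHat_lieHom, ← quillenHat_lieHom, h]
  · obtain ⟨x, -, hx⟩ := exists_preimage_of_gr_surjective (malcev_seriesConverge k G)
      (grLieHat_separated k G) (E.lieHom : malcev k G →ₗ[k] GrLieHat k G)
      (fun n x hx => E.lieHom_mem hx)
      (fun n y hy => by
        -- Degree 0 of the graded Lie algebra is zero: Quillen's map is injective and zero there.
        rcases Nat.eq_zero_or_pos n with rfl | hn
        · refine ⟨0, zero_mem _, fun j hj => ?_⟩
          obtain rfl : j = 0 := by omega
          refine quillenPiece_injective k G 0 ?_
          rw [quillenPiece_zero, quillenPiece_zero]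
        · obtain ⟨x, hx⟩ := exists_malcev_symbol k G hn (y n)
          refine ⟨x, hx.mem, fun j hj => ?_⟩
          rcases Nat.lt_succ_iff_lt_or_eq.1 hj with hj | rfl
          · exact sub_mem hy (E.lieHom_mem hx.mem) j hj
          · change y j - E.lieHom x j = 0
            rw [sub_eq_zero]
            exact quillenPiece_injective k G j (E.lieHom_apply_of_hasSymbol hx).symm)
      (GrLieHat.filtration_antitone k G) (n := 0) (y := y) (fun j hj => absurd hj j.not_lt_zero)
    exact ⟨x, hx⟩

/-- The isomorphism of Lie algebras corresponding to a Taylor expansion. -/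
def toLieIso : FilteredLieIso k G where
  toEquiv := LieEquiv.ofBijective E.lieHom E.lieHom_bijective
  filtered _ _ hx := E.lieHom_mem hx
  gr_eq_id _ _ _ hx := E.lieHom_apply_of_hasSymbol hx

theorem quillenHat_toLieIso (x : malcev k G) :
    quillenHat k G (E.toLieIso.toEquiv x) = E.hat (x : GroupAlgebraHat k G) :=
  E.quillenHat_lieHom x

end TaylorExpansion

theorem envHatMap_toCompletion {L L' : Type*} [LieRing L] [LieAlgebra k L] [LieRing L']
    [LieAlgebra k L'] (f : L →ₗ⁅k⁆ L') (u : UniversalEnvelopingAlgebra k L) :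
    envHatMap k f (toCompletion k _ u) = toCompletion k _ (envMap k f u) :=
  Completion.extend_toCompletion k _ _ _ _ u

theorem envHatMap_mem {L L' : Type*} [LieRing L] [LieAlgebra k L] [LieRing L'] [LieAlgebra k L']
    (f : L →ₗ⁅k⁆ L') {n : ℕ} {x : EnvHat k L} (hx : x ∈ Completion.filtration k (envAug k L) n) :
    envHatMap k f x ∈ Completion.filtration k (envAug k L') n :=
  Completion.extend_mem k _ _ _ _ hx

namespace FilteredLieIso

variable (α : FilteredLieIso k G)

/-- The map of algebras from the completed group algebra to the completed associated graded algebra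
which extends `α`. -/
def algHom : GroupAlgebraHat k G →ₐ[k] GrGroupAlgebraHat k G :=
  ((grEnvAlg k G).comp (envHatMap k α.toEquiv.toLieHom)).comp
    (AlgEquiv.ofBijective (malcevEnv k G) (malcevEnv_bijective k G)).symm.toAlgHom

theorem algHom_malcevEnv (u : EnvHat k (malcev k G)) :
    α.algHom (malcevEnv k G u) = grEnv k G (envHatMap k α.toEquiv.toLieHom u) := by
  change grEnv k G (envHatMap k α.toEquiv.toLieHom ((AlgEquiv.ofBijective (malcevEnv k G)
    (malcevEnv_bijective k G)).symm (AlgEquiv.ofBijective (malcevEnv k G)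
      (malcevEnv_bijective k G) u))) = _
  rw [AlgEquiv.symm_apply_apply]

theorem algHom_mem {n : ℕ} {x : GroupAlgebraHat k G}
    (hx : x ∈ Completion.filtration k (augIdeal k G) n) :
    α.algHom x ∈ GrHat.filtration k (augIdeal k G) n := by
  obtain ⟨u, rfl⟩ := (malcevEnv_bijective k G).2 x
  rw [algHom_malcevEnv]
  exact grEnv_mem k G (envHatMap_mem _ ((malcevEnv_mem_iff k G).1 hx))

theorem algHom_malcevLift (u : UniversalEnvelopingAlgebra k (malcev k G)) :
    α.algHom (malcevLift k G u) = lift k ((quillenHat k G).comp α.toEquiv.toLieHom) u := by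
  rw [← malcevEnv_toCompletion, algHom_malcevEnv, envHatMap_toCompletion, grEnv_toCompletion]
  have : (grLift k G).comp (envMap k α.toEquiv.toLieHom) =
      lift k ((quillenHat k G).comp α.toEquiv.toLieHom) := by
    refine hom_ext k (LieHom.ext fun x => ?_)
    change grLift k G (envMap k α.toEquiv.toLieHom (ι k x)) = lift k _ (ι k x)
    rw [envMap, lift_ι_apply, lift_ι_apply]
    exact grLift_ι k G _
  exact DFunLike.congr_fun this u

theorem algHom_coe (x : malcev k G) :
    α.algHom (x : GroupAlgebraHat k G) = quillenHat k G (α.toEquiv x) := by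
  rw [← malcevLift_ι, algHom_malcevLift, lift_ι_apply]
  rfl

/-- The hypothesis on α only concerns symbols of primitive elements, but all classes of degree one
are such, and they generate gr(kG). -/
theorem algHom_toCompletion {n : ℕ} {a : MonoidAlgebra k G} (ha : a ∈ pow k (augIdeal k G) n) :
    α.algHom (toCompletion k _ a) n = Gr.mk k _ n ⟨a, ha⟩ := by
  suffices H : ∃ ha, α.algHom (toCompletion k _ a) n = Gr.mk k _ n ⟨a, ha⟩ from H.2
  have h1 : ∀ a (ha : a ∈ pow k (augIdeal k G) 1),
      α.algHom (toCompletion k _ a) 1 = Gr.mk k _ 1 ⟨a, ha⟩ := fun a ha => by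
    obtain ⟨z, hz⟩ := mk_mem_range_quillenPiece_one k G ha
    obtain ⟨x, hx⟩ := exists_malcev_symbol k G one_pos z
    rw [hz] at hx
    have h2 := α.algHom_mem hx.sub_mem 1 Nat.one_lt_two
    rw [map_sub, algHom_coe] at h2
    exact (sub_eq_zero.1 h2).symm.trans (α.gr_eq_id 1 ⟨a, ha⟩ x hx)
  refine pow_induction k (augIdeal k G) (P := fun n a => ∃ ha,
    α.algHom (toCompletion k _ a) n = Gr.mk k (augIdeal k G) n ⟨a, ha⟩) (fun a => ?_) ?_ ?_ ha
  · refine ⟨mem_pow_zero k _ _, ?_⟩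
    let c := (groupHopf k G).counit a
    have hc := (mem_pow_one k _).2 ((groupHopf k G).sub_counit_mem a)
    have h2 := α.algHom_mem ((Completion.toCompletion_mem k _).2 hc) 0 one_pos
    rw [map_sub, map_sub, AlgHom.commutes, AlgHom.commutes] at h2
    refine (sub_eq_zero.1 h2).trans ?_
    rw [algebraMap_apply_zero]
    refine Gr.mk_eq_mk k _ ?_
    rw [← neg_mem_iff, neg_sub]
    exact hc
  · rintro n a - b - ⟨ha, hua⟩ ⟨hb, hvb⟩
    refine ⟨add_mem ha hb, ?_⟩
    rw [map_add, map_add]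
    change α.algHom (toCompletion k _ a) n + α.algHom (toCompletion k _ b) n = _
    rw [hua, hvb, ← map_add]
    rfl
  · rintro n a - b hb ⟨ha, hua⟩
    have hb' := (mem_pow_one k (augIdeal k G)).2 hb
    refine ⟨mul_mem_pow k _ ha hb', ?_⟩
    rw [map_mul, map_mul, GrHat.mul_apply_of_mem k _ rfl
      (α.algHom_mem ((Completion.toCompletion_mem k _).2 ha))
      (α.algHom_mem ((Completion.toCompletion_mem k _).2 hb')), hua, h1 b hb']
    rfl

/-- Comultiplications are respected on U(m), where the map is the lift of q ∘ α. As the image of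
U(m) is dense, this holds on the whole completion, in particular at the group-like element g. -/
theorem grComul_algHom_of (g : G) :
    grComul k G (α.algHom (toCompletion k _ (MonoidAlgebra.of k G g))) =
      GrTensor.tmul k _ (α.algHom (toCompletion k _ (MonoidAlgebra.of k G g)))
        (α.algHom (toCompletion k _ (MonoidAlgebra.of k G g))) := by
  funext i j
  let N := i + j + 1
  let φ : MonoidAlgebra k G →ₗ[k] GrGroupAlgebraHat k G :=
    (α.algHom.comp (toCompletion k (augIdeal k G))).toLinearMap
  have hφ : ∀ n, ∀ b ∈ augIdeal k G ^ n, φ b ∈ GrHat.filtration k (augIdeal k G) n :=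
    fun n b hb => α.algHom_mem ((Completion.toCompletion_mem k _).2 hb)
  -- The homogeneous components of the map, factored through kG/I^N, so that their tensor product is
  -- defined on level N of the completed tensor square.
  let p : ∀ i, i < N → (MonoidAlgebra k G ⧸ augIdeal k G ^ N) →ₗ[k] Gr k (augIdeal k G) i :=
    fun i hi => GrHat.extendLevel k _ _ φ hφ hi
  have hp : ∀ i hi x, p i hi (Completion.proj k _ N x) = α.algHom x i := fun i hi x => by
    refine (GrHat.extendLevel_proj k _ _ φ hφ hi x).trans (congrFun ?_ i)
    refine eq_of_filtered k _ (augIdeal k G) (f := GrHat.extend k _ _ φ hφ)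
      (g := α.algHom.toLinearMap) (fun n x => GrHat.extend_mem k _ _ φ hφ)
      (fun n x => α.algHom_mem) fun n => ?_
    obtain ⟨a, ha⟩ := Completion.exists_toCompletion k (augIdeal k G) n x
    exact ⟨_, ha, rfl⟩
  have hi : i < N := by omega
  have hj : j < N := by omega
  -- x is replaced by the image of some u in U(m) to precision 2N, and the claim becomes
  -- `map_envComul_eq_grComul` for u.
  have key : ∀ x : GroupAlgebraHat k G, grComul k G (α.algHom x) i j =
      TensorProduct.map (p i hi) (p j hj)
        (CompletedTensor.proj k _ N (completedComul k G x)) := fun x => by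
    obtain ⟨u, hu⟩ := exists_malcevLift_sub_mem k G x (2 * N)
    have h1 : grComul k G (α.algHom x) i j = grComul k G (α.algHom (malcevLift k G u)) i j := by
      rw [grComul_apply _ rfl, grComul_apply _ rfl]
      refine congrArg _ (sub_eq_zero.1 ?_)
      have := α.algHom_mem hu (i + j) (by omega)
      rw [map_sub] at this
      exact this
    rw [Completion.mem_filtration, map_sub, sub_eq_zero] at hu
    rw [h1, proj_completedComul, hu, ← proj_completedComul, proj_completedComul_malcevLift,
      algHom_malcevLift, ← map_envComul_eq_grComul]
    generalize envComul k (malcev k G) u = t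
    induction t using TensorProduct.induction_on with
    | zero => simp only [map_zero]
    | add s t hs ht => simp only [map_add, hs, ht]
    | tmul a b =>
      rw [TensorProduct.map_tmul, TensorProduct.map_tmul, TensorProduct.map_tmul]
      refine congrArg₂ (· ⊗ₜ[k] ·) ?_ ?_
      · exact (congrFun (α.algHom_malcevLift a) i).symm.trans (hp i hi _).symm
      · exact (congrFun (α.algHom_malcevLift b) j).symm.trans (hp j hj _).symm
  rw [key, proj_completedComul, Completion.proj_toCompletion, comulLevel_mk, comul_of,
    Algebra.TensorProduct.map_tmul, TensorProduct.map_tmul]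
  exact congrArg₂ (· ⊗ₜ[k] ·) (hp i hi (toCompletion k _ (MonoidAlgebra.of k G g)))
    (hp j hj (toCompletion k _ (MonoidAlgebra.of k G g)))

theorem lift_algHom : MonoidAlgebra.lift k (GrGroupAlgebraHat k G) G
      (((α.algHom.comp (toCompletion k (augIdeal k G)) : MonoidAlgebra k G →* _)).comp
        (MonoidAlgebra.of k G)) = α.algHom.comp (toCompletion k (augIdeal k G)) :=
  monoidAlgebra_hom_ext fun g => MonoidAlgebra.lift_of _ g

/-- The Taylor expansion corresponding to an isomorphism of Lie algebras. -/
def toTaylor : TaylorExpansion k G where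
  toHom := ((α.algHom.comp (toCompletion k (augIdeal k G)) : MonoidAlgebra k G →* _)).comp
    (MonoidAlgebra.of k G)
  filtered n a ha := by
    rw [lift_algHom]
    exact α.algHom_mem ((Completion.toCompletion_mem k _).2 ha)
  gr_eq_id n a := by
    rw [lift_algHom]
    exact α.algHom_toCompletion a.2
  groupLike g := α.grComul_algHom_of g

theorem hat_toTaylor (x : GroupAlgebraHat k G) : α.toTaylor.hat x = α.algHom x :=
  eq_of_filtered k _ (augIdeal k G) (f := α.toTaylor.hat) (g := α.algHom.toLinearMap)
    (fun _ _ => α.toTaylor.hat_mem) (fun _ _ => α.algHom_mem) fun n => by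
      obtain ⟨a, ha⟩ := Completion.exists_toCompletion k (augIdeal k G) n x
      exact ⟨_, ha, DFunLike.congr_fun α.lift_algHom a⟩

theorem toLieIso_toTaylor : α.toTaylor.toLieIso = α := by
  refine FilteredLieIso.ext (LieEquiv.ext fun x => quillenHat_injective k G ?_)
  rw [TaylorExpansion.quillenHat_toLieIso, hat_toTaylor, algHom_coe]

end FilteredLieIso

/-- Both are filtered algebra maps with the same restriction to m; they agree on the image of U(m),
which is dense. -/
theorem TaylorExpansion.algHom_toLieIso (E : TaylorExpansion k G) (x : GroupAlgebraHat k G) :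
    E.toLieIso.algHom x = E.hat x := by
  refine eq_of_filtered k _ (augIdeal k G) (f := E.toLieIso.algHom.toLinearMap) (g := E.hat)
    (fun _ _ => E.toLieIso.algHom_mem) (fun _ _ => E.hat_mem) fun n => ?_
  obtain ⟨u, hu⟩ := exists_malcevLift_sub_mem k G x n
  refine ⟨_, hu, ?_⟩
  have : E.toLieIso.algHom.comp (malcevLift k G) = E.hatAlg.comp (malcevLift k G) := by
    refine hom_ext k (LieHom.ext fun x => ?_)
    change E.toLieIso.algHom (malcevLift k G (ι k x)) = E.hat (malcevLift k G (ι k x))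
    rw [malcevLift_ι, FilteredLieIso.algHom_coe, quillenHat_toLieIso]
  exact DFunLike.congr_fun this u

variable (k G) in
/-- The correspondence between Taylor expansions and isomorphisms of filtered Lie algebras. -/
def taylorEquiv : TaylorExpansion k G ≃ FilteredLieIso k G where
  toFun := TaylorExpansion.toLieIso
  invFun := FilteredLieIso.toTaylor
  left_inv E := TaylorExpansion.ext (MonoidHom.ext fun g =>
    (E.algHom_toLieIso (toCompletion k _ (MonoidAlgebra.of k G g))).trans (E.linearExtension_of g))
  right_inv := FilteredLieIso.toLieIso_toTaylor

end Correspondence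

end TaylorExp

end

theorem theorem5p1 (k G : Type*) [Field k] [CharZero k] [Group G] [Group.FG G] :
    (Function.Injective (TaylorExp.quillenHat k G) ∧
      Set.range (TaylorExp.quillenHat k G) = TaylorExp.grPrimitives k G) ∧
    Function.Bijective (TaylorExp.malcevEnv k G) ∧
    Function.Bijective (TaylorExp.grEnv k G) ∧
    ∃ Φ : TaylorExp.TaylorExpansion k G ≃ TaylorExp.FilteredLieIso k G,
      (∀ E : TaylorExp.TaylorExpansion k G,
        E.IsHopfIso ∧
        ∀ x : TaylorExp.malcev k G,
          TaylorExp.quillenHat k G ((Φ E).toEquiv x) = E.hat (x : TaylorExp.GroupAlgebraHat k G)) ∧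
      (∀ (α : TaylorExp.FilteredLieIso k G) (u : TaylorExp.EnvHat k (TaylorExp.malcev k G)),
        (Φ.symm α).hat (TaylorExp.malcevEnv k G u) =
          TaylorExp.grEnv k G (TaylorExp.envHatMap k α.toEquiv.toLieHom u)) :=
  ⟨⟨TaylorExp.quillenHat_injective k G, TaylorExp.range_quillenHat k G⟩,
    TaylorExp.malcevEnv_bijective k G, TaylorExp.grEnv_bijective k G, TaylorExp.taylorEquiv k G,
    fun E => ⟨E.isHopfIso, E.quillenHat_toLieIso⟩,
    fun α u => (α.hat_toTaylor _).trans (α.algHom_malcevEnv u)⟩
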